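/- Let $3\le n<\omega$. \textbf{Conventions.} For an ordinal $\alpha$, let $\mathsf{Sc}_\alpha,\mathsf{CA}_\alpha,\mathsf{PA}_\alpha,\mathsf{PEA}_\alpha$ denote the classes of Pinter's substitution algebras, cylindric algebras, polyadic algebras and polyadic equality algebras of dimension $\alpha$. These are Boolean algebras with extra operations: cylindrifications $\mathsf c_i$ ($i<\alpha$) in all four cases; diagonals $\mathsf d_{ij}$ for $\mathsf{CA}$ and $\mathsf{PEA}$; substitutions $\mathsf s_\tau$, where $\tau$ ranges over the replacements $[i/j]$ for $\mathsf{Sc}$ and over all finitary maps $\tau:\alpha\to\alpha$ for $\mathsf{PA}$ and $\mathsf{PEA}$ (so for infinite $\alpha$ these are the quasi-polyadic algebras $\mathsf{QA}_\alpha,\mathsf{QEA}_\alpha$). $\mathsf{Rd}_{Sc}$ is the reduct to the signature of $\mathsf{Sc}$. For $n<\beta$ and a class $\mathsf M$ of algebras of dimension $\beta$, $\mathsf{Nr}_n\mathsf M$ is the class of (isomorphic copies of) neat reducts of members of $\mathsf M$, the neat reduct of $D$ having universe $\{a\in D:\mathsf c_ia=a\text{ for }n\le i<\beta\}$. $S_c\mathsf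 M$ is the class of (isomorphic copies of) complete subalgebras of members of $\mathsf M$; $A\subseteq B$ is complete if for all $X\subseteq A$, $\sum^AX=1$ implies $\sum^BX=1$. An algebra of dimension $n$ is completely representable if it has an embedding $f$ into the algebra of all subsets of a non-empty disjoint union $V=\bigcup_{i\in I}{}^nU_i$ (with non-empty $U_i$ and the set-theoretic operations) such that $f(\prod X)=\bigcap f[X]$ whenever $\prod X$ exists. A class is elementary if it is defined by a set of first-order sentences. \textbf{The rainbow algebra $\mathfrak C_n$.} The edge colours are the greens $\mathsf g_i$ ($1\le i\le n-2$) and $\mathsf g_0^t$ ($t\in\mathbb N$), the whites $\mathsf w_i$ ($0\le i\le n-2$) and the reds $\mathsf r_{kl}$ ($k,l\in\mathbb N$). A coloured graph $M$ is a complete graph each of whose edges has a colour $M(x,y)$, with $M(y,x)=M(x,y)$ unless $M(x,y)=\mathsf r_{kl}$, in which case $M(y,x)=\mathsf r_{lk}$, and some of whose $(n-1)$-tuples have a shade of yellow $\mathsf y_S$, where $S\subseteq\mathbb N$ is finite or $S=\mathbb N$, such that for all distinct nodes $x,y,z$: (1) the edges $xy$, $yz$, $xz$ are not all green; (2) not $M(x,y)=M(x,z)=\mathsf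 g_i$ and $M(y,z)=\mathsf w_i$, for $1\le i\le n-2$; (3) not $M(x,y)=\mathsf g_0^j$, $M(x,z)=\mathsf g_0^k$ and $M(y,z)=\mathsf w_0$; (4) if $M(x,y)=\mathsf g_0^i$, $M(x,z)=\mathsf g_0^j$ and $M(y,z)=\mathsf r_{kl}$, then $\{(i,k),(j,l)\}$ is an order-preserving partial function from $\mathbb N$ with the reversed order to $\mathbb N$ with the usual order (that is, $i=j$ implies $k=l$, $j<i$ implies $k<l$, and $i<j$ implies $l<k$); (5) if $M(x,y)=\mathsf r_{ij}$, $M(y,z)=\mathsf r_{j'k}$ and $M(x,z)=\mathsf r_{i'k'}$, then $i=i'$, $j=j'$ and $k=k'$; and moreover: (6) an $(n-1)$-tuple has a shade of yellow, and then exactly one, if and only if its entries are distinct and no edge between them is green; (7) if $(a_0,\dots,a_{n-2})$ has shade $\mathsf y_S$ and $z$ is a node with $M(a_0,z)=\mathsf g_0^t$ and $M(a_j,z)=\mathsf g_j$ for $1\le j\le n-2$, then $t\in S$. Consider surjections $a:n\to M$ onto coloured graphs; identify $a$ and $b$ if $a(i)=a(j)\Leftrightarrow b(i)=b(j)$ for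 all $i,j$ and the colours of corresponding edges and $(n-1)$-tuples coincide. $\mathfrak C_n$ is the complex algebra on the set of all sets of classes $[a]$, with $\mathsf c_iX=\{[a]:\exists [b]\in X,\ a\text{ and }b\text{ agree (up to this identification) on }n\setminus\{i\}\}$, $\mathsf d_{ij}=\{[a]:a(i)=a(j)\}$ and $\mathsf s_\tau X=\{[a]:[a\circ\tau]\in X\}$. \textbf{Theorem.} $\mathfrak C_n$ is an atomic algebra in $\mathsf{PEA}_n$ with countably many atoms, and $\mathsf{Rd}_{Sc}\mathfrak C_n\notin S_c\mathsf{Nr}_n\mathsf{Sc}_{n+3}$. Yet there is a countable atomic $\mathfrak B\in S_c\mathsf{Nr}_n\mathsf{QEA}_\omega$ that is completely representable and elementarily equivalent to $\mathfrak C_n$. Moreover, for each $\mathsf K\in\{\mathsf{Sc},\mathsf{CA},\mathsf{PA},\mathsf{PEA}\}$, no class $\mathsf L$ with $S_c\mathsf{Nr}_n\mathsf K_\omega\subseteq\mathsf L\subseteq S_c\mathsf{Nr}_n\mathsf K_{n+3}$ is elementary, and the class of completely representable algebras in $\mathsf K_n$ is not elementary. -/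

import Mathlib

/-! ### Dimensions, substitutions and the four kinds of algebras -/

/-- The replacement `[i/j]`: it sends `i` to `j` and fixes everything else. -/
noncomputable def repl {ι : Type} (i j : ι) : ι → ι :=
  open Classical in fun k => if k = i then j else k

/-- A transformation is finitary if it moves only finitely many points. -/
def Finitary {ι : Type} (τ : ι → ι) : Prop := {i | τ i ≠ i}.Finite

theorem finitary_repl {ι : Type} (i j : ι) : Finitary (repl i j) := by
  refine (Set.finite_singleton i).subset fun k hk => ?_
  by_contra h
  exact hk (by simp [repl, show k ≠ i from h])

/-- Pinter's substitution algebras, cylindric algebras, (quasi-)polyadic algebras and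
(quasi-)polyadic equality algebras. -/
inductive Kind : Type
  | Sc
  | CA
  | PA
  | PEA

/-- The kinds of algebras that have diagonal elements. -/
def Kind.HasDiag : Kind → Prop
  | .Sc => False
  | .CA => True
  | .PA => False
  | .PEA => True

/-- `k.HasSubst τ`: the substitution operator `s_τ` belongs to the signature. For `Sc` these are the
replacements, for `PA` and `PEA` all finitary transformations (all transformations if the dimension
is finite). -/
def Kind.HasSubst {ι : Type} : Kind → (ι → ι) → Prop
  | .Sc, τ => ∃ i j, τ = repl i j
  | .CA, _ => False
  | .PA, τ => Finitary τ
  | .PEA, τ => Finitary τ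

universe u

/-- A Boolean algebra with the extra operations of kind `k` in dimension `ι`:
cylindrifications `c_i`, diagonal elements `d_ij` and substitutions `s_τ`, the latter two as far as
they belong to the signature. No law for the extra operations is required here. -/
structure Alg (k : Kind) (ι : Type) : Type (u + 1) where
  carrier : Type u
  [ba : BooleanAlgebra carrier]
  c : ι → carrier → carrier
  d : k.HasDiag → ι → ι → carrier
  s : ∀ τ : ι → ι, k.HasSubst τ → carrier → carrier

instance {k : Kind} {ι : Type} : CoeSort (Alg.{u} k ι) (Type u) := ⟨Alg.carrier⟩

instance {k : Kind} {ι : Type} (A : Alg.{u} k ι) : BooleanAlgebra A := A.ba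

/-! ### The axioms -/

/-- The `c_i` are commuting quantifiers. -/
structure QuantifierLaws {ι : Type} {A : Type u} [BooleanAlgebra A] (c : ι → A → A) : Prop where
  c_bot : ∀ i, c i ⊥ = ⊥
  le_c : ∀ i x, x ≤ c i x
  c_inf_c : ∀ i x y, c i (x ⊓ c i y) = c i x ⊓ c i y
  c_comm : ∀ i j x, c i (c j x) = c j (c i x)

/-- The axioms of substitution algebras; `s i j` is the operator `s_[i/j]`. -/
structure SubstitutionLaws {ι : Type} {A : Type u} [BooleanAlgebra A]
    (c : ι → A → A) (s : ι → ι → A → A) : Prop extends QuantifierLaws c where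
  s_self : ∀ i x, s i i x = x
  s_sup : ∀ i j x y, s i j (x ⊔ y) = s i j x ⊔ s i j y
  s_compl : ∀ i j x, s i j xᶜ = (s i j x)ᶜ
  s_c : ∀ i j x, s i j (c i x) = c i x
  c_s : ∀ i j x, i ≠ j → c i (s i j x) = s i j x
  s_c_comm : ∀ i j k x, k ≠ i → k ≠ j → s i j (c k x) = c k (s i j x)
  c_s_swap : ∀ i j x, c i (s j i x) = c j (s i j x)
  s_s_comm : ∀ i j k l x, i ≠ j → i ≠ k → i ≠ l → j ≠ k → j ≠ l → k ≠ l →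
    s j i (s l k x) = s l k (s j i x)
  s_s : ∀ i j l x, s l i (s j l x) = s l i (s j i x)

/-- The axioms of cylindric algebras. -/
structure CylindricLaws {ι : Type} {A : Type u} [BooleanAlgebra A]
    (c : ι → A → A) (d : ι → ι → A) : Prop extends QuantifierLaws c where
  d_self : ∀ i, d i i = ⊤
  d_eq : ∀ i j k, k ≠ i → k ≠ j → d i j = c k (d i k ⊓ d k j)
  c_d : ∀ i j x, i ≠ j → c i (d i j ⊓ x) ⊓ c i (d i j ⊓ xᶜ) = ⊥

/-- The axioms of (quasi-)polyadic algebras. -/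
structure PolyadicLaws {ι : Type} {A : Type u} [BooleanAlgebra A]
    (c : ι → A → A) (s : ∀ τ : ι → ι, Finitary τ → A → A) : Prop extends QuantifierLaws c where
  s_sup : ∀ τ hτ x y, s τ hτ (x ⊔ y) = s τ hτ x ⊔ s τ hτ y
  s_compl : ∀ τ hτ x, s τ hτ xᶜ = (s τ hτ x)ᶜ
  s_id : ∀ h x, s id h x = x
  s_comp : ∀ σ τ hσ hτ h x, s (σ ∘ τ) h x = s σ hσ (s τ hτ x)
  s_c_congr : ∀ σ τ hσ hτ i x, (∀ j, j ≠ i → σ j = τ j) → s σ hσ (c i x) = s τ hτ (c i x)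
  c_s_of_notMem : ∀ τ hτ i x, (∀ j, τ j ≠ i) → c i (s τ hτ x) = s τ hτ x
  c_s_of_unique : ∀ τ hτ i j x, (∀ l, τ l = i ↔ l = j) → c i (s τ hτ x) = s τ hτ (c j x)

/-- The axioms of (quasi-)polyadic equality algebras. -/
structure PolyadicEqualityLaws {ι : Type} {A : Type u} [BooleanAlgebra A]
    (c : ι → A → A) (d : ι → ι → A) (s : ∀ τ : ι → ι, Finitary τ → A → A) : Prop
    extends PolyadicLaws c s where
  d_self : ∀ i, d i i = ⊤
  s_d : ∀ τ hτ i j, s τ hτ (d i j) = d (τ i) (τ j)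
  inf_d_le : ∀ i j x, x ⊓ d i j ≤ s (repl i j) (finitary_repl i j) x

/-- `variety k ι` is the class `K_ι` of all algebras of kind `k` and dimension `ι`. -/
def variety : ∀ (k : Kind) (ι : Type), Set (Alg.{u} k ι)
  | .Sc, _ => {A | SubstitutionLaws A.c fun i j => A.s (repl i j) ⟨i, j, rfl⟩}
  | .CA, _ => {A | CylindricLaws A.c (A.d trivial)}
  | .PA, _ => {A | PolyadicLaws A.c fun τ hτ => A.s τ hτ}
  | .PEA, _ => {A | PolyadicEqualityLaws A.c (A.d trivial) fun τ hτ => A.s τ hτ}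

/-! ### Homomorphisms and reducts -/

structure IsHom {k : Kind} {ι : Type} {A B : Alg.{u} k ι} (f : A → B) : Prop where
  map_bot : f ⊥ = ⊥
  map_top : f ⊤ = ⊤
  map_compl : ∀ x, f xᶜ = (f x)ᶜ
  map_sup : ∀ x y, f (x ⊔ y) = f x ⊔ f y
  map_inf : ∀ x y, f (x ⊓ y) = f x ⊓ f y
  map_c : ∀ i x, f (A.c i x) = B.c i (f x)
  map_d : ∀ h i j, f (A.d h i j) = B.d h i j
  map_s : ∀ τ h x, f (A.s τ h x) = B.s τ h (f x)

/-- The `Sc`-reduct of an algebra with all finitary substitutions and diagonals. -/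
def Alg.rdSc {ι : Type} (A : Alg.{u} .PEA ι) : Alg.{u} .Sc ι where
  carrier := A
  c := A.c
  d := fun h => h.elim
  s := fun τ h => A.s τ (by obtain ⟨i, j, rfl⟩ := h; exact finitary_repl i j)

/-- A transformation of the smaller dimension, extended by the identity to the larger one. -/
noncomputable def extendMap {ι κ : Type} (e : ι ↪ κ) (τ : ι → ι) : κ → κ :=
  Function.extend e (e ∘ τ) id

theorem extendMap_apply {ι κ : Type} (e : ι ↪ κ) (τ : ι → ι) (i : ι) :
    extendMap e τ (e i) = e (τ i) := e.injective.extend_apply _ _ _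

theorem extendMap_of_notMem {ι κ : Type} (e : ι ↪ κ) (τ : ι → ι) (j : κ) (hj : ¬ ∃ i, e i = j) :
    extendMap e τ j = j := Function.extend_apply' _ _ _ hj

theorem finitary_extendMap {ι κ : Type} (e : ι ↪ κ) {τ : ι → ι} (h : Finitary τ) :
    Finitary (extendMap e τ) := by
  refine (h.image e).subset fun j hj => ?_
  by_cases hx : ∃ i, e i = j
  · obtain ⟨i, rfl⟩ := hx
    refine ⟨i, fun hi => hj ?_, rfl⟩
    rw [extendMap_apply, hi]
  · exact absurd (extendMap_of_notMem e τ j hx) hj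

theorem extendMap_repl {ι κ : Type} (e : ι ↪ κ) (i j : ι) :
    extendMap e (repl i j) = repl (e i) (e j) := by
  funext l
  by_cases hx : ∃ m, e m = l
  · obtain ⟨m, rfl⟩ := hx
    rw [extendMap_apply]
    by_cases hm : m = i <;> simp [repl, hm]
  · rw [extendMap_of_notMem e _ l hx]
    have : l ≠ e i := fun h => hx ⟨i, h.symm⟩
    simp [repl, this]

theorem Kind.HasSubst.extendMap {ι κ : Type} (e : ι ↪ κ) {k : Kind} {τ : ι → ι}
    (h : k.HasSubst τ) : k.HasSubst (extendMap e τ) := by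
  cases k with
  | Sc => obtain ⟨i, j, rfl⟩ := h; exact ⟨e i, e j, extendMap_repl e i j⟩
  | CA => exact h
  | PA => exact finitary_extendMap e h
  | PEA => exact finitary_extendMap e h

/-- The reduct of a `κ`-dimensional algebra to the dimensions in `ι`, where `e : ι ↪ κ`. -/
noncomputable def Alg.dimReduct {k : Kind} {ι κ : Type} (e : ι ↪ κ) (D : Alg.{u} k κ) :
    Alg.{u} k ι where
  carrier := D
  c := fun i => D.c (e i)
  d := fun h i j => D.d h (e i) (e j)
  s := fun τ h => D.s (extendMap e τ) (h.extendMap e)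

/-- The class `Nr_ι K` of (isomorphic copies of) neat reducts of members of a class `K` of
`κ`-dimensional algebras: the neat reduct of `D` consists of the `a` with `c_j a = a` for all
dimensions `j` outside `ι`, with the operations induced from `D`. -/
def Nr {k : Kind} {ι κ : Type} (e : ι ↪ κ) (K : Set (Alg.{u} k κ)) : Set (Alg.{u} k ι) :=
  {B | ∃ D ∈ K, ∃ g : B → D.dimReduct e, Function.Injective g ∧ IsHom g ∧
    Set.range g = {a | ∀ j : κ, j ∉ Set.range e → D.c j a = a}}

/-- The class `S_c K` of (isomorphic copies of) complete subalgebras of members of `K`. -/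
def completeSub {k : Kind} {ι : Type} (K : Set (Alg.{u} k ι)) : Set (Alg.{u} k ι) :=
  {A | ∃ B ∈ K, ∃ f : A → B, Function.Injective f ∧ IsHom f ∧
    ∀ X : Set A, IsLUB X ⊤ → IsLUB (f '' X) ⊤}

/-! ### Complete representations -/

/-- The full set algebra on a set `V` of `ι`-sequences, with the operations relativized to `V`. -/
def setAlg (k : Kind) {ι : Type} {U : Type u} (V : Set (ι → U)) : Alg.{u} k ι where
  carrier := Set V
  c := fun i X => {s | ∃ t ∈ X, ∀ j, j ≠ i → t.1 j = s.1 j}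
  d := fun _ i j => {s | s.1 i = s.1 j}
  s := fun τ _ X => {s | ∃ t ∈ X, t.1 = s.1 ∘ τ}

/-- `V` is a disjoint union of a non-empty family of full Cartesian spaces `ι → U_i` with
non-empty bases `U_i`. -/
def IsGeneralizedSpace {ι : Type} {U : Type u} (V : Set (ι → U)) : Prop :=
  ∃ (I : Type u) (W : I → Set U), Nonempty I ∧ (∀ i, (W i).Nonempty) ∧
    Pairwise (fun i j => Disjoint (W i) (W j)) ∧ V = {s | ∃ i, ∀ j, s j ∈ W i}

/-- A representation that turns every existing (possibly infinite) meet into an intersection. -/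
def CompletelyRepresentable {k : Kind} {ι : Type} (A : Alg.{u} k ι) : Prop :=
  ∃ (U : Type u) (V : Set (ι → U)), IsGeneralizedSpace V ∧
    ∃ f : A → setAlg k V, Function.Injective f ∧ IsHom f ∧
      ∀ (X : Set A) (a : A), IsGLB X a → IsGLB (f '' X) (f a)

/-- The class of completely representable algebras of kind `k` and dimension `ι`. -/
def completelyRepresentables (k : Kind) (ι : Type) : Set (Alg.{u} k ι) :=
  {A | A ∈ variety k ι ∧ CompletelyRepresentable A}

/-! ### First-order logic of the algebras -/

/-- The operation symbols of kind `k` in dimension `ι`, indexed by their arity. -/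
inductive OpSymbol (k : Kind) (ι : Type) : ℕ → Type
  | bot : OpSymbol k ι 0
  | top : OpSymbol k ι 0
  | compl : OpSymbol k ι 1
  | sup : OpSymbol k ι 2
  | inf : OpSymbol k ι 2
  | c (i : ι) : OpSymbol k ι 1
  | d (h : k.HasDiag) (i j : ι) : OpSymbol k ι 0
  | s (τ : ι → ι) (h : k.HasSubst τ) : OpSymbol k ι 1

def algLang (k : Kind) (ι : Type) : FirstOrder.Language where
  Functions := OpSymbol k ι
  Relations := fun _ => Empty

instance {k : Kind} {ι : Type} (A : Alg.{u} k ι) : (algLang k ι).Structure A where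
  funMap := fun o x => match o, x with
    | .bot, _ => (⊥ : A)
    | .top, _ => (⊤ : A)
    | .compl, x => (x 0 : A)ᶜ
    | .sup, x => (x 0 : A) ⊔ x 1
    | .inf, x => (x 0 : A) ⊓ x 1
    | .c i, x => A.c i (x 0)
    | .d h i j, _ => A.d h i j
    | .s τ h, x => A.s τ h (x 0)
  RelMap := fun r => r.elim

/-- A class of algebras is elementary if it is defined by a set of first-order sentences. -/
def IsElementary {k : Kind} {ι : Type} (K : Set (Alg.{u} k ι)) : Prop :=
  ∃ T : (algLang k ι).Theory, ∀ A : Alg.{u} k ι, A ∈ K ↔ FirstOrder.Language.Theory.Model A T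

/-! ### The rainbow algebra -/

/-- Edge colours: `green i` is `g_i` (for `1 ≤ i ≤ n - 2`), `tinted t` is `g_0^t`, `white i` is `w_i`
(for `0 ≤ i ≤ n - 2`) and `red k l` is `r_kl`. -/
inductive Colour : Type
  | green (i : ℕ)
  | tinted (t : ℕ)
  | white (i : ℕ)
  | red (k l : ℕ)

/-- The colours that are available in dimension `n`. -/
def Colour.Available (n : ℕ) : Colour → Prop
  | .green i => 1 ≤ i ∧ i ≤ n - 2
  | .tinted _ => True
  | .white i => i ≤ n - 2
  | .red _ _ => True

def Colour.IsGreen : Colour → Prop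
  | .green _ => True
  | .tinted _ => True
  | .white _ => False
  | .red _ _ => False

/-- The colour of an edge traversed backwards: only the indices of reds are directed. -/
def Colour.rev : Colour → Colour
  | .red k l => .red l k
  | x => x

/-- `{(i, k), (j, l)}` is an order preserving partial function from `ℕ` with the reversed order to
`ℕ` with the usual order. -/
def OrderSynchronized (i j k l : ℕ) : Prop :=
  (i = j → k = l) ∧ (j < i → k < l) ∧ (i < j → l < k)

/-- The colour of the edge from the `j`-th base point of a cone of tint `t` to its apex. -/
def coneColour (t : ℕ) : ℕ → Colour
  | 0 => .tinted t
  | j + 1 => .green (j + 1)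

/-- Coloured graphs: complete graphs on `V` with coloured edges (`edge x y = none` if `x = y`), in
which some `(n-1)`-tuples carry a shade of yellow `y_S`, here given by `S`. -/
structure ColouredGraph (n : ℕ) (V : Type) where
  edge : V → V → Option Colour
  yellow : (Fin (n - 1) → V) → Option (Set ℕ)
  edge_eq_none : ∀ x y, edge x y = none ↔ x = y
  edge_symm : ∀ x y, edge y x = (edge x y).map Colour.rev
  edge_available : ∀ x y a, edge x y = some a → a.Available n
  not_green_green_green : ∀ x y z a b c, edge x y = some a → edge y z = some b →
    edge x z = some c → ¬ (a.IsGreen ∧ b.IsGreen ∧ c.IsGreen)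
  not_green_green_white : ∀ x y z i, ¬ (edge x y = some (.green i) ∧ edge x z = some (.green i) ∧
    edge y z = some (.white i))
  not_tinted_tinted_white : ∀ x y z j k, ¬ (edge x y = some (.tinted j) ∧
    edge x z = some (.tinted k) ∧ edge y z = some (.white 0))
  tinted_tinted_red : ∀ x y z i j k l, edge x y = some (.tinted i) → edge x z = some (.tinted j) →
    edge y z = some (.red k l) → OrderSynchronized i j k l
  red_red_red : ∀ x y z i j j' k i' k', edge x y = some (.red i j) → edge y z = some (.red j' k) →
    edge x z = some (.red i' k') → i = i' ∧ j = j' ∧ k = k'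
  yellow_isSome : ∀ a, (yellow a).isSome ↔
    Function.Injective a ∧ ∀ i j b, edge (a i) (a j) = some b → ¬ b.IsGreen
  yellow_shade : ∀ a S, yellow a = some S → S.Finite ∨ S = Set.univ
  yellow_cone : ∀ a S z t, yellow a = some S →
    (∀ j : Fin (n - 1), edge (a j) z = some (coneColour t j)) → t ∈ S

/-- The atoms of the rainbow algebra: surjections `a` from `n` onto a coloured graph `M`, up to the
identification of `a` and `b` whenever `a i = a j ↔ b i = b j` for all `i, j` and all the colours of
edges and tuples agree. The class of `a` is given by the colourings of `M` pulled back along `a`;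
`edge i j = none` says that `a i = a j`. -/
structure RainbowAtom (n : ℕ) where
  edge : Fin n → Fin n → Option Colour
  yellow : (Fin (n - 1) → Fin n) → Option (Set ℕ)
  exists_graph : ∃ (V : Type) (M : ColouredGraph n V) (a : Fin n → V), Function.Surjective a ∧
    (∀ i j, edge i j = M.edge (a i) (a j)) ∧ ∀ t, yellow t = M.yellow (a ∘ t)

/-- The rainbow algebra: the complex algebra of the atom structure of all `RainbowAtom`s. Classes
`[a]`, `[b]` are related by the `i`-th accessibility relation if `a` and `b` agree outside `i`, `[a]`
lies in the diagonal `d_ij` if `a i = a j`, and `[a]` lies in `s_τ X` if `[a ∘ τ]` lies in `X`. -/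
def rainbowAlg (n : ℕ) : Alg.{0} .PEA (Fin n) where
  carrier := Set (RainbowAtom n)
  c := fun i X => {p | ∃ q ∈ X, (∀ j k, j ≠ i → k ≠ i → p.edge j k = q.edge j k) ∧
    ∀ t : Fin (n - 1) → Fin n, (∀ l, t l ≠ i) → p.yellow t = q.yellow t}
  d := fun _ i j => {p | p.edge i j = none}
  s := fun τ _ X => {p | ∃ q ∈ X, (∀ j k, q.edge j k = p.edge (τ j) (τ k)) ∧
    ∀ t : Fin (n - 1) → Fin n, q.yellow t = p.yellow (τ ∘ t)}

/-!
The two halves of the theorem, that `rainbowAlg n` is far from being representable and that an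
elementarily equivalent algebra is completely representable, come from one fact about orders. By the
triangle conditions, the red edges between the apexes of cones over one base reverse the order of
the tints: if the apexes of cones of tints `s < t` over that base are joined by a red edge `r_kl`,
then `l < k`. The tints and the red indices are both indexed by `ℕ`, and `ℕ` has no order reversing
map to itself; but a suitable countable set of nonstandard numbers has one.

*Non-membership.* Let `rainbowAlg n` be completely embedded in the neat reduct of a substitution
algebra of dimension `n + 3` (`RainbowNeatEmbedding`). The `coneAtom`s of all tints have the same
base, whose shade of yellow is `ℕ`, so in the larger algebra cones of any two tints can be put over
one base with their apexes at two of the three new coordinates. By completeness the edge between the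
apexes has some colour (`exists_edgeAt`), and this must be red (`exists_red_of_apexAt`). Adding a
third cone of larger tint at the remaining new coordinate, and forgetting the first one, lowers a
red index. So there is an infinite descent (`RainbowNeatEmbedding.descent`). It uses the operations
`c_i` and `s_[i/j]` only, which all four kinds of algebras have (`exists_substitutionLaws`), so it
refutes membership for each reduct.

*The completely representable algebra.* Take an ultrapower of the rainbow algebra over `ℕ`, whose
atoms are coloured graphs with nonstandard tints, red indices and shades, and in it a countable
elementary substructure `S` that is closed under reading off the colours of its atoms and forming
atoms from given colours, and that contains the number `m ↦ ⌊q m⌋` for each positive rational `q`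
(`exists_closedStar`, by `exists_elementarySubstructure_closed`). The numbers occurring in `S` form
a countable linear order that contains a copy of the rationals; hence every countable linear order,
in particular its own reverse, embeds in it. With such an order reversing map for the choice of red
indices, a coloured graph with colours from `S` can always be extended by a node in any way that is
locally admissible (`PG.Coherent.exists_ext`): the new edges that are not prescribed are white where
some white is possible, and otherwise they join two apexes over one base and their red indices are
read off from an index function kept for that base. A countable iteration gives graphs in which
every extension that an atom asks for is realized (`exists_saturatedGraph`), and the sequences in
these graphs represent `S` completely (`ClosedStar.completelyRepresentable_setAlgebra`). The
argument is carried out for `PG`, coloured graphs whose nodes may be listed with repetitions, and an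
arbitrary `Palette` of tints, red indices and shades, so that it applies to nonstandard colours.

*Consequences.* A complete representation of dimension `n` extends to one of any larger dimension by
using sequences of that length in the same bases, so that completely representable algebras are
complete subalgebras of neat reducts (`CompletelyRepresentable.mem_completeSub`). Reducts of
elementarily equivalent algebras are elementarily equivalent, so a class of complete subalgebras of
neat reducts from dimension `n + 3` that contains the reduct of the completely representable algebra
separates two elementarily equivalent algebras, as it does not contain that of the rainbow algebra
(`not_isElementary_of_elementarilyEquivalent`).
-/

/-! ### Palettes, triangles and coloured pre-graphs -/

/-- Edge colours with tints from `T` and reds indexed by pairs from `R`; `Colour` is the case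
`T = R = ℕ`. -/
inductive Col (T R : Type) : Type
  | green (i : ℕ)
  | tinted (t : T)
  | white (i : ℕ)
  | red (k l : R)

namespace Col

variable {T R : Type}

/-- The colour of an edge traversed backwards. -/
def rev : Col T R → Col T R
  | red k l => red l k
  | x => x

/-- The index of a green colour, which is `0` for all tinted greens. -/
def gidx : Col T R → Option ℕ
  | green i => some i
  | tinted _ => some 0
  | _ => none

/-- The colours that are available in dimension `n`. -/
def Avail (n : ℕ) : Col T R → Prop
  | green i => 1 ≤ i ∧ i ≤ n - 2
  | white i => i ≤ n - 2
  | _ => True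

/-- The plain and the tinted greens. -/
def IsGreen (a : Col T R) : Prop := a.gidx ≠ none

/-- The colour of the edge from the `j`-th base point of a cone of tint `t` to its apex. -/
def cone (t : T) : ℕ → Col T R
  | 0 => tinted t
  | j + 1 => green (j + 1)

@[simp] theorem rev_rev (a : Col T R) : a.rev.rev = a := by cases a <;> rfl

@[simp] theorem gidx_rev (a : Col T R) : a.rev.gidx = a.gidx := by cases a <;> rfl

@[simp] theorem gidx_cone (t : T) (j : ℕ) : (cone t j : Col T R).gidx = some j := by
  cases j <;> rfl

@[simp] theorem rev_cone (t : T) (j : ℕ) : (cone t j : Col T R).rev = cone t j := by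
  cases j <;> rfl

@[simp] theorem isGreen_rev (a : Col T R) : a.rev.IsGreen ↔ a.IsGreen := by
  simp [IsGreen]

theorem isGreen_cone (t : T) (j : ℕ) : (cone t j : Col T R).IsGreen := by
  simp [IsGreen]

theorem avail_rev {n : ℕ} {a : Col T R} (h : a.Avail n) : a.rev.Avail n := by
  cases a <;> exact h

theorem eq_green_of_gidx {n : ℕ} {a : Col T R} (ha : a.Avail n) {i : ℕ}
    (h : a.gidx = some (i + 1)) : a = green (i + 1) := by
  cases a <;> simp_all [gidx]

theorem eq_tinted_of_gidx {n : ℕ} {a : Col T R} (ha : a.Avail n)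
    (h : a.gidx = some 0) : ∃ t, a = tinted t := by
  cases a <;> simp_all [gidx, Avail]

end Col

/-- `{(i, k), (j, l)}` is an order reversing partial function. -/
def Sync {T R : Type} [LinearOrder T] [LinearOrder R] (i j : T) (k l : R) : Prop :=
  (i = j → k = l) ∧ (j < i → k < l) ∧ (i < j → l < k)

theorem Sync.symm {T R : Type} [LinearOrder T] [LinearOrder R] {i j : T} {k l : R}
    (h : Sync i j k l) : Sync j i l k :=
  ⟨fun e => (h.1 e.symm).symm, h.2.2, h.2.1⟩

/-- If the edges `xy`, `yz` and `xz` of a triangle are all red, then their indices are those of some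
`r_ij`, `r_jk` and `r_ik`. -/
def RedComp {T R : Type} : Col T R → Col T R → Col T R → Prop
  | .red i j, .red j' k, .red i' k' => i = i' ∧ j = j' ∧ k = k'
  | _, _, _ => True

theorem RedComp.rot {T R : Type} {a b c : Col T R} (h : RedComp a b c) : RedComp c b.rev a := by
  cases a <;> cases b <;> cases c <;> simp_all [RedComp, Col.rev]

theorem RedComp.flip {T R : Type} {a b c : Col T R} (h : RedComp a b c) : RedComp a.rev c b := by
  cases a <;> cases b <;> cases c <;> simp_all [RedComp, Col.rev]

section Tri

variable {T R : Type} [LinearOrder T] [LinearOrder R]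

/-- The condition on a triangle at the vertex `x`, for outgoing edges of colours `a` (to `y`) and
`c` (to `z`), and the opposite edge of colour `b` (from `y` to `z`). -/
def Vtx (a c : Col T R) : Col T R → Prop
  | .white i => ¬ (a.gidx = some i ∧ c.gidx = some i)
  | .red k l => ∀ s t, a = .tinted s → c = .tinted t → Sync s t k l
  | _ => True

/-- A triangle `x, y, z` with `xy` of colour `a`, `yz` of colour `b` and `xz` of colour `c` is
admissible. This bundles the conditions at all the vertices, so it is invariant under permutations
of the triangle. -/
structure Tri (a b c : Col T R) : Prop where
  not_green : ¬ (a.IsGreen ∧ b.IsGreen ∧ c.IsGreen)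
  vtx_x : Vtx a c b
  vtx_y : Vtx a.rev b c
  vtx_z : Vtx c.rev b.rev a
  red : RedComp a b c

theorem Vtx.swap {a b c : Col T R} (h : Vtx a c b) : Vtx c a b.rev := by
  cases b with
  | red k l => exact fun s t hs ht => (h t s ht hs).symm
  | white i => exact fun hh => h hh.symm
  | green i => exact h
  | tinted t => exact h

/-- Exchanging `y` and `z`. -/
theorem Tri.swap_yz {a b c : Col T R} (h : Tri a b c) : Tri c b.rev a where
  not_green := fun hh => h.not_green ⟨hh.2.2, by simpa using hh.2.1, hh.1⟩
  vtx_x := h.vtx_x.swap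
  vtx_y := h.vtx_z
  vtx_z := by simpa using h.vtx_y
  red := h.red.rot

/-- Exchanging `x` and `y`. -/
theorem Tri.swap_xy {a b c : Col T R} (h : Tri a b c) : Tri a.rev c b where
  not_green := fun hh => h.not_green ⟨by simpa using hh.1, hh.2.2, hh.2.1⟩
  vtx_x := h.vtx_y
  vtx_y := by simpa using h.vtx_x
  vtx_z := h.vtx_z.swap
  red := h.red.flip

end Tri

/-- The tints, red indices and shades of yellow of a class of coloured graphs. `mem t S` says that
cones of tint `t` are allowed over a base with shade `S`; only the shades with `ok S` may be used.
Every finite set of tints is required to be a shade. -/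
structure Palette where
  T : Type
  R : Type
  Sh : Type
  [ordT : LinearOrder T]
  [ordR : LinearOrder R]
  mem : T → Sh → Prop
  ok : Sh → Prop
  shade : Set T → Sh
  mem_shade : ∀ s, s.Finite → ∀ t, mem t (shade s) ↔ t ∈ s
  ok_shade : ∀ s, s.Finite → ok (shade s)

attribute [instance] Palette.ordT Palette.ordR

/-- Coloured pre-graphs: `e x y = none` is an equivalence relation that is compatible with the
colours, and the quotient is a coloured graph. Unlike coloured graphs they can be pulled back along
arbitrary maps. -/
structure PG (P : Palette) (n : ℕ) (V : Type) where
  e : V → V → Option (Col P.T P.R)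
  y : (Fin (n - 1) → V) → Option P.Sh
  e_self : ∀ x, e x x = none
  e_congr : ∀ x y z, e x y = none → e x z = e y z
  e_symm : ∀ x y, e y x = (e x y).map Col.rev
  e_avail : ∀ x y a, e x y = some a → a.Avail n
  tri : ∀ x y z a b c, e x y = some a → e y z = some b → e x z = some c → Tri a b c
  y_congr : ∀ s t, (∀ i, e (s i) (t i) = none) → y s = y t
  y_isSome : ∀ t, (y t).isSome ↔ ∀ i j, i ≠ j → ∃ a, e (t i) (t j) = some a ∧ ¬ a.IsGreen
  y_ok : ∀ t S, y t = some S → P.ok S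
  y_cone : ∀ t S z s, y t = some S → (∀ j, e (t j) z = some (Col.cone s j)) → P.mem s S

namespace PG

variable {P : Palette} {n : ℕ} {V W : Type}

@[ext] theorem ext {M N : PG P n V} (he : ∀ x y, M.e x y = N.e x y) (hy : ∀ t, M.y t = N.y t) :
    M = N := by
  cases M; cases N
  simp only [mk.injEq]
  exact ⟨funext fun x => funext fun y => he x y, funext hy⟩

/-- The pre-graph pulled back along a map of nodes. -/
def comap (f : W → V) (M : PG P n V) : PG P n W where
  e x y := M.e (f x) (f y)
  y t := M.y (f ∘ t)
  e_self _ := M.e_self _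
  e_congr _ _ _ h := M.e_congr _ _ _ h
  e_symm _ _ := M.e_symm _ _
  e_avail _ _ _ h := M.e_avail _ _ _ h
  tri _ _ _ _ _ _ := M.tri _ _ _ _ _ _
  y_congr _ _ h := M.y_congr _ _ h
  y_isSome _ := M.y_isSome _
  y_ok _ _ h := M.y_ok _ _ h
  y_cone _ _ _ _ h := M.y_cone _ _ _ _ h

theorem e_none_symm (M : PG P n V) {x y : V} (h : M.e x y = none) : M.e y x = none := by
  rw [M.e_symm, h]; rfl

theorem e_symm_some (M : PG P n V) {x y : V} {a} (h : M.e x y = some a) :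
    M.e y x = some a.rev := by
  rw [M.e_symm, h]; rfl

theorem e_congr_right (M : PG P n V) {x y : V} (h : M.e x y = none) (z : V) :
    M.e z x = M.e z y := by
  rw [M.e_symm x, M.e_symm y, M.e_congr _ _ _ h]

theorem e_congr_both (M : PG P n V) {x x' y y' : V} (h : M.e x x' = none) (h' : M.e y y' = none) :
    M.e x y = M.e x' y' := by
  rw [M.e_congr _ _ _ h, M.e_congr_right h']

/-- `M` and `N` agree on all nodes other than `j`. -/
def AgreeOff (j : V) (M N : PG P n V) : Prop :=
  (∀ k l, k ≠ j → l ≠ j → M.e k l = N.e k l) ∧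
    ∀ t : Fin (n - 1) → V, (∀ i, t i ≠ j) → M.y t = N.y t

/-- `z` is the apex of a cone of tint `t` with base `a`. -/
def Cone (M : PG P n V) (a : Fin (n - 1) → V) (z : V) (t : P.T) : Prop :=
  ∀ j, M.e (a j) z = some (Col.cone t j)

/-- To check the triangle condition it suffices to do it up to permutations of the nodes. -/
theorem tri_symm_closure {T R : Type} [LinearOrder T] [LinearOrder R]
    {e : Option V → Option V → Option (Col T R)}
    (hsymm : ∀ x y, e y x = (e x y).map Col.rev) (hnn : e none none = none)
    (h1 : ∀ x y z a b c, e (some x) (some y) = some a → e (some y) (some z) = some b →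
      e (some x) (some z) = some c → Tri a b c)
    (h2 : ∀ y z a b c, e none (some y) = some a → e (some y) (some z) = some b →
      e none (some z) = some c → Tri a b c) :
    ∀ x y z a b c, e x y = some a → e y z = some b → e x z = some c → Tri a b c := by
  intro x y z a b c ha hb hc
  have ha' : e y x = some a.rev := by rw [hsymm, ha]; rfl
  have hb' : e z y = some b.rev := by rw [hsymm, hb]; rfl
  have hc' : e z x = some c.rev := by rw [hsymm, hc]; rfl
  rcases x with _ | x <;> rcases y with _ | y <;> rcases z with _ | z <;>
    try (first | (rw [hnn] at ha; cases ha) | (rw [hnn] at hb; cases hb) | (rw [hnn] at hc; cases hc))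
  · exact h2 _ _ _ _ _ ha hb hc
  · simpa using (h2 _ _ _ _ _ ha' hc hb).swap_xy
  · simpa using (h2 _ _ _ _ _ hc' ha hb').swap_xy.swap_yz
  · exact h1 _ _ _ _ _ _ ha hb hc

end PG

/-! ### Adding a node to a pre-graph -/

/-- An extension problem: add to `M` a new node `c` that is related to the nodes `v k`, `k ≠ j`, as
`j` is to `k` in `H`. The pair `ρ x` indexes the red edge from `c` to `x` in case no white is
possible. -/
structure ExtProblem (P : Palette) (n : ℕ) (V : Type) where
  M : PG P n V
  H : PG P n (Fin n)
  v : Fin n → V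
  j : Fin n
  ρ : V → P.R × P.R
  agree : H.AgreeOff j (M.comap v)
  new : ∀ k, k ≠ j → H.e k j ≠ none

namespace ExtProblem

variable {P : Palette} {n : ℕ} {V : Type} (E : ExtProblem P n V)

/-- The node `x` of `M` is one of the nodes `v k`, `k ≠ j`, whose edge to the new node is given. -/
def Face (x : V) : Prop := ∃ k, k ≠ E.j ∧ E.M.e (E.v k) x = none

/-- The `i`-th white is possible between the new node and `x`. -/
def Free (x : V) (i : ℕ) : Prop :=
  i ≤ n - 2 ∧ ∀ k, k ≠ E.j → ∀ a b, E.H.e k E.j = some a → E.M.e (E.v k) x = some b →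
    ¬ (a.gidx = some i ∧ b.gidx = some i)

open Classical in
/-- The colour of the edge from the new node to `x`. -/
noncomputable def newEdge (x : V) : Option (Col P.T P.R) :=
  if h : E.Face x then E.H.e E.j h.choose
  else if ∃ i, E.Free x i then some (.white (sInf {i | E.Free x i}))
  else some (.red (E.ρ x).1 (E.ρ x).2)

/-- The edges of the extension; `none` is the new node. -/
noncomputable def edge : Option V → Option V → Option (Col P.T P.R)
  | none, none => none
  | none, some x => E.newEdge x
  | some x, none => (E.newEdge x).map Col.rev
  | some x, some y => E.M.e x y

theorem face_congr {x x' : V} (h : E.M.e x x' = none) (hx : E.Face x) : E.Face x' := by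
  obtain ⟨k, hk, hkx⟩ := hx
  exact ⟨k, hk, by rw [← E.M.e_congr_right h, hkx]⟩

theorem newEdge_face {x : V} {k : Fin n} (hk : k ≠ E.j) (hx : E.M.e (E.v k) x = none) :
    E.newEdge x = E.H.e E.j k := by
  have h : E.Face x := ⟨k, hk, hx⟩
  rw [newEdge, dif_pos h]
  have h2 := h.choose_spec
  refine E.H.e_congr_right ?_ _
  rw [E.agree.1 _ _ h2.1 hk]
  show E.M.e _ _ = none
  rw [E.M.e_congr _ _ _ h2.2]
  exact E.M.e_none_symm hx

theorem newEdge_ne_none (x : V) : E.newEdge x ≠ none := by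
  by_cases h : E.Face x
  · obtain ⟨k, hk, hx⟩ := h
    rw [E.newEdge_face hk hx]
    exact fun h => E.new k hk (E.H.e_none_symm h)
  · rw [newEdge, dif_neg h]
    split_ifs <;> simp

theorem free_congr {x x' : V} (h : E.M.e x x' = none) (i : ℕ) : E.Free x i ↔ E.Free x' i := by
  unfold Free
  simp only [E.M.e_congr_right h]

/-- Outside the face there are only whites, and reds if no white is possible. -/
theorem newEdge_not_face {x : V} (h : ¬ E.Face x) :
    (∃ i, E.Free x i ∧ E.newEdge x = some (.white i)) ∨
      ((∀ i, ¬ E.Free x i) ∧ E.newEdge x = some (.red (E.ρ x).1 (E.ρ x).2)) := by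
  by_cases h2 : ∃ i, E.Free x i
  · exact Or.inl ⟨_, Nat.sInf_mem (s := {i | E.Free x i}) h2, by rw [newEdge, dif_neg h, if_pos h2]⟩
  · exact Or.inr ⟨not_exists.1 h2, by rw [newEdge, dif_neg h, if_neg h2]⟩

theorem newEdge_congr {x x' : V} (hρ : ∀ x x', E.M.e x x' = none → E.ρ x = E.ρ x')
    (h : E.M.e x x' = none) : E.newEdge x = E.newEdge x' := by
  by_cases hx : E.Face x
  · obtain ⟨k, hk, hkx⟩ := hx
    rw [E.newEdge_face hk hkx, E.newEdge_face hk (by rw [← E.M.e_congr_right h, hkx])]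
  · have hx' : ¬ E.Face x' := fun h' => hx (E.face_congr (E.M.e_none_symm h) h')
    have hF : E.Free x = E.Free x' := funext fun i => propext (E.free_congr h i)
    rw [newEdge, newEdge, dif_neg hx, dif_neg hx', hF, hρ _ _ h]

/-- If no white is possible, then the face is the base of a cone with apex the new node, and of
another one with apex `x`. -/
theorem exists_cone_of_not_free (hn : 3 ≤ n) {x : V} (hx : ∀ i, ¬ E.Free x i) :
    ∃ (κ : Fin (n - 1) → Fin n) (s t : P.T), (∀ i, κ i ≠ E.j) ∧ E.H.Cone κ E.j s ∧
      E.M.Cone (E.v ∘ κ) x t := by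
  have h1 : ∀ i : Fin (n - 1), ∃ k, k ≠ E.j ∧ ∃ a b, E.H.e k E.j = some a ∧
      E.M.e (E.v k) x = some b ∧ a.gidx = some i.1 ∧ b.gidx = some i.1 := by
    intro i
    by_contra hcon
    refine hx i ⟨by omega, fun k hk a b ha hb hab => hcon ⟨k, hk, a, b, ha, hb, hab⟩⟩
  choose κ hκ a b ha hb hai hbi using h1
  obtain ⟨s, hs⟩ := Col.eq_tinted_of_gidx (E.H.e_avail _ _ _ (ha ⟨0, by omega⟩)) (hai _)
  obtain ⟨t, ht⟩ := Col.eq_tinted_of_gidx (E.M.e_avail _ _ _ (hb ⟨0, by omega⟩)) (hbi _)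
  refine ⟨κ, s, t, hκ, ?_, ?_⟩
  · rintro ⟨_ | i, hi⟩
    · rw [ha, hs]; rfl
    · rw [ha, Col.eq_green_of_gidx (E.H.e_avail _ _ _ (ha _)) (hai ⟨i + 1, hi⟩)]; rfl
  · rintro ⟨_ | i, hi⟩
    · exact (hb _).trans (by rw [ht]; rfl)
    · exact (hb _).trans (by
        rw [Col.eq_green_of_gidx (E.M.e_avail _ _ _ (hb _)) (hbi ⟨i + 1, hi⟩)]; rfl)

end ExtProblem

/-- Different base points of a cone are joined to the apex by different colours. -/
theorem PG.Cone.injective {P : Palette} {n : ℕ} {V : Type} {M : PG P n V} {a : Fin (n - 1) → V}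
    {z : V} {t : P.T} (h : M.Cone a z t) : Function.Injective a := by
  intro i i' hi
  have h1 := h i
  rw [hi, h i'] at h1
  have h2 := congrArg (fun o => o.bind Col.gidx) h1
  simp only [Option.bind_some, Col.gidx_cone, Option.some.injEq] at h2
  exact Fin.ext h2.symm

/-- An injection from `n - 1` points into `n` points that omits `j` hits everything else. -/
theorem exists_eq_of_injective_of_ne {n : ℕ} {κ : Fin (n - 1) → Fin n} (hκ : Function.Injective κ)
    {j : Fin n} (hj : ∀ i, κ i ≠ j) {k : Fin n} (hk : k ≠ j) : ∃ i, κ i = k := by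
  have h1 : Finset.univ.image κ = Finset.univ.erase j := by
    refine Finset.eq_of_subset_of_card_le ?_ ?_
    · intro x hx
      obtain ⟨i, -, rfl⟩ := Finset.mem_image.1 hx
      simp [hj i]
    · rw [Finset.card_image_of_injective _ hκ]; simp
  have h2 : k ∈ Finset.univ.image κ := by rw [h1]; simp [hk]
  obtain ⟨i, -, hi⟩ := Finset.mem_image.1 h2
  exact ⟨i, hi⟩

namespace ExtProblem

variable {P : Palette} {n : ℕ} {V : Type} (E : ExtProblem P n V)

/-- The conditions on `ρ` under which the new red edges violate no triangle condition: `ρ` respects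
the equivalence of nodes, reverses the order of the tints of the cones over the face, and fits the red
edges between the apexes that are there already. -/
structure GoodReds : Prop where
  congr : ∀ x x', E.M.e x x' = none → E.ρ x = E.ρ x'
  sync : ∀ (κ : Fin (n - 1) → Fin n) s t x, (∀ i, κ i ≠ E.j) → E.H.Cone κ E.j s →
    E.M.Cone (E.v ∘ κ) x t → Sync s t (E.ρ x).1 (E.ρ x).2
  comp : ∀ (κ : Fin (n - 1) → Fin n) s t t' x x' k l, (∀ i, κ i ≠ E.j) → E.H.Cone κ E.j s →
    E.M.Cone (E.v ∘ κ) x t → E.M.Cone (E.v ∘ κ) x' t' → E.M.e x x' = some (.red k l) →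
    (E.ρ x).1 = (E.ρ x').1 ∧ (E.ρ x).2 = k ∧ (E.ρ x').2 = l

/-- The base of the cone whose apex is the new node is unique. -/
theorem cone_unique (hn : 3 ≤ n) {κ κ' : Fin (n - 1) → Fin n} {s s' : P.T} (hκ : ∀ i, κ i ≠ E.j)
    (hκ' : ∀ i, κ' i ≠ E.j) (h : E.H.Cone κ E.j s) (h' : E.H.Cone κ' E.j s') :
    κ = κ' ∧ s = s' := by
  have h1 : κ = κ' := by
    funext i
    obtain ⟨i', hi'⟩ := exists_eq_of_injective_of_ne h'.injective hκ' (hκ i)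
    have h2 := h i
    rw [← hi', h' i'] at h2
    have h3 := congrArg (fun o => o.bind Col.gidx) h2
    simp only [Option.bind_some, Col.gidx_cone, Option.some.injEq] at h3
    rw [← hi', Fin.ext h3]
  subst h1
  have h2 := h ⟨0, by omega⟩
  rw [h' ⟨0, by omega⟩] at h2
  simp only [Option.some.injEq, Col.cone, Col.tinted.injEq] at h2
  exact ⟨rfl, h2.symm⟩

theorem edge_symm (x y : Option V) : E.edge y x = (E.edge x y).map Col.rev := by
  rcases x with _ | x <;> rcases y with _ | y
  · rfl
  · rfl
  · have h : (Col.rev ∘ Col.rev : Col P.T P.R → Col P.T P.R) = id := funext Col.rev_rev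
    simp [edge, h]
  · exact E.M.e_symm x y

theorem tri_of_face {y z : V} {a b c : Col P.T P.R} (hy : E.Face y) (hz : E.Face z)
    (ha : E.newEdge y = some a) (hb : E.M.e y z = some b) (hc : E.newEdge z = some c) :
    Tri a b c := by
  obtain ⟨k, hk, hky⟩ := hy
  obtain ⟨l, hl, hlz⟩ := hz
  rw [E.newEdge_face hk hky] at ha
  rw [E.newEdge_face hl hlz] at hc
  refine E.H.tri _ _ _ _ _ _ ha ?_ hc
  rw [E.agree.1 _ _ hk hl]
  show E.M.e _ _ = _
  rw [E.M.e_congr_both hky hlz, hb]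

theorem tri_of_face_of_not_face (hn : 3 ≤ n) (hE : E.GoodReds) {y z : V} {a b c : Col P.T P.R}
    (hy : E.Face y) (hz : ¬ E.Face z)
    (ha : E.newEdge y = some a) (hb : E.M.e y z = some b) (hc : E.newEdge z = some c) :
    Tri a b c := by
  obtain ⟨k, hk, hky⟩ := hy
  rw [E.newEdge_face hk hky] at ha
  have ha' := E.H.e_symm_some ha
  have hb' : E.M.e (E.v k) z = some b := by rw [E.M.e_congr _ _ _ hky, hb]
  rcases E.newEdge_not_face hz with ⟨i, hi, hc'⟩ | ⟨hf, hc'⟩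
  · rw [hc, Option.some.injEq] at hc'
    subst hc'
    have h1 := hi.2 k hk _ _ ha' hb'
    refine ⟨fun h => h.2.2 rfl, ?_, fun h => h1 h, ?_, ?_⟩
    · cases b <;> simp [Vtx, Col.gidx]
    · cases a <;> simp [Vtx, Col.gidx, Col.rev]
    · cases a <;> cases b <;> trivial
  · rw [hc, Option.some.injEq] at hc'
    subst hc'
    obtain ⟨κ, s, t, hκ, h1, h2⟩ := E.exists_cone_of_not_free hn hf
    obtain ⟨i, rfl⟩ := exists_eq_of_injective_of_ne h1.injective hκ hk
    rw [h1 i, Option.some.injEq] at ha'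
    obtain rfl : a = Col.cone s i := by rw [← Col.rev_rev a, ← ha', Col.rev_cone]
    have hb2 := h2 i
    rw [show (E.v ∘ κ) i = E.v (κ i) from rfl, hb', Option.some.injEq] at hb2
    subst hb2
    have hs := hE.sync κ s t z hκ h1 h2
    refine ⟨fun h => h.2.2 rfl, ?_, ?_, ?_, ?_⟩
    · rcases i with ⟨_ | i, hi⟩ <;> trivial
    · rcases i with ⟨_ | i, hi⟩
      · intro s' t' hs' ht'
        cases hs'; cases ht'; exact hs
      · intro s' t' hs'; cases hs'
    · rcases i with ⟨_ | i, hi⟩ <;> trivial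
    · rcases i with ⟨_ | i, hi⟩ <;> trivial

theorem tri_of_not_face (hn : 3 ≤ n) (hE : E.GoodReds) {y z : V} {a b c : Col P.T P.R}
    (hy : ¬ E.Face y) (hz : ¬ E.Face z)
    (ha : E.newEdge y = some a) (hb : E.M.e y z = some b) (hc : E.newEdge z = some c) :
    Tri a b c := by
  rcases E.newEdge_not_face hy with ⟨i, hi, ha'⟩ | ⟨hfy, ha'⟩ <;>
    rcases E.newEdge_not_face hz with ⟨i', hi', hc'⟩ | ⟨hfz, hc'⟩ <;>
    rw [ha, Option.some.injEq] at ha' <;> rw [hc, Option.some.injEq] at hc' <;> subst ha' <;>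
    subst hc'
  · refine ⟨fun h => h.1 rfl, ?_, ?_, ?_, ?_⟩ <;> cases b <;> simp [Vtx, Col.gidx, Col.rev, RedComp]
  · refine ⟨fun h => h.1 rfl, ?_, ?_, ?_, ?_⟩ <;> cases b <;> simp [Vtx, Col.gidx, Col.rev, RedComp]
  · refine ⟨fun h => h.1 rfl, ?_, ?_, ?_, ?_⟩ <;> cases b <;> simp [Vtx, Col.gidx, Col.rev, RedComp]
  · refine ⟨fun h => h.1 rfl, ?_, ?_, ?_, ?_⟩
    · cases b <;> simp [Vtx, Col.gidx]
    · simp [Vtx, Col.rev]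
    · simp [Vtx, Col.rev]
    · obtain ⟨κ, s, t, hκ, h1, h2⟩ := E.exists_cone_of_not_free hn hfy
      obtain ⟨κ', s', t', hκ', h1', h2'⟩ := E.exists_cone_of_not_free hn hfz
      obtain ⟨rfl, rfl⟩ := E.cone_unique hn hκ hκ' h1 h1'
      cases b with
      | red k l =>
        obtain ⟨e1, e2, e3⟩ := hE.comp κ s t t' y z k l hκ h1 h2 h2' hb
        exact ⟨e1, e2, e3.symm⟩
      | _ => trivial

/-- `t₁` represents the tuple `t` of nodes of the face and the new node in `H`. -/
def Lift (t : Fin (n - 1) → Option V) (t₁ : Fin (n - 1) → Fin n) : Prop :=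
  ∀ i, (t i = none ∧ t₁ i = E.j) ∨ ∃ x, t i = some x ∧ t₁ i ≠ E.j ∧ E.M.e (E.v (t₁ i)) x = none

/-- The set of tints of the cones with base `t`. -/
def tints (t : Fin (n - 1) → Option V) : Set P.T :=
  {s | ∃ z, ∀ i, E.edge (t i) z = some (Col.cone s i)}

open Classical in
/-- The shades of yellow of the extension. -/
noncomputable def yellow (t : Fin (n - 1) → Option V) : Option P.Sh :=
  if h : ∃ t₀ : Fin (n - 1) → V, t = some ∘ t₀ then E.M.y h.choose
  else if h : ∃ t₁, E.Lift t t₁ then E.H.y h.choose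
  else if ∀ i j, i ≠ j → ∃ a, E.edge (t i) (t j) = some a ∧ ¬ a.IsGreen then
    some (P.shade (E.tints t))
  else none

theorem yellow_some (t₀ : Fin (n - 1) → V) : E.yellow (some ∘ t₀) = E.M.y t₀ := by
  have h : ∃ t₁ : Fin (n - 1) → V, some ∘ t₀ = some ∘ t₁ := ⟨t₀, rfl⟩
  rw [yellow, dif_pos h]
  congr 1
  funext i
  exact (Option.some.inj (congrFun h.choose_spec i)).symm

theorem edge_lift {t : Fin (n - 1) → Option V} {t₁ : Fin (n - 1) → Fin n} (h : E.Lift t t₁)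
    (i i' : Fin (n - 1)) : E.edge (t i) (t i') = E.H.e (t₁ i) (t₁ i') := by
  rcases h i with ⟨hi, hi1⟩ | ⟨x, hx, hj, hxv⟩ <;> rcases h i' with ⟨hi', hi1'⟩ | ⟨x', hx', hj', hxv'⟩
  · rw [hi, hi', hi1, hi1', E.H.e_self]; rfl
  · rw [hi, hx', hi1, ← E.newEdge_face hj' hxv']; rfl
  · rw [hi', hx, hi1', E.H.e_symm, ← E.newEdge_face hj hxv]; rfl
  · rw [hx, hx', E.agree.1 _ _ hj hj']
    exact (E.M.e_congr_both hxv hxv').symm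

theorem yellow_lift {t : Fin (n - 1) → Option V} {t₁ : Fin (n - 1) → Fin n} (h : E.Lift t t₁) :
    E.yellow t = E.H.y t₁ := by
  by_cases h0 : ∃ t₀ : Fin (n - 1) → V, t = some ∘ t₀
  · obtain ⟨t₀, rfl⟩ := h0
    have h1 : ∀ i, t₁ i ≠ E.j ∧ E.M.e (E.v (t₁ i)) (t₀ i) = none := by
      intro i
      rcases h i with ⟨hi, -⟩ | ⟨x, hx, hj, hxv⟩
      · cases hi
      · cases hx; exact ⟨hj, hxv⟩
    rw [yellow_some, E.agree.2 _ fun i => (h1 i).1]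
    exact (E.M.y_congr _ _ fun i => (h1 i).2).symm
  · have h1 : ∃ t₁, E.Lift t t₁ := ⟨t₁, h⟩
    rw [yellow, dif_neg h0, dif_pos h1]
    refine E.H.y_congr _ _ fun i => ?_
    have h2 := h1.choose_spec i
    generalize h1.choose i = k at h2
    rcases h2 with ⟨hi, hi1⟩ | ⟨x, hx, hj, hxv⟩ <;> rcases h i with ⟨hi', hi1'⟩ | ⟨x', hx', hj', hxv'⟩
    · rw [hi1, hi1', E.H.e_self]
    · rw [hi] at hx'; cases hx'
    · rw [hx] at hi'; cases hi'
    · rw [hx] at hx'; cases hx'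
      rw [E.agree.1 _ _ hj hj']
      show E.M.e _ _ = _
      rw [E.M.e_congr _ _ _ hxv]
      exact E.M.e_none_symm hxv'

theorem face_of_isGreen {x : V} {a : Col P.T P.R} (h : E.newEdge x = some a) (ha : a.IsGreen) :
    E.Face x := by
  by_contra hx
  rcases E.newEdge_not_face hx with ⟨i, -, h'⟩ | ⟨-, h'⟩ <;> rw [h, Option.some.injEq] at h' <;>
    subst h' <;> exact ha rfl

theorem yellow_other {t : Fin (n - 1) → Option V} (h0 : ∀ t₀ : Fin (n - 1) → V, t ≠ some ∘ t₀)
    (h1 : ∀ t₁, ¬ E.Lift t t₁) {S : P.Sh} (h : E.yellow t = some S) :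
    S = P.shade (E.tints t) := by
  rw [yellow, dif_neg (not_exists.2 h0), dif_neg (not_exists.2 h1)] at h
  split_ifs at h
  exact (Option.some.inj h).symm

theorem edge_congr (hE : E.GoodReds) (x y z : Option V) (h : E.edge x y = none) :
    E.edge x z = E.edge y z := by
  rcases x with _ | x <;> rcases y with _ | y
  · rfl
  · exact absurd h (E.newEdge_ne_none y)
  · exact absurd (Option.map_eq_none_iff.1 h) (E.newEdge_ne_none x)
  · rcases z with _ | z
    · show (E.newEdge x).map _ = (E.newEdge y).map _
      rw [E.newEdge_congr hE.congr h]
    · exact E.M.e_congr _ _ _ h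

theorem finite_tints [Finite V] (hn : 3 ≤ n) (t : Fin (n - 1) → Option V) :
    (E.tints t).Finite := by
  have h : ∀ s ∈ E.tints t, ∃ z, E.edge (t ⟨0, by omega⟩) z = some (.tinted s) :=
    fun s ⟨z, hz⟩ => ⟨z, hz ⟨0, by omega⟩⟩
  choose! z hz using h
  refine Set.Finite.of_finite_image (f := z) (Set.toFinite _) fun s hs s' hs' hss => ?_
  have h1 := hz s hs
  rw [hss, hz s' hs'] at h1
  simpa using h1.symm

/-- A cone over a tuple that is represented in `H` has its apex there. -/
theorem exists_apex_of_lift {t : Fin (n - 1) → Option V} {t₁ : Fin (n - 1) → Fin n}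
    (h : E.Lift t t₁) (h0 : ∀ t₀ : Fin (n - 1) → V, t ≠ some ∘ t₀) {z : Option V} {s : P.T}
    (hz : ∀ i, E.edge (t i) z = some (Col.cone s i)) :
    ∃ x k, z = some x ∧ k ≠ E.j ∧ E.M.e (E.v k) x = none ∧ E.H.Cone t₁ k s := by
  obtain ⟨i, hi⟩ : ∃ i, t i = none := by
    by_contra hcon
    have h2 : ∀ i, ∃ x, t i = some x := fun i => Option.ne_none_iff_exists'.1 fun h' => hcon ⟨i, h'⟩
    choose t₀ ht₀ using h2
    exact h0 t₀ (funext ht₀)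
  have hzi := hz i
  rw [hi] at hzi
  rcases z with _ | x
  · cases hzi
  obtain ⟨k, hk, hkx⟩ := E.face_of_isGreen hzi (Col.isGreen_cone _ _)
  refine ⟨x, k, rfl, hk, hkx, fun i' => ?_⟩
  rw [← hz i']
  rcases h i' with ⟨hi1, hi2⟩ | ⟨x', hx', hj', hxv'⟩
  · rw [hi1, hi2, ← E.newEdge_face hk hkx]; rfl
  · rw [hx', E.agree.1 _ _ hj' hk]
    exact E.M.e_congr_both hxv' hkx

/-- If the new node is the apex of a cone, then its base lies in the face. -/
theorem exists_lift_of_apex {t₀ : Fin (n - 1) → V} {s : P.T}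
    (hz : ∀ i, E.edge (some (t₀ i)) none = some (Col.cone s i)) :
    ∃ κ : Fin (n - 1) → Fin n, (∀ i, κ i ≠ E.j) ∧ (∀ i, E.M.e (E.v (κ i)) (t₀ i) = none) ∧
      E.H.Cone κ E.j s := by
  have h1 : ∀ i, E.newEdge (t₀ i) = some (Col.cone s i) := by
    intro i
    have := E.edge_symm (some (t₀ i)) none
    rw [hz] at this
    simpa [edge] using this
  have h2 := fun i => E.face_of_isGreen (h1 i) (Col.isGreen_cone _ _)
  choose κ hκ hκx using h2
  refine ⟨κ, hκ, hκx, fun i => ?_⟩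
  rw [E.H.e_symm, ← E.newEdge_face (hκ i) (hκx i), h1]
  simp

/-- The extension of `M` by the new node. -/
noncomputable def graph [Finite V] (hn : 3 ≤ n) (hE : E.GoodReds) : PG P n (Option V) where
  e := E.edge
  y := E.yellow
  e_self x := by
    rcases x with _ | x
    · rfl
    · exact E.M.e_self x
  e_congr := E.edge_congr hE
  e_symm := E.edge_symm
  e_avail := by
    have h : ∀ x a, E.newEdge x = some a → a.Avail n := by
      intro x a h
      by_cases hx : E.Face x
      · obtain ⟨k, hk, hkx⟩ := hx
        rw [E.newEdge_face hk hkx] at h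
        exact E.H.e_avail _ _ _ h
      · rcases E.newEdge_not_face hx with ⟨i, hi, h'⟩ | ⟨-, h'⟩ <;>
          rw [h, Option.some.injEq] at h' <;> subst h'
        · exact hi.1
        · trivial
    intro x y a hxy
    rcases x with _ | x <;> rcases y with _ | y
    · cases hxy
    · exact h _ _ hxy
    · obtain ⟨b, hb, rfl⟩ := Option.map_eq_some_iff.1 hxy
      exact Col.avail_rev (h _ _ hb)
    · exact E.M.e_avail _ _ _ hxy
  tri := by
    refine PG.tri_symm_closure E.edge_symm rfl (fun x y z a b c => E.M.tri x y z a b c) ?_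
    intro y z a b c ha hb hc
    by_cases hy : E.Face y <;> by_cases hz : E.Face z
    · exact E.tri_of_face hy hz ha hb hc
    · exact E.tri_of_face_of_not_face hn hE hy hz ha hb hc
    · have hb' := E.M.e_symm_some hb
      simpa using (E.tri_of_face_of_not_face hn hE hz hy hc hb' ha).swap_yz
    · exact E.tri_of_not_face hn hE hy hz ha hb hc
  y_congr := by
    intro s t h
    by_cases hs : ∃ s₀ : Fin (n - 1) → V, s = some ∘ s₀
    · obtain ⟨s₀, rfl⟩ := hs
      have h1 : ∀ i, ∃ x, t i = some x := by
        intro i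
        refine Option.ne_none_iff_exists'.1 fun h' => ?_
        have h2 := h i
        rw [h'] at h2
        exact E.newEdge_ne_none (s₀ i) (Option.map_eq_none_iff.1 h2)
      choose t₀ ht₀ using h1
      obtain rfl : t = some ∘ t₀ := funext ht₀
      rw [yellow_some, yellow_some]
      exact E.M.y_congr _ _ h
    by_cases hs1 : ∃ s₁, E.Lift s s₁
    · obtain ⟨s₁, hs1⟩ := hs1
      rw [E.yellow_lift hs1, E.yellow_lift (t₁ := s₁)]
      intro i
      have h2 := h i
      rcases hs1 i with ⟨hi1, hi2⟩ | ⟨x, hx, hj, hxv⟩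
      · rw [hi1] at h2
        left
        refine ⟨?_, hi2⟩
        cases hti : t i with
        | none => rfl
        | some y => rw [hti] at h2; exact absurd h2 (E.newEdge_ne_none y)
      · rw [hx] at h2
        right
        cases hti : t i with
        | none => rw [hti] at h2; exact absurd (Option.map_eq_none_iff.1 h2) (E.newEdge_ne_none x)
        | some y =>
          rw [hti] at h2
          exact ⟨y, rfl, hj, by rw [← hxv]; exact (E.M.e_congr_right h2 _).symm⟩
    · have ht : ¬ ∃ t₀ : Fin (n - 1) → V, t = some ∘ t₀ := by
        rintro ⟨t₀, rfl⟩
        have h1 : ∀ i, ∃ x, s i = some x := by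
          intro i
          refine Option.ne_none_iff_exists'.1 fun h' => ?_
          have h2 := h i
          rw [h'] at h2
          exact E.newEdge_ne_none (t₀ i) h2
        choose s₀ hs₀ using h1
        exact hs ⟨s₀, funext hs₀⟩
      have ht1 : ¬ ∃ t₁, E.Lift t t₁ := by
        rintro ⟨t₁, ht1⟩
        refine hs1 ⟨t₁, fun i => ?_⟩
        have h2 := h i
        rcases ht1 i with ⟨hi1, hi2⟩ | ⟨x, hx, hj, hxv⟩
        · rw [hi1] at h2
          left
          refine ⟨?_, hi2⟩
          cases hti : s i with
          | none => rfl
          | some y =>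
            rw [hti] at h2; exact absurd (Option.map_eq_none_iff.1 h2) (E.newEdge_ne_none y)
        · rw [hx] at h2
          right
          cases hti : s i with
          | none => rw [hti] at h2; exact absurd h2 (E.newEdge_ne_none x)
          | some y =>
            rw [hti] at h2
            exact ⟨y, rfl, hj, by rw [← hxv]; exact E.M.e_congr_right h2 _⟩
      have h3 : ∀ i z, E.edge (s i) z = E.edge (t i) z := fun i z => E.edge_congr hE _ _ _ (h i)
      have h4 : ∀ i j, E.edge (s i) (s j) = E.edge (t i) (t j) := by
        intro i j
        rw [h3, E.edge_symm (s j), h3, ← E.edge_symm]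
      rw [yellow, yellow, dif_neg hs, dif_neg hs1, dif_neg ht, dif_neg ht1]
      have h5 : E.tints s = E.tints t := by simp only [tints, h3]
      have h6 : (∀ i j, i ≠ j → ∃ a, E.edge (s i) (s j) = some a ∧ ¬ a.IsGreen) ↔
          ∀ i j, i ≠ j → ∃ a, E.edge (t i) (t j) = some a ∧ ¬ a.IsGreen := by simp only [h4]
      rw [h5]
      split_ifs with hc hc' hc'
      · rfl
      · exact absurd (h6.1 hc) hc'
      · exact absurd (h6.2 hc') hc
      · rfl
  y_isSome := by
    intro t
    by_cases h0 : ∃ t₀ : Fin (n - 1) → V, t = some ∘ t₀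
    · obtain ⟨t₀, rfl⟩ := h0
      rw [yellow_some]
      exact E.M.y_isSome t₀
    by_cases h1 : ∃ t₁, E.Lift t t₁
    · obtain ⟨t₁, h1⟩ := h1
      rw [E.yellow_lift h1, E.H.y_isSome]
      simp only [E.edge_lift h1]
    · rw [yellow, dif_neg h0, dif_neg h1]
      split_ifs with h2
      · simpa using h2
      · simpa using h2
  y_ok := by
    intro t S hS
    by_cases h0 : ∃ t₀ : Fin (n - 1) → V, t = some ∘ t₀
    · obtain ⟨t₀, rfl⟩ := h0
      rw [yellow_some] at hS
      exact E.M.y_ok _ _ hS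
    by_cases h1 : ∃ t₁, E.Lift t t₁
    · obtain ⟨t₁, h1⟩ := h1
      rw [E.yellow_lift h1] at hS
      exact E.H.y_ok _ _ hS
    · rw [E.yellow_other (not_exists.1 h0) (not_exists.1 h1) hS]
      exact P.ok_shade _ (E.finite_tints hn t)
  y_cone := by
    intro t S z s hS hz
    by_cases h0 : ∃ t₀ : Fin (n - 1) → V, t = some ∘ t₀
    · obtain ⟨t₀, rfl⟩ := h0
      rw [yellow_some] at hS
      rcases z with _ | z
      · obtain ⟨κ, hκ, hκt, hc⟩ := E.exists_lift_of_apex hz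
        refine E.H.y_cone κ S E.j s ?_ hc
        rw [E.agree.2 κ hκ, ← hS]
        exact E.M.y_congr _ _ hκt
      · exact E.M.y_cone _ _ _ _ hS hz
    by_cases h1 : ∃ t₁, E.Lift t t₁
    · obtain ⟨t₁, h1⟩ := h1
      rw [E.yellow_lift h1] at hS
      obtain ⟨x, k, -, -, -, hc⟩ := E.exists_apex_of_lift h1 (not_exists.1 h0) hz
      exact E.H.y_cone _ _ _ _ hS hc
    · rw [E.yellow_other (not_exists.1 h0) (not_exists.1 h1) hS,
        P.mem_shade _ (E.finite_tints hn t)]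
      exact ⟨z, hz⟩

/-- The new node solves the extension problem. -/
theorem graph_comap [Finite V] (hn : 3 ≤ n) (hE : E.GoodReds) :
    (E.graph hn hE).comap (fun k => if k = E.j then none else some (E.v k)) = E.H := by
  have key : ∀ k, ((if k = E.j then none else some (E.v k)) = (none : Option V) ∧ k = E.j) ∨
      ∃ x, (if k = E.j then none else some (E.v k)) = some x ∧ k ≠ E.j ∧
        E.M.e (E.v k) x = none := by
    intro k
    by_cases hk : k = E.j
    · exact Or.inl ⟨if_pos hk, hk⟩
    · exact Or.inr ⟨_, if_neg hk, hk, E.M.e_self _⟩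
  ext1
  · rename_i k l
    exact E.edge_lift (t := fun i => if (if i = ⟨0, by omega⟩ then k else l) = E.j then none
      else some (E.v (if i = ⟨0, by omega⟩ then k else l)))
      (t₁ := fun i => if i = ⟨0, by omega⟩ then k else l) (fun i => key _) ⟨0, by omega⟩
      ⟨1, by omega⟩
  · rename_i t
    exact E.yellow_lift fun i => key _

theorem graph_comap_some [Finite V] (hn : 3 ≤ n) (hE : E.GoodReds) :
    (E.graph hn hE).comap some = E.M := by
  ext1
  · rfl
  · exact E.yellow_some _

end ExtProblem

/-! ### Coherent choices of reds -/

/-- The colour of an edge between the apexes of two cones over the same base can only be red. -/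
theorem exists_red_of_tri {T R : Type} [LinearOrder T] [LinearOrder R] {n : ℕ} (hn : 3 ≤ n)
    {c : Col T R} (hc : c.Avail n) {t t' : T}
    (h : ∀ i : Fin (n - 1), Tri (Col.cone t i) c (Col.cone t' i)) :
    ∃ k l, c = .red k l ∧ Sync t t' k l := by
  have hg : ¬ c.IsGreen := fun hg =>
    (h ⟨0, by omega⟩).not_green ⟨Col.isGreen_cone _ _, hg, Col.isGreen_cone _ _⟩
  cases c with
  | green i => exact absurd (by simp [Col.IsGreen, Col.gidx]) hg
  | tinted i => exact absurd (by simp [Col.IsGreen, Col.gidx]) hg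
  | white i =>
    have hi : i ≤ n - 2 := hc
    exact absurd ⟨Col.gidx_cone _ _, Col.gidx_cone _ _⟩ (h ⟨i, by omega⟩).vtx_x
  | red k l => exact ⟨k, l, rfl, (h ⟨0, by omega⟩).vtx_x t t' rfl rfl⟩

namespace PG

variable {P : Palette} {n : ℕ} {V W : Type}

/-- The red edges between the apexes of cones over `a` are indexed by a function of their tints. -/
def Indexed (M : PG P n V) (a : Fin (n - 1) → V) (f : P.T → P.R) : Prop :=
  ∀ z z' t t', M.Cone a z t → M.Cone a z' t' → M.e z z' ≠ none →
    M.e z z' = some (.red (f t) (f t'))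

/-- Over each tuple with a shade `S` of yellow, the red edges between apexes of cones are given by
an index function that reverses the order on the tints allowed by `S`, so that it also suits all the
cones that may still be added. -/
def Coherent (M : PG P n V) : Prop :=
  ∀ a S, M.y a = some S → ∃ f : P.T → P.R,
    (∀ t t', P.mem t S → P.mem t' S → t < t' → f t' < f t) ∧ M.Indexed a f

theorem Coherent.comap {M : PG P n V} (h : M.Coherent) (g : W → V) : (M.comap g).Coherent :=
  fun a S hS => by
    obtain ⟨f, hf, hi⟩ := h (g ∘ a) S hS
    exact ⟨f, hf, fun z z' t t' hz hz' => hi (g z) (g z') t t' hz hz'⟩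

theorem Cone.congr {M : PG P n V} {a a' : Fin (n - 1) → V} {z z' : V} {t : P.T} (h : M.Cone a z t)
    (ha : ∀ i, M.e (a i) (a' i) = none) (hz : M.e z z' = none) : M.Cone a' z' t := fun i => by
  rw [← M.e_congr_both (ha i) hz, h i]

theorem Cone.tint_unique (hn : 3 ≤ n) {M : PG P n V} {a : Fin (n - 1) → V} {z : V} {t t' : P.T}
    (h : M.Cone a z t) (h' : M.Cone a z t') : t = t' := by
  have h2 := h ⟨0, by omega⟩
  rw [h' ⟨0, by omega⟩] at h2
  simp only [Option.some.injEq, Col.cone, Col.tinted.injEq] at h2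
  exact h2.symm

theorem Indexed.congr {M : PG P n V} {a a' : Fin (n - 1) → V} {f : P.T → P.R} (h : M.Indexed a f)
    (ha : ∀ i, M.e (a i) (a' i) = none) : M.Indexed a' f := fun z z' t t' hz hz' =>
  h z z' t t' (hz.congr (fun i => M.e_none_symm (ha i)) (M.e_self _))
    (hz'.congr (fun i => M.e_none_symm (ha i)) (M.e_self _))

/-- Edges between apexes of cones over the same base are red. -/
theorem Cone.exists_red (hn : 3 ≤ n) {M : PG P n V} {a : Fin (n - 1) → V} {z z' : V} {t t' : P.T}
    (h : M.Cone a z t) (h' : M.Cone a z' t') (hz : M.e z z' ≠ none) :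
    ∃ k l, M.e z z' = some (.red k l) ∧ Sync t t' k l := by
  obtain ⟨c, hc⟩ := Option.ne_none_iff_exists'.1 hz
  obtain ⟨k, l, rfl, hs⟩ := exists_red_of_tri hn (M.e_avail _ _ _ hc) fun i =>
    M.tri _ _ _ _ _ _ (h i) hc (h' i)
  exact ⟨k, l, hc, hs⟩

theorem Cone.index_unique (hn : 3 ≤ n) {M : PG P n V} {a : Fin (n - 1) → V} {z z' : V}
    {t' t'' : P.T} {z'' : V} (h' : M.Cone a z' t') (h'' : M.Cone a z'' t'')
    {k l k' l' : P.R} (e : M.e z z' = some (.red k l)) (e' : M.e z z'' = some (.red k' l')) :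
    k = k' := by
  by_cases hz : M.e z' z'' = none
  · rw [M.e_congr_right hz, e'] at e
    cases e; rfl
  · obtain ⟨p, q, hpq, -⟩ := h'.exists_red hn h'' hz
    exact (M.tri _ _ _ _ _ _ e hpq e').red.1

theorem Cone.index_unique_tint (hn : 3 ≤ n) {M : PG P n V} {a : Fin (n - 1) → V} {z w z' w' : V}
    {t t' t'' : P.T} (hz : M.Cone a z t) (hw : M.Cone a w t) (hz' : M.Cone a z' t')
    (hw' : M.Cone a w' t'') {k l k' l' : P.R} (e : M.e z z' = some (.red k l))
    (e' : M.e w w' = some (.red k' l')) : k = k' := by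
  by_cases h : M.e z w = none
  · rw [← M.e_congr _ _ _ h] at e'
    exact hz'.index_unique hn hw' e e'
  · obtain ⟨p, q, hpq, hs⟩ := hz.exists_red hn hw h
    rw [hz'.index_unique hn hw e hpq, hw'.index_unique hn hz e' (M.e_symm_some hpq)]
    exact hs.1 rfl

/-- For any tuple there is an index function that suits the existing cones. -/
theorem exists_index (hn : 3 ≤ n) (M : PG P n V) (a : Fin (n - 1) → V) {ρ₀ : P.T → P.R}
    (hρ₀ : StrictAnti ρ₀) :
    ∃ f : P.T → P.R, (∀ t t', (∃ z, M.Cone a z t) → (∃ z, M.Cone a z t') → t < t' → f t' < f t) ∧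
      M.Indexed a f := by
  by_cases hp : ∃ z₀ t₀ z₁ t₁, M.Cone a z₀ t₀ ∧ M.Cone a z₁ t₁ ∧ M.e z₀ z₁ ≠ none
  · obtain ⟨z₀, t₀, z₁, t₁, h0, h1, hne⟩ := hp
    have h2 : ∀ t, (∃ z, M.Cone a z t) → ∃ k, ∃ z z' t' l, M.Cone a z t ∧ M.Cone a z' t' ∧
        M.e z z' = some (.red k l) := by
      rintro t ⟨z, hz⟩
      by_cases h : M.e z z₀ = none
      · rw [← M.e_congr _ _ _ h] at hne
        obtain ⟨k, l, hkl, -⟩ := hz.exists_red hn h1 hne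
        exact ⟨k, z, z₁, t₁, l, hz, h1, hkl⟩
      · obtain ⟨k, l, hkl, -⟩ := hz.exists_red hn h0 h
        exact ⟨k, z, z₀, t₀, l, hz, h0, hkl⟩
    have : Nonempty P.R := ⟨ρ₀ t₀⟩
    choose! f hf using h2
    have key : ∀ z z' t t' k l, M.Cone a z t → M.Cone a z' t' → M.e z z' = some (.red k l) →
        f t = k ∧ f t' = l := by
      intro z z' t t' k l hz hz' e
      constructor
      · obtain ⟨w, w', t'', l', hw, hw', e'⟩ := hf t ⟨z, hz⟩
        exact hw.index_unique_tint hn hz hw' hz' e' e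
      · obtain ⟨w, w', t'', l', hw, hw', e'⟩ := hf t' ⟨z', hz'⟩
        exact hw.index_unique_tint hn hz' hw' hz e' (M.e_symm_some e)
    refine ⟨f, ?_, ?_⟩
    · rintro t t' ⟨z, hz⟩ ⟨z', hz'⟩ htt
      have hne : M.e z z' ≠ none := fun h =>
        htt.ne ((hz.congr (fun i => M.e_self _) h).tint_unique hn hz')
      obtain ⟨k, l, hkl, hs⟩ := hz.exists_red hn hz' hne
      obtain ⟨rfl, rfl⟩ := key _ _ _ _ _ _ hz hz' hkl
      exact hs.2.2 htt
    · intro z z' t t' hz hz' hne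
      obtain ⟨k, l, hkl, hs⟩ := hz.exists_red hn hz' hne
      obtain ⟨rfl, rfl⟩ := key _ _ _ _ _ _ hz hz' hkl
      exact hkl
  · refine ⟨ρ₀, fun t t' _ _ h => hρ₀ h, fun z z' t t' hz hz' hne => ?_⟩
    exact absurd ⟨z, t, z', t', hz, hz', hne⟩ hp

end PG

namespace ExtProblem

variable {P : Palette} {n : ℕ} {V : Type}

/-- Coherence is inherited by an extension if the reds are chosen from an index function of the
face. -/
theorem graph_coherent [Finite V] (hn : 3 ≤ n) (E : ExtProblem P n V) (hE : E.GoodReds)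
    {ρ₀ : P.T → P.R} (hρ₀ : StrictAnti ρ₀) (hM : E.M.Coherent)
    (hf : ∀ (κ : Fin (n - 1) → Fin n) s S, (∀ i, κ i ≠ E.j) → E.H.Cone κ E.j s →
      E.H.y κ = some S → ∃ f : P.T → P.R,
        (∀ t t', P.mem t S → P.mem t' S → t < t' → f t' < f t) ∧ E.M.Indexed (E.v ∘ κ) f ∧
        ∀ x t, E.M.Cone (E.v ∘ κ) x t → E.ρ x = (f s, f t)) :
    (E.graph hn hE).Coherent := by
  intro a S hS
  by_cases h0 : ∃ t₀ : Fin (n - 1) → V, a = some ∘ t₀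
  · obtain ⟨t₀, rfl⟩ := h0
    have hS' : E.M.y t₀ = some S := by rw [← hS]; exact (E.yellow_some t₀).symm
    by_cases hc : ∃ s, (E.graph hn hE).Cone (some ∘ t₀) none s
    · obtain ⟨s, hs⟩ := hc
      obtain ⟨κ, hκ, hκt, hcone⟩ := E.exists_lift_of_apex hs
      have hSκ : E.H.y κ = some S := by
        rw [E.agree.2 κ hκ, ← hS']
        exact E.M.y_congr _ _ hκt
      obtain ⟨f, hf1, hf2, hf3⟩ := hf κ s S hκ hcone hSκ
      refine ⟨f, hf1, ?_⟩
      have key : ∀ x t, E.M.Cone t₀ x t → E.newEdge x = some (.red (f s) (f t)) := by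
        intro x t hx
        have hx' : E.M.Cone (E.v ∘ κ) x t :=
          hx.congr (fun i => E.M.e_none_symm (hκt i)) (E.M.e_self _)
        have hnf : ¬ E.Face x := by
          rintro ⟨k, hk, hkx⟩
          obtain ⟨i, rfl⟩ := exists_eq_of_injective_of_ne hcone.injective hκ hk
          have := hx' i
          rw [show (E.v ∘ κ) i = E.v (κ i) from rfl, hkx] at this
          cases this
        rcases E.newEdge_not_face hnf with ⟨i, hi, -⟩ | ⟨-, h⟩
        · have hi1 : i ≤ n - 2 := hi.1
          exact absurd ⟨Col.gidx_cone _ _, Col.gidx_cone _ _⟩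
            (hi.2 (κ ⟨i, by omega⟩) (hκ _) _ _ (hcone ⟨i, by omega⟩) (hx' ⟨i, by omega⟩))
        · rw [h, hf3 x t hx']
      rintro (_ | z) (_ | z') t t' hz hz' hne
      · exact absurd rfl hne
      · obtain rfl := hz.tint_unique hn hs
        exact key z' t' hz'
      · obtain rfl := hz'.tint_unique hn hs
        show (E.newEdge z).map _ = _
        rw [key z t hz]
        rfl
      · exact (hf2.congr hκt) z z' t t' hz hz' hne
    · obtain ⟨f, hf1, hf2⟩ := hM t₀ S hS'
      refine ⟨f, hf1, ?_⟩
      rintro (_ | z) (_ | z') t t' hz hz' hne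
      · exact absurd rfl hne
      · exact absurd ⟨_, hz⟩ hc
      · exact absurd ⟨_, hz'⟩ hc
      · exact hf2 z z' t t' hz hz' hne
  by_cases h1 : ∃ t₁, E.Lift a t₁
  · obtain ⟨t₁, h1⟩ := h1
    refine ⟨ρ₀, fun t t' _ _ h => hρ₀ h, fun z z' t t' hz hz' hne => absurd ?_ hne⟩
    obtain ⟨x, k, rfl, hk, hkx, hc⟩ := E.exists_apex_of_lift h1 (not_exists.1 h0) hz
    obtain ⟨x', k', rfl, hk', hkx', hc'⟩ := E.exists_apex_of_lift h1 (not_exists.1 h0) hz'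
    -- the `n - 1` base points leave room for only one apex in `H`
    have hne' : ∀ {k t}, E.H.Cone t₁ k t → ∀ i, t₁ i ≠ k := by
      rintro k t hc i rfl
      have := hc i
      rw [E.H.e_self] at this
      cases this
    have hkk : k' = k := by
      by_contra hkk
      obtain ⟨i, hi⟩ := exists_eq_of_injective_of_ne hc.injective (hne' hc) hkk
      exact hne' hc' i hi
    subst hkk
    show E.M.e x x' = none
    rw [← E.M.e_congr _ _ _ hkx]
    exact hkx'
  · have hS' := E.yellow_other (not_exists.1 h0) (not_exists.1 h1) hS
    obtain ⟨f, hf1, hf2⟩ := (E.graph hn hE).exists_index hn a hρ₀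
    refine ⟨f, fun t t' ht ht' => hf1 t t' ?_ ?_, hf2⟩
    · rwa [hS', P.mem_shade _ (E.finite_tints hn a)] at ht
    · rwa [hS', P.mem_shade _ (E.finite_tints hn a)] at ht'

end ExtProblem

/-- A finite coherent pre-graph can be extended by any node that some pre-graph on `n` nodes asks
for. -/
theorem PG.Coherent.exists_ext {P : Palette} {n : ℕ} {V : Type} [Finite V] (hn : 3 ≤ n)
    {ρ₀ : P.T → P.R} (hρ₀ : StrictAnti ρ₀) [hR : Nonempty P.R] {M : PG P n V} (hM : M.Coherent)
    {H : PG P n (Fin n)} {v : Fin n → V} {j : Fin n} (hag : H.AgreeOff j (M.comap v))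
    (hnew : ∀ k, k ≠ j → H.e k j ≠ none) :
    ∃ M' : PG P n (Option V), M'.comap some = M ∧
      M'.comap (fun k => if k = j then none else some (v k)) = H ∧ M'.Coherent ∧
      ∀ x, M'.e none (some x) ≠ none := by
  have main : ∀ ρ hE, (⟨M, H, v, j, ρ, hag, hnew⟩ : ExtProblem P n V).graph hn hE |>.Coherent →
      ∃ M' : PG P n (Option V), M'.comap some = M ∧
      M'.comap (fun k => if k = j then none else some (v k)) = H ∧ M'.Coherent ∧
      ∀ x, M'.e none (some x) ≠ none := fun ρ hE hc =>
    ⟨_, ExtProblem.graph_comap_some _ hn hE, ExtProblem.graph_comap _ hn hE, hc,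
      fun x => ExtProblem.newEdge_ne_none _ x⟩
  by_cases hcone : ∃ (κ : Fin (n - 1) → Fin n) (s : P.T) (S : P.Sh), (∀ i, κ i ≠ j) ∧
      H.Cone κ j s ∧ H.y κ = some S
  · obtain ⟨κ, s, S, hκ, hc, hS⟩ := hcone
    have hSM : M.y (v ∘ κ) = some S := by rw [← hS]; exact (hag.2 κ hκ).symm
    obtain ⟨f, hf1, hf2⟩ := hM _ _ hSM
    classical
    -- the tint of `x` as an apex over the face
    let g : (P.T → Prop) → P.T := fun p => if h : ∃ t, p t then h.choose else s
    let τ : V → P.T := fun x => g (M.Cone (v ∘ κ) x)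
    have hτ : ∀ x t, M.Cone (v ∘ κ) x t → τ x = t := by
      intro x t hx
      have h : ∃ t, M.Cone (v ∘ κ) x t := ⟨t, hx⟩
      have : τ x = h.choose := dif_pos h
      rw [this]
      exact h.choose_spec.tint_unique hn hx
    have huniq : ∀ {κ' s'}, (∀ i, κ' i ≠ j) → H.Cone κ' j s' → κ = κ' ∧ s = s' := fun hκ' hc' =>
      ExtProblem.cone_unique ⟨M, H, v, j, fun x => (f s, f (τ x)), hag, hnew⟩ hn hκ hκ' hc hc'
    have hs : P.mem s S := H.y_cone _ _ _ _ hS hc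
    have hE : ExtProblem.GoodReds ⟨M, H, v, j, fun x => (f s, f (τ x)), hag, hnew⟩ := by
      refine ⟨?_, ?_, ?_⟩
      · intro x x' hxx
        have h1 : ∀ t, M.Cone (v ∘ κ) x t ↔ M.Cone (v ∘ κ) x' t := fun t =>
          ⟨fun h => h.congr (fun i => M.e_self _) hxx,
            fun h => h.congr (fun i => M.e_self _) (M.e_none_symm hxx)⟩
        have h2 : τ x = τ x' := congrArg g (funext fun t => propext (h1 t))
        show (f s, f (τ x)) = _
        rw [h2]
      · intro κ' s' t x hκ' hc' hx
        obtain ⟨rfl, rfl⟩ := huniq hκ' hc'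
        have ht : P.mem t S := M.y_cone _ _ _ _ hSM hx
        show Sync s t (f s) (f (τ x))
        rw [hτ x t hx]
        exact ⟨fun h => by rw [h], fun h => hf1 _ _ ht hs h, fun h => hf1 _ _ hs ht h⟩
      · intro κ' s' t t' x x' k l hκ' hc' hx hx' hxx
        obtain ⟨rfl, rfl⟩ := huniq hκ' hc'
        have hxx' : M.e x x' = some (.red k l) := hxx
        have h1 := hf2 x x' t t' hx hx' (by rw [hxx']; simp)
        rw [hxx', Option.some.injEq, Col.red.injEq] at h1
        refine ⟨rfl, ?_, ?_⟩
        · show f (τ x) = k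
          rw [hτ x t hx, h1.1]
        · show f (τ x') = l
          rw [hτ x' t' hx', h1.2]
    refine main _ hE (ExtProblem.graph_coherent hn _ hE hρ₀ hM ?_)
    intro κ' s' S' hκ' hc' hS'
    obtain ⟨rfl, rfl⟩ := huniq hκ' hc'
    rw [show H.y κ = some S' from hS', Option.some.injEq] at hS
    subst hS
    refine ⟨f, hf1, hf2, fun x t hx => ?_⟩
    show (f s, f (τ x)) = _
    rw [hτ x t hx]
  · -- a cone whose apex is the new node has a shade
    have hno : ∀ κ s, (∀ i, κ i ≠ j) → ¬ H.Cone κ j s := by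
      intro κ s hκ hc
      have : (H.y κ).isSome := by
        rw [H.y_isSome]
        intro i i' hii
        by_cases h : H.e (κ i) (κ i') = none
        · have h1 := hc i
          rw [H.e_congr _ _ _ h, hc i'] at h1
          have h3 := congrArg (fun o => o.bind Col.gidx) h1
          simp only [Option.bind_some, Col.gidx_cone, Option.some.injEq] at h3
          exact absurd (Fin.ext h3.symm) hii
        · obtain ⟨a, ha⟩ := Option.ne_none_iff_exists'.1 h
          exact ⟨a, ha, fun hg => (H.tri _ _ _ _ _ _ ha (hc i') (hc i)).not_green
            ⟨hg, Col.isGreen_cone _ _, Col.isGreen_cone _ _⟩⟩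
      obtain ⟨S, hS⟩ := Option.isSome_iff_exists.1 this
      exact hcone ⟨κ, s, S, hκ, hc, hS⟩
    obtain ⟨r⟩ := hR
    have hE : ExtProblem.GoodReds ⟨M, H, v, j, fun _ => (r, r), hag, hnew⟩ :=
      ⟨fun _ _ _ => rfl, fun κ s _ _ hκ hc => absurd hc (hno κ s hκ),
        fun κ s _ _ _ _ _ _ hκ hc => absurd hc (hno κ s hκ)⟩
    exact main _ hE (ExtProblem.graph_coherent hn _ hE hρ₀ hM
      fun κ s S hκ hc => absurd hc (hno κ s hκ))

/-! ### Saturated coloured graphs -/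

namespace PG

variable {P : Palette} {n : ℕ} {V W : Type}

theorem comap_comap {X : Type} (f : W → V) (g : X → W) (M : PG P n V) :
    (M.comap f).comap g = M.comap (f ∘ g) := rfl

theorem comap_congr {M N : PG P n V} {f : W → V} (A : Set V) (hf : ∀ x, f x ∈ A)
    (he : ∀ x ∈ A, ∀ y ∈ A, M.e x y = N.e x y)
    (hy : ∀ t : Fin (n - 1) → V, (∀ i, t i ∈ A) → M.y t = N.y t) : M.comap f = N.comap f := by
  ext1
  · exact he _ (hf _) _ (hf _)
  · exact hy _ fun i => hf _

/-- Nodes may be replaced by equivalent ones. -/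
theorem comap_eq_of_e_eq_none {M : PG P n V} {f g : W → V} (h : ∀ x, M.e (f x) (g x) = none) :
    M.comap f = M.comap g := by
  ext1
  · exact M.e_congr_both (h _) (h _)
  · exact M.y_congr _ _ fun i => h _

theorem comap_id (M : PG P n V) : M.comap id = M := rfl

theorem AgreeOff.comap_eq {M N : PG P n V} {j : V} (h : M.AgreeOff j N) {f : W → V}
    (hf : ∀ x, f x ≠ j) : M.comap f = N.comap f :=
  comap_congr {x | x ≠ j} hf (fun x hx y hy => h.1 x y hx hy) h.2

/-- If `j` is equivalent in `H` to another node `k`, then `v k` can be used in place of `v j`. -/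
theorem AgreeOff.comap_update {H : PG P n (Fin n)} {M : PG P n V} {v : Fin n → V} {j k : Fin n}
    (h : H.AgreeOff j (M.comap v)) (hk : k ≠ j) (hkj : H.e k j = none) :
    M.comap (Function.update v j (v k)) = H := by
  have h1 : Function.update v j (v k) = v ∘ Function.update id j k := by
    rw [Function.comp_update]; rfl
  have hne : ∀ a, Function.update id j k a ≠ j := by
    intro a
    by_cases ha : a = j
    · subst ha; rwa [Function.update_self]
    · simp [ha]
  rw [h1, ← comap_comap, ← h.comap_eq hne]
  refine (comap_eq_of_e_eq_none fun a => ?_).trans H.comap_id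
  by_cases ha : a = j
  · subst ha; simpa using hkj
  · simpa [ha] using H.e_self a

end PG

instance Col.countable {T R : Type} [Countable T] [Countable R] : Countable (Col T R) := by
  let f : Col T R → (ℕ ⊕ T) ⊕ (ℕ ⊕ R × R)
    | .green i => .inl (.inl i)
    | .tinted t => .inl (.inr t)
    | .white i => .inr (.inl i)
    | .red k l => .inr (.inr (k, l))
  refine Function.Injective.countable (f := f) ?_
  intro a b h
  cases a <;> cases b <;> simp_all [f]

instance PG.countable {P : Palette} {n : ℕ} {V : Type} [Finite V] [Countable P.T] [Countable P.R]
    [Countable P.Sh] : Countable (PG P n V) := by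
  refine Function.Injective.countable
    (f := fun M : PG P n V => ((M.e, M.y) :
      (V → V → Option (Col P.T P.R)) × ((Fin (n - 1) → V) → Option P.Sh))) ?_
  intro M N h
  simp only [Prod.mk.injEq] at h
  exact PG.ext (fun x y => by rw [h.1]) fun t => by rw [h.2]

/-- A finite stage of the construction of a saturated graph: the nodes are `0, …, N`. -/
structure Stage (P : Palette) (n : ℕ) where
  M : PG P n ℕ
  N : ℕ
  coherent : M.Coherent
  eq_of_none : ∀ x y, x ≤ N → y ≤ N → M.e x y = none → x = y

namespace Stage

variable {P : Palette} {n : ℕ}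

/-- `B` is an extension of the stage `A`. -/
def Extends (A B : Stage P n) : Prop :=
  A.N ≤ B.N ∧ (∀ x ≤ A.N, ∀ y ≤ A.N, A.M.e x y = B.M.e x y) ∧
    ∀ t : Fin (n - 1) → ℕ, (∀ i, t i ≤ A.N) → A.M.y t = B.M.y t

theorem Extends.refl (A : Stage P n) : A.Extends A := ⟨le_rfl, fun _ _ _ _ => rfl, fun _ _ => rfl⟩

theorem Extends.trans {A B C : Stage P n} (h : A.Extends B) (h' : B.Extends C) : A.Extends C :=
  ⟨h.1.trans h'.1, fun x hx y hy => (h.2.1 x hx y hy).trans (h'.2.1 x (hx.trans h.1) y (hy.trans h.1)),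
    fun t ht => (h.2.2 t ht).trans (h'.2.2 t fun i => (ht i).trans h.1)⟩

theorem Extends.comap_eq {A B : Stage P n} (h : A.Extends B) {W : Type} {f : W → ℕ}
    (hf : ∀ x, f x ≤ A.N) : A.M.comap f = B.M.comap f :=
  PG.comap_congr {x | x ≤ A.N} hf h.2.1 h.2.2

/-- Every request can be met at the next stage. -/
theorem exists_extends (hn : 3 ≤ n) {ρ₀ : P.T → P.R} (hρ₀ : StrictAnti ρ₀) [Nonempty P.R]
    (A : Stage P n) (v : Fin n → ℕ) (j : Fin n) (H : PG P n (Fin n)) :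
    ∃ B : Stage P n, A.Extends B ∧ ((∀ k, v k ≤ A.N) → H.AgreeOff j (A.M.comap v) →
      ∃ x ≤ B.N, B.M.comap (Function.update v j x) = H) := by
  by_cases hv : ∀ k, v k ≤ A.N
  swap
  · exact ⟨A, .refl A, fun h => absurd h hv⟩
  by_cases hH : H.AgreeOff j (A.M.comap v)
  swap
  · exact ⟨A, .refl A, fun _ h => absurd h hH⟩
  by_cases hk : ∃ k, k ≠ j ∧ H.e k j = none
  · obtain ⟨k, hk, hkj⟩ := hk
    exact ⟨A, .refl A, fun _ _ => ⟨v k, hv k, hH.comap_update hk hkj⟩⟩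
  · push Not at hk
    let ι : Fin (A.N + 1) → ℕ := fun x => x.1
    let v' : Fin n → Fin (A.N + 1) := fun k => ⟨v k, Nat.lt_succ_of_le (hv k)⟩
    obtain ⟨M', h1, h2, h3, h4⟩ := (A.coherent.comap ι).exists_ext hn hρ₀
      (H := H) (v := v') (j := j) hH hk
    let g : ℕ → Option (Fin (A.N + 1)) := fun x => if h : x < A.N + 1 then some ⟨x, h⟩ else none
    have hg : ∀ x, x ≤ A.N → ∃ h, g x = some ⟨x, h⟩ := fun x hx =>
      ⟨Nat.lt_succ_of_le hx, dif_pos _⟩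
    have hg' : g (A.N + 1) = none := dif_neg (lt_irrefl _)
    have he : ∀ x ≤ A.N, ∀ y ≤ A.N, A.M.e x y = (M'.comap g).e x y := by
      intro x hx y hy
      obtain ⟨hx1, hx2⟩ := hg x hx
      obtain ⟨hy1, hy2⟩ := hg y hy
      show _ = M'.e (g x) (g y)
      rw [hx2, hy2]
      exact (congrArg (fun M => PG.e M ⟨x, hx1⟩ ⟨y, hy1⟩) h1).symm
    refine ⟨⟨M'.comap g, A.N + 1, h3.comap g, ?_⟩, ⟨Nat.le_succ _, he, ?_⟩, ?_⟩
    · intro x y hx hy hxy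
      rcases Nat.le_succ_iff.1 hx with hx | rfl <;> rcases Nat.le_succ_iff.1 hy with hy | rfl
      · rw [← he x hx y hy] at hxy
        exact A.eq_of_none x y hx hy hxy
      · obtain ⟨hx1, hx2⟩ := hg x hx
        have h5 := PG.e_none_symm _ hxy
        have h6 : M'.e (g (A.N + 1)) (g x) = none := h5
        rw [hg', hx2] at h6
        exact absurd h6 (h4 _)
      · obtain ⟨hy1, hy2⟩ := hg y hy
        have h6 : M'.e (g (A.N + 1)) (g y) = none := hxy
        rw [hg', hy2] at h6
        exact absurd h6 (h4 _)
      · rfl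
    · intro t ht
      show _ = M'.y (g ∘ t)
      have h5 : g ∘ t = some ∘ fun i => (⟨t i, Nat.lt_succ_of_le (ht i)⟩ : Fin (A.N + 1)) :=
        funext fun i => (hg _ (ht i)).2
      rw [h5]
      exact (congrArg (fun M => PG.y M fun i => ⟨t i, Nat.lt_succ_of_le (ht i)⟩) h1).symm
    · intro _ _
      refine ⟨A.N + 1, le_rfl, ?_⟩
      show M'.comap (g ∘ _) = H
      have h5 : g ∘ Function.update v j (A.N + 1) = fun k => if k = j then none else some (v' k) := by
        funext k
        by_cases hkj : k = j
        · subst hkj; simp [hg']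
        · simp only [Function.comp_apply, ne_eq, hkj, not_false_eq_true, Function.update_of_ne,
            if_false]
          exact (hg _ (hv k)).2
      rw [h5]
      exact h2

end Stage

/-- A graph on `W`, given by the pre-graphs `lab v` that it induces on `n`-tuples `v`, that contains
every node asked for by a pre-graph on `n` nodes. -/
structure SaturatedGraph (P : Palette) (n : ℕ) where
  W : Type
  lab : (Fin n → W) → PG P n (Fin n)
  e_eq_none_iff : ∀ v i j, (lab v).e i j = none ↔ v i = v j
  lab_comp : ∀ v τ, lab (v ∘ τ) = (lab v).comap τ
  agree : ∀ v v' j, (∀ i, i ≠ j → v i = v' i) → (lab v).AgreeOff j (lab v')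
  exists_update : ∀ v j H, H.AgreeOff j (lab v) → ∃ x, lab (Function.update v j x) = H

/-- A chain of stages in which every request that can be made is met. -/
theorem exists_chain {P : Palette} {n : ℕ} (hn : 3 ≤ n) [Countable P.T] [Countable P.R]
    [Countable P.Sh] [Nonempty P.R] {ρ₀ : P.T → P.R} (hρ₀ : StrictAnti ρ₀) (A : Stage P n) :
    ∃ S : ℕ → Stage P n, S 0 = A ∧ (∀ i k, i ≤ k → (S i).Extends (S k)) ∧
      ∀ i (v : Fin n → ℕ) j H, (∀ k, v k ≤ (S i).N) → H.AgreeOff j ((S i).M.comap v) →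
        ∃ k ≥ i, ∃ x ≤ (S k).N, (S k).M.comap (Function.update v j x) = H := by
  have : Nonempty (Fin n) := ⟨⟨0, by omega⟩⟩
  have : Nonempty (PG P n (Fin n)) := ⟨A.M.comap fun _ => 0⟩
  obtain ⟨f, hf⟩ := exists_surjective_nat ((Fin n → ℕ) × Fin n × PG P n (Fin n))
  choose next h1 h2 using fun A : Stage P n => A.exists_extends hn hρ₀
  -- stage `i` deals with the request number `i.unpair.1`, so that every request recurs
  let S : ℕ → Stage P n := fun i => Nat.rec A (fun i B => next B (f i.unpair.1).1
    (f i.unpair.1).2.1 (f i.unpair.1).2.2) i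
  have hS : ∀ i, S (i + 1) = next (S i) (f i.unpair.1).1 (f i.unpair.1).2.1 (f i.unpair.1).2.2 :=
    fun i => rfl
  have hmono : ∀ i k, i ≤ k → (S i).Extends (S k) := by
    intro i k hik
    induction k, hik using Nat.le_induction with
    | base => exact .refl _
    | succ k _ ih => exact ih.trans (by rw [hS]; exact h1 _ _ _ _)
  refine ⟨S, rfl, hmono, ?_⟩
  intro i v j H hv hH
  obtain ⟨r, hr⟩ := hf (v, j, H)
  have hi : i ≤ Nat.pair r i := Nat.right_le_pair r i
  have hr' : f (Nat.pair r i).unpair.1 = (v, j, H) := by rw [Nat.unpair_pair]; exact hr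
  have h3 := h2 (S (Nat.pair r i)) v j H (fun k => (hv k).trans (hmono _ _ hi).1)
    (by rw [← (hmono _ _ hi).comap_eq hv]; exact hH)
  refine ⟨Nat.pair r i + 1, by omega, ?_⟩
  rw [hS, hr']
  exact h3

theorem exists_saturatedGraph {P : Palette} {n : ℕ} (hn : 3 ≤ n) [Countable P.T] [Countable P.R]
    [Countable P.Sh] [Nonempty P.R] {ρ₀ : P.T → P.R} (hρ₀ : StrictAnti ρ₀) (p : PG P n (Fin n)) :
    ∃ G : SaturatedGraph P n, ∃ v, G.lab v = p := by
  have h0 : (0 : ℕ) < n := by omega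
  let A : Stage P n := ⟨p.comap fun _ : ℕ => (⟨0, h0⟩ : Fin n), 0,
    fun a S _ => ⟨ρ₀, fun t t' _ _ h => hρ₀ h, fun z z' t t' _ _ hne => (hne (p.e_self ⟨0, h0⟩)).elim⟩,
    fun x y hx hy _ => by omega⟩
  obtain ⟨S, hS0, hS, hsat⟩ := exists_chain hn hρ₀ A
  let W : Type := {x : ℕ // ∃ i, x ≤ (S i).N}
  let st : (Fin n → W) → ℕ := fun v => Finset.univ.sup fun k => (v k).2.choose
  have hst : ∀ v k, (v k).1 ≤ (S (st v)).N := fun v k =>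
    (v k).2.choose_spec.trans (hS _ _ (Finset.le_sup (f := fun k => (v k).2.choose)
      (Finset.mem_univ k))).1
  let lab : (Fin n → W) → PG P n (Fin n) := fun v => (S (st v)).M.comap fun k => (v k).1
  have hlab : ∀ v i, (∀ k, (v k).1 ≤ (S i).N) → lab v = (S i).M.comap fun k => (v k).1 := by
    intro v i hv
    rcases le_total i (st v) with h | h
    · exact ((hS _ _ h).comap_eq hv).symm
    · exact (hS _ _ h).comap_eq (hst v)
  have hupd : ∀ v j H, H.AgreeOff j (lab v) → ∃ x, lab (Function.update v j x) = H := by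
    intro v j H hH
    obtain ⟨k, hk, x, hx, h⟩ := hsat (st v) (fun k => (v k).1) j H (hst v) hH
    refine ⟨⟨x, k, hx⟩, ?_⟩
    have h1 : (fun i => (Function.update v j (⟨x, k, hx⟩ : W) i).1) =
        Function.update (fun i => (v i).1) j x := by
      funext i
      by_cases hi : i = j
      · subst hi; simp
      · simp [hi]
    rw [hlab _ k, h1, h]
    intro i
    by_cases hi : i = j
    · subst hi; simpa using hx
    · simpa [hi] using (hst v i).trans (hS _ _ hk).1
  refine ⟨⟨W, lab, ?_, ?_, ?_, hupd⟩, ?_⟩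
  · intro v i j
    constructor
    · intro h
      exact Subtype.ext ((S (st v)).eq_of_none _ _ (hst v i) (hst v j) h)
    · intro h
      show (S (st v)).M.e (v i).1 (v j).1 = none
      rw [h]
      exact (S (st v)).M.e_self _
  · intro v τ
    rw [hlab (v ∘ τ) (st v) fun k => hst v (τ k)]
    rfl
  · intro v v' j h
    have h1 := hlab v (max (st v) (st v')) fun k => (hst v k).trans (hS _ _ (le_max_left _ _)).1
    have h2 := hlab v' (max (st v) (st v')) fun k => (hst v' k).trans (hS _ _ (le_max_right _ _)).1
    rw [h1, h2]
    refine ⟨fun k l hk hl => ?_, fun t ht => ?_⟩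
    · show (S _).M.e (v k).1 (v l).1 = (S _).M.e (v' k).1 (v' l).1
      rw [h k hk, h l hl]
    · show (S _).M.y _ = (S _).M.y _
      congr 1
      funext i
      exact congrArg Subtype.val (h _ (ht i))
  · -- the nodes of `p` are added one by one
    let c : ℕ → Fin n → Fin n := fun m i => if i.1 ≤ m then i else ⟨0, h0⟩
    have key : ∀ m, ∃ v, lab v = p.comap (c m) := by
      intro m
      induction m with
      | zero =>
        refine ⟨fun _ => ⟨0, 0, Nat.zero_le _⟩, ?_⟩
        rw [hlab _ 0 fun _ => Nat.zero_le _]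
        refine (congrArg (fun B : Stage P n => B.M.comap fun _ : Fin n => 0) hS0).trans ?_
        show p.comap _ = p.comap _
        congr 1
        funext i
        by_cases hi : i.1 ≤ 0
        · simp only [c, if_pos hi]
          exact Fin.ext (by simp at hi; simp [hi])
        · simp only [c, if_neg hi]
      | succ m ih =>
        obtain ⟨v, hv⟩ := ih
        by_cases hm : m + 1 < n
        · obtain ⟨x, hx⟩ := hupd v ⟨m + 1, hm⟩ (p.comap (c (m + 1))) (by
            rw [hv]
            have h2 : ∀ k : Fin n, k ≠ ⟨m + 1, hm⟩ → c (m + 1) k = c m k := by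
              intro k hk
              have hk' : k.1 ≠ m + 1 := fun h => hk (Fin.ext h)
              by_cases h3 : k.1 ≤ m
              · simp only [c, if_pos h3, if_pos (show k.1 ≤ m + 1 by omega)]
              · simp only [c, if_neg h3, if_neg (show ¬ k.1 ≤ m + 1 by omega)]
            refine ⟨fun k l hk hl => ?_, fun t ht => ?_⟩
            · show p.e _ _ = p.e _ _
              rw [h2 k hk, h2 l hl]
            · show p.y _ = p.y _
              congr 1
              funext i
              exact h2 _ (ht i))
          exact ⟨_, hx⟩
        · refine ⟨v, ?_⟩
          rw [hv]
          congr 1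
          funext i
          have := i.2
          simp only [c, if_pos (show i.1 ≤ m by omega), if_pos (show i.1 ≤ m + 1 by omega)]
    obtain ⟨v, hv⟩ := key n
    refine ⟨v, ?_⟩
    show lab v = p
    rw [hv]
    refine Eq.trans ?_ p.comap_id
    congr 1
    funext i
    simp only [c, if_pos i.2.le, id]

/-! ### The rainbow algebra is a polyadic equality algebra -/

/-- The palette of the rainbow algebra. -/
abbrev stdPalette : Palette where
  T := ℕ
  R := ℕ
  Sh := Set ℕ
  mem t S := t ∈ S
  ok S := S.Finite ∨ S = Set.univ
  shade s := s
  mem_shade _ _ _ := Iff.rfl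
  ok_shade _ h := Or.inl h

instance : Nonempty stdPalette.R := ⟨(0 : ℕ)⟩

namespace Colour

/-- A colour of the rainbow algebra as a colour with tints and red indices from `ℕ`. -/
def toCol : Colour → Col ℕ ℕ
  | green i => .green i
  | tinted t => .tinted t
  | white i => .white i
  | red k l => .red k l

/-- The inverse of `Colour.toCol`. -/
def ofCol : Col ℕ ℕ → Colour
  | .green i => green i
  | .tinted t => tinted t
  | .white i => white i
  | .red k l => red k l

@[simp] theorem ofCol_toCol (a : Colour) : ofCol a.toCol = a := by cases a <;> rfl

@[simp] theorem toCol_ofCol (a : Col ℕ ℕ) : (ofCol a).toCol = a := by cases a <;> rfl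

theorem toCol_rev (a : Colour) : a.rev.toCol = a.toCol.rev := by cases a <;> rfl

theorem ofCol_rev (a : Col ℕ ℕ) : ofCol a.rev = (ofCol a).rev := by cases a <;> rfl

theorem isGreen_toCol (a : Colour) : a.toCol.IsGreen ↔ a.IsGreen := by
  cases a <;> simp [toCol, Col.IsGreen, Col.gidx, IsGreen]

theorem isGreen_ofCol (a : Col ℕ ℕ) : (ofCol a).IsGreen ↔ a.IsGreen := by
  rw [← isGreen_toCol, toCol_ofCol]

theorem avail_toCol (n : ℕ) (a : Colour) : a.toCol.Avail n ↔ a.Available n := by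
  cases a <;> rfl

theorem toCol_coneColour (t j : ℕ) : (coneColour t j).toCol = Col.cone t j := by cases j <;> rfl

theorem ofCol_cone (t j : ℕ) : ofCol (Col.cone t j) = coneColour t j := by cases j <;> rfl

theorem eq_ofCol {a : Colour} {b : Col ℕ ℕ} (h : a.toCol = b) : a = ofCol b := by
  rw [← h, ofCol_toCol]

end Colour

namespace ColouredGraph

variable {n : ℕ} {V : Type}

theorem edge_rev (M : ColouredGraph n V) {x y : V} {a} (h : M.edge x y = some a) :
    M.edge y x = some a.rev := by
  rw [M.edge_symm, h]; rfl

theorem vtx (M : ColouredGraph n V) {x y z : V} {a b c : Colour} (ha : M.edge x y = some a)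
    (hb : M.edge y z = some b) (hc : M.edge x z = some c) : Vtx a.toCol c.toCol b.toCol := by
  have ha' := (Colour.avail_toCol n a).2 (M.edge_available _ _ _ ha)
  have hc' := (Colour.avail_toCol n c).2 (M.edge_available _ _ _ hc)
  cases b with
  | green i => trivial
  | tinted t => trivial
  | white i =>
    rintro ⟨h1, h2⟩
    rcases i with _ | i
    · obtain ⟨s, hs⟩ := Col.eq_tinted_of_gidx ha' h1
      obtain ⟨t, ht⟩ := Col.eq_tinted_of_gidx hc' h2
      exact M.not_tinted_tinted_white x y z s t ⟨by rw [ha, Colour.eq_ofCol hs]; rfl,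
        by rw [hc, Colour.eq_ofCol ht]; rfl, hb⟩
    · exact M.not_green_green_white x y z (i + 1)
        ⟨by rw [ha, Colour.eq_ofCol (Col.eq_green_of_gidx ha' h1)]; rfl,
        by rw [hc, Colour.eq_ofCol (Col.eq_green_of_gidx hc' h2)]; rfl, hb⟩
  | red k l =>
    intro s t hs ht
    exact M.tinted_tinted_red x y z s t k l (by rw [ha, Colour.eq_ofCol hs]; rfl)
      (by rw [hc, Colour.eq_ofCol ht]; rfl) hb

/-- A coloured graph as a pre-graph. -/
def toPG (M : ColouredGraph n V) : PG stdPalette n V where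
  e x y := (M.edge x y).map Colour.toCol
  y := M.yellow
  e_self x := by rw [(M.edge_eq_none x x).2 rfl]; rfl
  e_congr x y z h := by rw [(M.edge_eq_none x y).1 (Option.map_eq_none_iff.1 h)]
  e_symm x y := by
    rw [M.edge_symm, Option.map_map, Option.map_map]
    congr 1
    exact funext Colour.toCol_rev
  e_avail x y a h := by
    obtain ⟨b, hb, rfl⟩ := Option.map_eq_some_iff.1 h
    exact (Colour.avail_toCol n b).2 (M.edge_available _ _ _ hb)
  tri x y z a b c ha hb hc := by
    obtain ⟨a, ha1, rfl⟩ := Option.map_eq_some_iff.1 ha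
    obtain ⟨b, hb1, rfl⟩ := Option.map_eq_some_iff.1 hb
    obtain ⟨c, hc1, rfl⟩ := Option.map_eq_some_iff.1 hc
    refine ⟨?_, M.vtx ha1 hb1 hc1, ?_, ?_, ?_⟩
    · simp only [Colour.isGreen_toCol]
      exact M.not_green_green_green x y z a b c ha1 hb1 hc1
    · rw [← Colour.toCol_rev]
      exact M.vtx (M.edge_rev ha1) hc1 hb1
    · rw [← Colour.toCol_rev, ← Colour.toCol_rev]
      exact M.vtx (M.edge_rev hc1) ha1 (M.edge_rev hb1)
    · cases a with
      | red i j =>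
        cases b with
        | red j' k =>
          cases c with
          | red i' k' => exact M.red_red_red x y z i j j' k i' k' ha1 hb1 hc1
          | _ => trivial
        | _ => trivial
      | _ => trivial
  y_congr s t h := by
    have : s = t := funext fun i => (M.edge_eq_none _ _).1 (Option.map_eq_none_iff.1 (h i))
    rw [this]
  y_isSome t := by
    rw [M.yellow_isSome]
    constructor
    · rintro ⟨h1, h2⟩ i j hij
      cases h : M.edge (t i) (t j) with
      | none => exact absurd (h1 ((M.edge_eq_none _ _).1 h)) hij
      | some a => exact ⟨_, rfl, by rw [Colour.isGreen_toCol]; exact h2 i j a h⟩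
    · intro h
      refine ⟨fun i j hij => ?_, fun i j b hb => ?_⟩
      · by_contra hne
        obtain ⟨a, ha, -⟩ := h i j hne
        rw [(M.edge_eq_none _ _).2 hij] at ha
        cases ha
      · have hne : i ≠ j := by
          rintro rfl
          rw [(M.edge_eq_none _ _).2 rfl] at hb
          cases hb
        obtain ⟨a, ha, hg⟩ := h i j hne
        rw [hb] at ha
        cases ha
        rwa [Colour.isGreen_toCol] at hg
  y_ok t S h := M.yellow_shade t S h
  y_cone t S z s h hz := M.yellow_cone t S z s h fun j => by
    obtain ⟨b, hb, hb'⟩ := Option.map_eq_some_iff.1 (hz j)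
    rw [hb, Colour.eq_ofCol hb']
    exact congrArg some (Colour.ofCol_cone _ _)

end ColouredGraph

namespace PG

variable {n : ℕ} {V : Type}

/-- A pre-graph in which equivalent nodes are equal, as a coloured graph. -/
def toGraph (M : PG stdPalette n V) (h : ∀ x y, M.e x y = none → x = y) : ColouredGraph n V where
  edge x y := (M.e x y).map Colour.ofCol
  yellow := M.y
  edge_eq_none x y := by
    rw [Option.map_eq_none_iff]
    exact ⟨h x y, by rintro rfl; exact M.e_self x⟩
  edge_symm x y := by
    rw [M.e_symm, Option.map_map, Option.map_map]
    congr 1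
    exact funext Colour.ofCol_rev
  edge_available x y a ha := by
    obtain ⟨b, hb, rfl⟩ := Option.map_eq_some_iff.1 ha
    rw [← Colour.avail_toCol, Colour.toCol_ofCol]
    exact M.e_avail _ _ _ hb
  not_green_green_green x y z a b c ha hb hc := by
    obtain ⟨a, ha1, rfl⟩ := Option.map_eq_some_iff.1 ha
    obtain ⟨b, hb1, rfl⟩ := Option.map_eq_some_iff.1 hb
    obtain ⟨c, hc1, rfl⟩ := Option.map_eq_some_iff.1 hc
    simp only [Colour.isGreen_ofCol]
    exact (M.tri _ _ _ _ _ _ ha1 hb1 hc1).not_green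
  not_green_green_white := by
    rintro x y z i ⟨ha, hc, hb⟩
    obtain ⟨a, ha, ha'⟩ := Option.map_eq_some_iff.1 ha
    obtain ⟨b, hb, hb'⟩ := Option.map_eq_some_iff.1 hb
    obtain ⟨c, hc, hc'⟩ := Option.map_eq_some_iff.1 hc
    have h1 := (M.tri _ _ _ _ _ _ ha hb hc).vtx_x
    rw [← Colour.toCol_ofCol a, ← Colour.toCol_ofCol b, ← Colour.toCol_ofCol c, ha', hb', hc'] at h1
    exact h1 ⟨rfl, rfl⟩
  not_tinted_tinted_white := by
    rintro x y z j k ⟨ha, hc, hb⟩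
    obtain ⟨a, ha, ha'⟩ := Option.map_eq_some_iff.1 ha
    obtain ⟨b, hb, hb'⟩ := Option.map_eq_some_iff.1 hb
    obtain ⟨c, hc, hc'⟩ := Option.map_eq_some_iff.1 hc
    have h1 := (M.tri _ _ _ _ _ _ ha hb hc).vtx_x
    rw [← Colour.toCol_ofCol a, ← Colour.toCol_ofCol b, ← Colour.toCol_ofCol c, ha', hb', hc'] at h1
    exact h1 ⟨rfl, rfl⟩
  tinted_tinted_red := by
    intro x y z i j k l ha hc hb
    obtain ⟨a, ha, ha'⟩ := Option.map_eq_some_iff.1 ha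
    obtain ⟨b, hb, hb'⟩ := Option.map_eq_some_iff.1 hb
    obtain ⟨c, hc, hc'⟩ := Option.map_eq_some_iff.1 hc
    have h1 := (M.tri _ _ _ _ _ _ ha hb hc).vtx_x
    rw [← Colour.toCol_ofCol a, ← Colour.toCol_ofCol b, ← Colour.toCol_ofCol c, ha', hb', hc'] at h1
    exact h1 i j rfl rfl
  red_red_red := by
    intro x y z i j j' k i' k' ha hb hc
    obtain ⟨a, ha, ha'⟩ := Option.map_eq_some_iff.1 ha
    obtain ⟨b, hb, hb'⟩ := Option.map_eq_some_iff.1 hb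
    obtain ⟨c, hc, hc'⟩ := Option.map_eq_some_iff.1 hc
    have h1 := (M.tri _ _ _ _ _ _ ha hb hc).red
    rw [← Colour.toCol_ofCol a, ← Colour.toCol_ofCol b, ← Colour.toCol_ofCol c, ha', hb', hc'] at h1
    exact h1
  yellow_isSome t := by
    rw [M.y_isSome]
    constructor
    · intro h1
      refine ⟨fun i j hij => ?_, fun i j b hb => ?_⟩
      · by_contra hne
        obtain ⟨a, ha, -⟩ := h1 i j hne
        rw [hij, M.e_self] at ha
        cases ha
      · obtain ⟨b, hb1, rfl⟩ := Option.map_eq_some_iff.1 hb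
        have hne : i ≠ j := by
          rintro rfl
          rw [M.e_self] at hb
          cases hb
        obtain ⟨a, ha, hg⟩ := h1 i j hne
        rw [hb1] at ha
        cases ha
        rwa [Colour.isGreen_ofCol]
    · rintro ⟨h1, h2⟩ i j hij
      cases ha : M.e (t i) (t j) with
      | none => exact absurd (h1 (h _ _ ha)) hij
      | some a =>
        refine ⟨a, rfl, ?_⟩
        rw [← Colour.isGreen_ofCol]
        exact h2 i j _ (by rw [ha]; rfl)
  yellow_shade t S hS := M.y_ok t S hS
  yellow_cone t S z s hS hz := M.y_cone t S z s hS fun j => by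
    obtain ⟨b, hb, hb'⟩ := Option.map_eq_some_iff.1 (hz j)
    rw [hb, ← Colour.toCol_ofCol b, hb', Colour.toCol_coneColour]

end PG

namespace RainbowAtom

variable {n : ℕ}

@[ext] theorem ext {p q : RainbowAtom n} (he : ∀ i j, p.edge i j = q.edge i j)
    (hy : ∀ t, p.yellow t = q.yellow t) : p = q := by
  cases p; cases q
  simp only [mk.injEq]
  exact ⟨funext fun x => funext fun y => he x y, funext hy⟩

/-- The pre-graph on the coordinates given by an atom. -/
noncomputable def toPG (p : RainbowAtom n) : PG stdPalette n (Fin n) :=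
  p.exists_graph.choose_spec.choose.toPG.comap p.exists_graph.choose_spec.choose_spec.choose

theorem toPG_e (p : RainbowAtom n) (i j : Fin n) :
    p.toPG.e i j = (p.edge i j).map Colour.toCol := by
  rw [p.exists_graph.choose_spec.choose_spec.choose_spec.2.1 i j]
  rfl

theorem toPG_y (p : RainbowAtom n) (t : Fin (n - 1) → Fin n) : p.toPG.y t = p.yellow t := by
  rw [p.exists_graph.choose_spec.choose_spec.choose_spec.2.2 t]
  rfl

theorem edge_eq (p : RainbowAtom n) (i j : Fin n) :
    p.edge i j = (p.toPG.e i j).map Colour.ofCol := by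
  have h : Colour.ofCol ∘ Colour.toCol = id := funext Colour.ofCol_toCol
  rw [toPG_e, Option.map_map, h, Option.map_id]; rfl

theorem edge_eq_none_iff (p : RainbowAtom n) (i j : Fin n) :
    p.edge i j = none ↔ p.toPG.e i j = none := by
  rw [toPG_e, Option.map_eq_none_iff]

/-- The atom of a pre-graph on the coordinates: equivalent coordinates are identified. -/
def ofPG (M : PG stdPalette n (Fin n)) : RainbowAtom n where
  edge i j := (M.e i j).map Colour.ofCol
  yellow := M.y
  exists_graph := by
    let S : Setoid (Fin n) := ⟨fun i j => M.e i j = none, M.e_self, M.e_none_symm,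
      fun {x y z} h h' => by rw [M.e_congr _ _ _ h, h']⟩
    have h1 : ∀ i : Fin n, M.e (Quotient.mk S i).out i = none := fun i =>
      Quotient.exact (Quotient.out_eq (Quotient.mk S i))
    refine ⟨Quotient S, (M.comap Quotient.out).toGraph fun x y h => ?_, Quotient.mk S,
      Quotient.mk_surjective, fun i j => ?_, fun t => ?_⟩
    · rw [← Quotient.out_eq x, ← Quotient.out_eq y]
      exact Quotient.sound h
    · exact congrArg _ (M.e_congr_both (h1 i) (h1 j)).symm
    · exact (M.y_congr _ _ fun i => h1 (t i)).symm

@[simp] theorem toPG_ofPG (M : PG stdPalette n (Fin n)) : (ofPG M).toPG = M := by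
  have h : Colour.toCol ∘ Colour.ofCol = id := funext Colour.toCol_ofCol
  ext1
  · rw [toPG_e]
    show ((M.e _ _).map Colour.ofCol).map Colour.toCol = _
    rw [Option.map_map, h, Option.map_id]; rfl
  · rw [toPG_y]; rfl

@[simp] theorem ofPG_toPG (p : RainbowAtom n) : ofPG p.toPG = p := by
  ext1
  · rw [p.edge_eq]; rfl
  · rw [← p.toPG_y]; rfl

theorem toPG_injective : Function.Injective (toPG (n := n)) :=
  Function.LeftInverse.injective ofPG_toPG

/-- The atom `[a ∘ τ]`. -/
noncomputable def comap (τ : Fin n → Fin n) (p : RainbowAtom n) : RainbowAtom n :=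
  ofPG (p.toPG.comap τ)

@[simp] theorem toPG_comap (τ : Fin n → Fin n) (p : RainbowAtom n) :
    (p.comap τ).toPG = p.toPG.comap τ := toPG_ofPG _

theorem comap_edge (τ : Fin n → Fin n) (p : RainbowAtom n) (i j : Fin n) :
    (p.comap τ).edge i j = p.edge (τ i) (τ j) := by
  rw [edge_eq, edge_eq, toPG_comap]; rfl

theorem comap_yellow (τ : Fin n → Fin n) (p : RainbowAtom n) (t : Fin (n - 1) → Fin n) :
    (p.comap τ).yellow t = p.yellow (τ ∘ t) := by
  rw [← toPG_y, ← toPG_y, toPG_comap]; rfl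

/-- The classes `p` and `q` agree outside the coordinate `i`. -/
def AgreeOff (i : Fin n) (p q : RainbowAtom n) : Prop :=
  (∀ j k, j ≠ i → k ≠ i → p.edge j k = q.edge j k) ∧
    ∀ t : Fin (n - 1) → Fin n, (∀ l, t l ≠ i) → p.yellow t = q.yellow t

theorem agreeOff_iff {i : Fin n} {p q : RainbowAtom n} :
    p.AgreeOff i q ↔ p.toPG.AgreeOff i q.toPG := by
  have hinj : Function.Injective Colour.toCol :=
    Function.LeftInverse.injective Colour.ofCol_toCol
  have h : ∀ a b : Option Colour, a.map Colour.toCol = b.map Colour.toCol ↔ a = b := fun a b =>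
    (Option.map_injective hinj).eq_iff
  simp only [AgreeOff, PG.AgreeOff, toPG_e, toPG_y, h]

end RainbowAtom

theorem PG.AgreeOff.symm {P : Palette} {n : ℕ} {V : Type} {i : V} {p q : PG P n V}
    (h : p.AgreeOff i q) : q.AgreeOff i p :=
  ⟨fun j k hj hk => (h.1 j k hj hk).symm, fun t ht => (h.2 t ht).symm⟩

theorem PG.AgreeOff.trans {P : Palette} {n : ℕ} {V : Type} {i : V} {p q r : PG P n V}
    (h : p.AgreeOff i q) (h' : q.AgreeOff i r) : p.AgreeOff i r :=
  ⟨fun j k hj hk => (h.1 j k hj hk).trans (h'.1 j k hj hk),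
    fun t ht => (h.2 t ht).trans (h'.2 t ht)⟩

theorem PG.AgreeOff.refl {P : Palette} {n : ℕ} {V : Type} (i : V) (p : PG P n V) : p.AgreeOff i p :=
  ⟨fun _ _ _ _ => rfl, fun _ _ => rfl⟩

theorem PG.agreeOff_comap_of_eqOn {P : Palette} {n : ℕ} {V W : Type} (p : PG P n V) {i : W}
    {f g : W → V} (h : ∀ j, j ≠ i → f j = g j) : (p.comap f).AgreeOff i (p.comap g) := by
  refine ⟨fun j k hj hk => ?_, fun t ht => ?_⟩
  · show p.e _ _ = p.e _ _
    rw [h j hj, h k hk]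
  · show p.y _ = p.y _
    congr 1
    funext l
    exact h _ (ht l)

/-- Amalgamation: if `i` is the value of `τ` at `j` only, then the node at `i` can be moved so that
the pull-back along `τ` becomes any given `r` that agrees with the old pull-back off `j`. The new node
never needs a red edge, since there are not enough other nodes for two cones over the same base. -/
theorem PG.exists_amalgam {P : Palette} {n : ℕ} (hn : 3 ≤ n) [hR : Nonempty P.R]
    (p r : PG P n (Fin n)) (τ : Fin n → Fin n) (i j : Fin n) (hτ : ∀ l, τ l = i ↔ l = j)
    (h : r.AgreeOff j (p.comap τ)) : ∃ q : PG P n (Fin n), q.AgreeOff i p ∧ q.comap τ = r := by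
  by_cases hk : ∃ k, k ≠ j ∧ r.e k j = none
  · obtain ⟨k, hk, hkj⟩ := hk
    refine ⟨p.comap (Function.update id i (τ k)),
      p.agreeOff_comap_of_eqOn (f := Function.update id i (τ k)) (g := id)
        fun a ha => by simp [ha], ?_⟩
    rw [comap_comap]
    refine Eq.trans ?_ (h.comap_update hk hkj)
    congr 1
    funext l
    by_cases hl : l = j
    · subst hl; simp [(hτ l).2 rfl]
    · simp [hl, mt (hτ l).1 hl]
  · push Not at hk
    obtain ⟨ρ⟩ := hR
    let V := {x : Fin n // x ≠ i}
    have hV : ∃ x : Fin n, x ≠ i := by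
      have : Nontrivial (Fin n) := Fin.nontrivial_iff_two_le.2 (by omega)
      exact exists_ne i
    let v : Fin n → V := fun k => if h : τ k ≠ i then ⟨τ k, h⟩ else ⟨_, hV.choose_spec⟩
    have hv : ∀ k, k ≠ j → (v k).1 = τ k := by
      intro k hk
      have h1 : τ k ≠ i := mt (hτ k).1 hk
      simp only [v, dif_pos h1]
    let E : ExtProblem P n V :=
      ⟨p.comap Subtype.val, r, v, j, fun _ => (ρ, ρ), h.trans
        ((p.agreeOff_comap_of_eqOn fun k hk => (hv k hk).symm :
          (p.comap τ).AgreeOff j (p.comap fun k => (v k).1))), hk⟩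
    have hno : ∀ (κ : Fin (n - 1) → Fin n) x t, ¬ E.M.Cone (v ∘ κ) x t := by
      intro κ x t hc
      have h1 := exists_eq_of_injective_of_ne
        (Subtype.val_injective.comp hc.injective) (j := i) (fun l => (v (κ l)).2) x.2
      obtain ⟨l, hl⟩ := h1
      have h2 := hc l
      rw [show (v ∘ κ) l = x from Subtype.ext hl, E.M.e_self] at h2
      cases h2
    have hE : E.GoodReds := ⟨fun _ _ _ => rfl, fun κ s t x _ _ hx => absurd hx (hno κ x t),
      fun κ s t t' x x' k l _ _ hx => absurd hx (hno κ x t)⟩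
    let g : Fin n → Option V := fun k => if h : k ≠ i then some ⟨k, h⟩ else none
    have hg : ∀ k (h : k ≠ i), g k = some ⟨k, h⟩ := fun k h => dif_pos h
    have hM : ∀ (x y : V), (E.graph hn hE).e (some x) (some y) = p.e x.1 y.1 := fun x y => rfl
    refine ⟨(E.graph hn hE).comap g, ⟨fun k l hk hl => ?_, fun t ht => ?_⟩, ?_⟩
    · show (E.graph hn hE).e _ _ = _
      rw [hg k hk, hg l hl]; rfl
    · have h1 : g ∘ t = some ∘ fun l => (⟨t l, ht l⟩ : V) := funext fun l => hg _ (ht l)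
      show E.yellow (g ∘ t) = _
      rw [h1, E.yellow_some]; rfl
    · rw [comap_comap]
      refine Eq.trans ?_ (E.graph_comap hn hE)
      congr 1
      funext l
      by_cases hl : l = j
      · rw [if_pos hl]
        exact dif_neg (not_not.2 ((hτ l).2 hl))
      · rw [if_neg hl]
        have h1 : τ l ≠ i := mt (hτ l).1 hl
        rw [Function.comp_apply, hg _ h1]
        exact congrArg some (Subtype.ext (hv l hl).symm)

theorem repl_self {ι : Type} (i j : ι) : repl i j i = j := by simp [repl]

theorem repl_of_ne {ι : Type} {i j k : ι} (h : k ≠ i) : repl i j k = k := by simp [repl, h]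

section PEA

variable {n : ℕ}

/-- The cylindrifications of the rainbow algebra, on sets of atoms. -/
def rainbowC (i : Fin n) (X : Set (RainbowAtom n)) : Set (RainbowAtom n) := (rainbowAlg n).c i X

/-- The diagonals of the rainbow algebra, as sets of atoms. -/
def rainbowD (i j : Fin n) : Set (RainbowAtom n) := (rainbowAlg n).d trivial i j

/-- The substitutions of the rainbow algebra, on sets of atoms. -/
def rainbowS (τ : Fin n → Fin n) (hτ : Finitary τ) (X : Set (RainbowAtom n)) :
    Set (RainbowAtom n) := (rainbowAlg n).s τ hτ X

theorem mem_rainbowC {i : Fin n} {X : Set (RainbowAtom n)} {p : RainbowAtom n} :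
    p ∈ rainbowC i X ↔ ∃ q ∈ X, p.AgreeOff i q := Iff.rfl

theorem mem_rainbowD {i j : Fin n} {p : RainbowAtom n} :
    p ∈ rainbowD i j ↔ p.edge i j = none := Iff.rfl

theorem mem_rainbowS {τ : Fin n → Fin n} {h : Finitary τ} {X : Set (RainbowAtom n)}
    {p : RainbowAtom n} : p ∈ rainbowS τ h X ↔ p.comap τ ∈ X := by
  constructor
  · rintro ⟨q, hq, h1, h2⟩
    have : p.comap τ = q := by
      ext1
      · rw [h1, RainbowAtom.comap_edge]
      · rw [h2, RainbowAtom.comap_yellow]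
    rwa [this]
  · intro hp
    exact ⟨_, hp, RainbowAtom.comap_edge τ p, RainbowAtom.comap_yellow τ p⟩

theorem RainbowAtom.comap_comap (σ τ : Fin n → Fin n) (p : RainbowAtom n) :
    (p.comap σ).comap τ = p.comap (σ ∘ τ) := by
  apply toPG_injective
  simp [PG.comap_comap]

theorem RainbowAtom.comap_id (p : RainbowAtom n) : p.comap id = p := by
  apply toPG_injective
  simp [PG.comap_id]

theorem RainbowAtom.comap_repl {p : RainbowAtom n} {i j : Fin n} (h : p.edge i j = none) :
    p.comap (repl i j) = p := by
  apply toPG_injective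
  rw [toPG_comap]
  refine (PG.comap_eq_of_e_eq_none fun k => ?_).trans (PG.comap_id _)
  by_cases hk : k = i
  · subst hk
    rw [repl_self]
    exact PG.e_none_symm _ ((p.edge_eq_none_iff _ _).1 h)
  · rw [repl_of_ne hk]
    exact p.toPG.e_self k

/-- Amalgamation of atoms of the rainbow algebra. -/
theorem RainbowAtom.exists_amalgam (hn : 3 ≤ n) (p r : RainbowAtom n) (τ : Fin n → Fin n)
    (i j : Fin n) (hτ : ∀ l, τ l = i ↔ l = j) (h : (p.comap τ).AgreeOff j r) :
    ∃ q : RainbowAtom n, p.AgreeOff i q ∧ q.comap τ = r := by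
  rw [agreeOff_iff, toPG_comap] at h
  obtain ⟨q, hq, hqr⟩ := PG.exists_amalgam hn p.toPG r.toPG τ i j hτ h.symm
  refine ⟨ofPG q, ?_, ?_⟩
  · rw [agreeOff_iff, toPG_ofPG]
    exact hq.symm
  · apply toPG_injective
    rw [toPG_comap, toPG_ofPG, hqr]

theorem RainbowAtom.agreeOff_comap_of_eqOn (p : RainbowAtom n) {i : Fin n} {σ τ : Fin n → Fin n}
    (h : ∀ j, j ≠ i → σ j = τ j) : (p.comap σ).AgreeOff i (p.comap τ) := by
  rw [agreeOff_iff, toPG_comap, toPG_comap]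
  exact PG.agreeOff_comap_of_eqOn _ h

theorem RainbowAtom.AgreeOff.symm {i : Fin n} {p q : RainbowAtom n} (h : p.AgreeOff i q) :
    q.AgreeOff i p := agreeOff_iff.2 (agreeOff_iff.1 h).symm

theorem RainbowAtom.AgreeOff.trans {i : Fin n} {p q r : RainbowAtom n} (h : p.AgreeOff i q)
    (h' : q.AgreeOff i r) : p.AgreeOff i r :=
  agreeOff_iff.2 ((agreeOff_iff.1 h).trans (agreeOff_iff.1 h'))

theorem RainbowAtom.AgreeOff.refl (i : Fin n) (p : RainbowAtom n) : p.AgreeOff i p :=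
  agreeOff_iff.2 (.refl _ _)

/-- The accessibility relations commute. -/
theorem RainbowAtom.exists_agreeOff_comm (hn : 3 ≤ n) {i j : Fin n} {p q r : RainbowAtom n}
    (h : p.AgreeOff i q) (h' : q.AgreeOff j r) : ∃ q', p.AgreeOff j q' ∧ q'.AgreeOff i r := by
  by_cases hij : i = j
  · subst hij; exact ⟨q, h, h'⟩
  obtain ⟨l, hl⟩ : ∃ l, l ∉ ({i, j} : Finset (Fin n)) := by
    by_contra hcon
    push Not at hcon
    have h1 : (Finset.univ : Finset (Fin n)).card ≤ ({i, j} : Finset (Fin n)).card :=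
      Finset.card_le_card fun x _ => hcon x
    have h2 := Finset.card_le_two (a := i) (b := j)
    rw [Finset.card_univ, Fintype.card_fin] at h1
    omega
  simp only [Finset.mem_insert, Finset.mem_singleton, not_or] at hl
  have hτ : ∀ k, k ≠ j → repl i l k ≠ j ∧ repl i l k ≠ i := by
    intro k hk
    by_cases hki : k = i
    · subst hki; rw [repl_self]; exact ⟨hl.2, hl.1⟩
    · rw [repl_of_ne hki]; exact ⟨hk, hki⟩
  obtain ⟨q', h1, h2⟩ := exists_amalgam hn p (r.comap (repl i l)) (repl i l) j j
    (fun k => ⟨fun hk => by_contra fun hkj => (hτ k hkj).1 hk,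
      by rintro rfl; exact repl_of_ne (Ne.symm hij)⟩) (by
    refine ⟨fun a b ha hb => ?_, fun t ht => ?_⟩
    · rw [comap_edge, comap_edge, h.1 _ _ (hτ a ha).2 (hτ b hb).2,
        h'.1 _ _ (hτ a ha).1 (hτ b hb).1]
    · rw [comap_yellow, comap_yellow, h.2 (repl i l ∘ t) fun a => (hτ _ (ht a)).2,
        h'.2 (repl i l ∘ t) fun a => (hτ _ (ht a)).1])
  refine ⟨q', h1, ?_⟩
  have h3 : ∀ s : RainbowAtom n, s.AgreeOff i (s.comap (repl i l)) := fun s => by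
    have h4 := s.agreeOff_comap_of_eqOn (i := i) (σ := id) (τ := repl i l)
      fun k hk => (repl_of_ne hk).symm
    rwa [comap_id] at h4
  exact (h3 q').trans (by rw [h2]; exact (h3 r).symm)

theorem rainbowAlg_mem_variety (hn : 3 ≤ n) : rainbowAlg n ∈ variety .PEA (Fin n) := by
  show PolyadicEqualityLaws (A := Set (RainbowAtom n)) rainbowC rainbowD rainbowS
  refine ⟨⟨⟨?_, ?_, ?_, ?_⟩, ?_, ?_, ?_, ?_, ?_, ?_, ?_⟩, ?_, ?_, ?_⟩
  · intro i
    ext p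
    refine ⟨?_, fun h => h.elim⟩
    rintro ⟨q, hq, -⟩
    exact hq
  · exact fun i X p hp => ⟨p, hp, RainbowAtom.AgreeOff.refl i p⟩
  · intro i X Y
    ext p
    constructor
    · rintro ⟨q, ⟨hq, r, hr, hqr⟩, hpq⟩
      exact ⟨⟨q, hq, hpq⟩, r, hr, RainbowAtom.AgreeOff.trans hpq hqr⟩
    · rintro ⟨⟨q, hq, hpq⟩, r, hr, hpr⟩
      exact ⟨q, ⟨hq, r, hr, (RainbowAtom.AgreeOff.symm hpq).trans hpr⟩, hpq⟩
  · have key : ∀ i j (X : Set (RainbowAtom n)), rainbowC i (rainbowC j X) ⊆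
        rainbowC j (rainbowC i X) := by
      rintro i j X p ⟨q, ⟨r, hr, hqr⟩, hpq⟩
      obtain ⟨q', h1, h2⟩ := RainbowAtom.exists_agreeOff_comm hn hpq hqr
      exact ⟨q', ⟨r, hr, h2⟩, h1⟩
    exact fun i j X => Set.Subset.antisymm (key i j X) (key j i X)
  · intro τ hτ X Y
    ext p
    simp only [mem_rainbowS, Set.sup_eq_union, Set.mem_union]
  · intro τ hτ X
    ext p
    simp only [mem_rainbowS, Set.mem_compl_iff]
  · intro h X
    ext p
    rw [mem_rainbowS, RainbowAtom.comap_id]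
  · intro σ τ hσ hτ h X
    ext p
    rw [mem_rainbowS, mem_rainbowS, mem_rainbowS, RainbowAtom.comap_comap]
  · intro σ τ hσ hτ i X h
    ext p
    rw [mem_rainbowS, mem_rainbowS, mem_rainbowC, mem_rainbowC]
    have h1 := p.agreeOff_comap_of_eqOn h
    exact ⟨fun ⟨q, hq, hpq⟩ => ⟨q, hq, h1.symm.trans hpq⟩,
      fun ⟨q, hq, hpq⟩ => ⟨q, hq, h1.trans hpq⟩⟩
  · intro τ hτ i X h
    ext p
    rw [mem_rainbowC]
    simp only [mem_rainbowS]
    refine ⟨?_, fun hp => ⟨p, hp, RainbowAtom.AgreeOff.refl i p⟩⟩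
    rintro ⟨q, hq, hpq⟩
    have : p.comap τ = q.comap τ := by
      ext1
      · rw [RainbowAtom.comap_edge, RainbowAtom.comap_edge, hpq.1 _ _ (h _) (h _)]
      · rw [RainbowAtom.comap_yellow, RainbowAtom.comap_yellow, hpq.2 (τ ∘ _) fun l => h _]
    rwa [this]
  · intro τ hτ i j X h
    ext p
    rw [mem_rainbowC, mem_rainbowS, mem_rainbowC]
    simp only [mem_rainbowS]
    constructor
    · rintro ⟨q, hq, hpq⟩
      have h1 : ∀ k, k ≠ j → τ k ≠ i := fun k hk => mt (h k).1 hk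
      refine ⟨q.comap τ, hq, fun a b ha hb => ?_, fun t ht => ?_⟩
      · rw [RainbowAtom.comap_edge, RainbowAtom.comap_edge, hpq.1 _ _ (h1 a ha) (h1 b hb)]
      · rw [RainbowAtom.comap_yellow, RainbowAtom.comap_yellow, hpq.2 (τ ∘ t) fun l => h1 _ (ht l)]
    · rintro ⟨r, hr, hpr⟩
      obtain ⟨q, h1, h2⟩ := RainbowAtom.exists_amalgam hn p r τ i j h hpr
      exact ⟨q, by rw [h2]; exact hr, h1⟩
  · intro i
    ext p
    refine ⟨fun _ => trivial, fun _ => ?_⟩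
    rw [mem_rainbowD, p.edge_eq_none_iff, p.toPG.e_self]
  · intro τ hτ i j
    ext p
    rw [mem_rainbowS, mem_rainbowD, mem_rainbowD, RainbowAtom.comap_edge]
  · intro i j X p hp
    rw [mem_rainbowS, RainbowAtom.comap_repl hp.2]
    exact hp.1

/-- There are only countably many shades of yellow. -/
theorem countable_ok_shades : {S : Set ℕ | S.Finite ∨ S = Set.univ}.Countable := by
  have h := (Set.countable_range fun s : Finset ℕ => (s : Set ℕ)).union
    (Set.countable_singleton Set.univ)
  refine h.mono ?_
  rintro S (hS | hS)
  · exact Or.inl ⟨hS.toFinset, by simp⟩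
  · exact Or.inr hS

instance RainbowAtom.countable : Countable (RainbowAtom n) := by
  have : Countable {S : Set ℕ | S.Finite ∨ S = Set.univ} := countable_ok_shades
  have hy : ∀ (p : RainbowAtom n) t, ∃ o : Option {S : Set ℕ | S.Finite ∨ S = Set.univ},
      p.toPG.y t = o.map Subtype.val := by
    intro p t
    cases h : p.toPG.y t with
    | none => exact ⟨none, rfl⟩
    | some S => exact ⟨some ⟨S, p.toPG.y_ok t S h⟩, rfl⟩
  choose f hf using hy
  have : Countable (Col ℕ ℕ) := Col.countable
  refine Function.Injective.countable (f := fun p : RainbowAtom n =>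
    ((p.toPG.e, f p) : (Fin n → Fin n → Option (Col ℕ ℕ)) × _)) ?_
  intro p q h
  have h1 := congrArg Prod.fst h
  have h2 := congrArg Prod.snd h
  apply toPG_injective
  ext1
  · exact congrFun (congrFun h1 _) _
  · rw [hf, hf]
    exact congrArg _ (congrFun h2 _)

theorem rainbowAlg_isAtomic : IsAtomic (rainbowAlg n) :=
  inferInstanceAs (IsAtomic (Set (RainbowAtom n)))

theorem rainbowAlg_countable_atoms : {a : rainbowAlg n | IsAtom a}.Countable := by
  refine (Set.countable_range fun p : RainbowAtom n => ({p} : Set (RainbowAtom n))).mono ?_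
  intro a ha
  obtain ⟨p, hp⟩ := Set.isAtom_iff.1 (show IsAtom (α := Set (RainbowAtom n)) a from ha)
  exact ⟨p, hp.symm⟩

end PEA

/-! ### Calculations in substitution algebras -/

namespace QuantifierLaws

variable {ι : Type} {D : Type u} [BooleanAlgebra D] {c : ι → D → D} (hD : QuantifierLaws c)
include hD

theorem c_top (i : ι) : c i ⊤ = ⊤ := top_le_iff.1 (hD.le_c i ⊤)

theorem c_c (i : ι) (x : D) : c i (c i x) = c i x := by
  have := hD.c_inf_c i ⊤ x
  rwa [top_inf_eq, hD.c_top, top_inf_eq] at this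

theorem c_mono (i : ι) {x y : D} (h : x ≤ y) : c i x ≤ c i y := by
  have := hD.c_inf_c i x y
  rw [inf_eq_left.2 (h.trans (hD.le_c i y))] at this
  exact inf_eq_left.1 this.symm

theorem c_compl {i : ι} {x : D} (h : c i x = x) : c i xᶜ = xᶜ := by
  refine le_antisymm (le_compl_iff_disjoint_right.2 (disjoint_iff.2 ?_)) (hD.le_c i _)
  have h1 := hD.c_inf_c i xᶜ x
  rw [h, compl_inf_eq_bot, hD.c_bot] at h1
  exact h1.symm

theorem c_inf {i : ι} {x y : D} (h : c i x = x) (h' : c i y = y) : c i (x ⊓ y) = x ⊓ y := by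
  have := hD.c_inf_c i x y
  rwa [h, h'] at this

theorem c_c_free {i j : ι} {x : D} (h : c i x = x) : c i (c j x) = c j x := by
  rw [hD.c_comm, h]

theorem c_inf_eq_bot {i : ι} {x y : D} (h : c i y = y) (hxy : x ⊓ y = ⊥) : c i x ⊓ y = ⊥ := by
  have := hD.c_inf_c i x y
  rw [h, hxy, hD.c_bot] at this
  exact this.symm

end QuantifierLaws

namespace SubstitutionLaws

variable {ι : Type} {D : Type u} [BooleanAlgebra D] {c : ι → D → D} {s : ι → ι → D → D}
  (hD : SubstitutionLaws c s)
include hD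

theorem s_inf (i j : ι) (x y : D) : s i j (x ⊓ y) = s i j x ⊓ s i j y := by
  have : x ⊓ y = (xᶜ ⊔ yᶜ)ᶜ := by rw [compl_sup, compl_compl, compl_compl]
  rw [this, hD.s_compl, hD.s_sup, hD.s_compl, hD.s_compl, compl_sup, compl_compl, compl_compl]

theorem s_mono (i j : ι) {x y : D} (h : x ≤ y) : s i j x ≤ s i j y := by
  rw [← inf_eq_left, ← hD.s_inf, inf_eq_left.2 h]

theorem s_bot (i j : ι) : s i j ⊥ = ⊥ := by
  calc s i j ⊥ = s i j (⊥ ⊓ ⊥ᶜ) := by rw [inf_compl_eq_bot]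
    _ = ⊥ := by rw [hD.s_inf, hD.s_compl, inf_compl_eq_bot]

theorem s_free {i : ι} (j : ι) {x : D} (h : c i x = x) : s i j x = x := by
  rw [← h, hD.s_c]

theorem c_s_free {i j k : ι} {x : D} (hi : k ≠ i) (hj : k ≠ j) (h : c k x = x) :
    c k (s i j x) = s i j x := by
  rw [← hD.s_c_comm i j k x hi hj, h]

/-- Renaming a coordinate to a fresh one can be undone. -/
theorem s_s_cancel {i j : ι} {x : D} (h : c j x = x) : s j i (s i j x) = x := by
  rw [hD.s_s i i j x, hD.s_self, hD.s_free i h]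

/-- Renaming a coordinate via a fresh one. -/
theorem s_s_trans {i k l : ι} {x : D} (hki : k ≠ i) (h : c k x = x) :
    s k l (s i k x) = s i l x := by
  by_cases hkl : k = l
  · subst hkl; rw [hD.s_self]
  · rw [hD.s_s l i k x, hD.s_free l (hD.c_s_free hki hkl h)]

end SubstitutionLaws

/-! ### The cone atoms -/

section ConeAtom

variable {n : ℕ}

/-- The last coordinate, which is used for the apex of cones. -/
def lastCoord (hn : 3 ≤ n) : Fin n := ⟨n - 1, by omega⟩

/-- The base coordinates of cones. -/
def baseCoord (hn : 3 ≤ n) (j : Fin (n - 1)) : Fin n := ⟨j, by omega⟩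

theorem baseCoord_ne (hn : 3 ≤ n) (j : Fin (n - 1)) : baseCoord hn j ≠ lastCoord hn := by
  intro h
  have h1 : j.1 = n - 1 := congrArg Fin.val h
  omega

/-- The edges of a cone of tint `t`: all edges between base points have the colour `w_0`. -/
def coneEdge (hn : 3 ≤ n) (t : ℕ) (i j : Fin n) : Option (Col ℕ ℕ) :=
  if i = j then none
  else if j = lastCoord hn then some (.cone t i)
  else if i = lastCoord hn then some (.cone t j)
  else some (.white 0)

theorem coneEdge_symm (hn : 3 ≤ n) (t : ℕ) (i j : Fin n) :
    coneEdge hn t j i = (coneEdge hn t i j).map Col.rev := by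
  unfold coneEdge
  by_cases hij : i = j
  · simp [hij]
  · by_cases hi : i = lastCoord hn <;> by_cases hj : j = lastCoord hn
    · exact absurd (hi.trans hj.symm) hij
    · simp [hi, hj, Ne.symm hj]
    · simp [hi, hj, Ne.symm hi]
    · simp [hij, Ne.symm hij, hi, hj, Col.rev]

theorem coneEdge_cases (hn : 3 ≤ n) (t : ℕ) {i j : Fin n} {a : Col ℕ ℕ}
    (h : coneEdge hn t i j = some a) :
    (j = lastCoord hn ∧ i ≠ j ∧ a = .cone t i) ∨ (i = lastCoord hn ∧ i ≠ j ∧ a = .cone t j) ∨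
      (i ≠ lastCoord hn ∧ j ≠ lastCoord hn ∧ i ≠ j ∧ a = .white 0) := by
  unfold coneEdge at h
  split_ifs at h with h1 h2 h3
  · exact Or.inl ⟨h2, h1, (Option.some.inj h).symm⟩
  · exact Or.inr (Or.inl ⟨h3, h1, (Option.some.inj h).symm⟩)
  · exact Or.inr (Or.inr ⟨h3, h2, h1, (Option.some.inj h).symm⟩)

theorem cone_avail (t : ℕ) {i : ℕ} (hi : i < n - 1) : (Col.cone t i : Col ℕ ℕ).Avail n := by
  cases i with
  | zero => trivial
  | succ i => exact ⟨by omega, by omega⟩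

open Classical in
/-- The pre-graph of a cone of tint `t` over a base with the shade `ℕ` of yellow. -/
noncomputable def conePG (hn : 3 ≤ n) (t : ℕ) : PG stdPalette n (Fin n) where
  e := coneEdge hn t
  y a := if Function.Injective a ∧ ∀ i, a i ≠ lastCoord hn then some Set.univ else none
  e_self x := if_pos rfl
  e_congr x y z h := by
    have : x = y := by
      by_contra hxy
      unfold coneEdge at h
      rw [if_neg hxy] at h
      split_ifs at h
    rw [this]
  e_symm := coneEdge_symm hn t
  e_avail x y a h := by
    have hlt : ∀ i : Fin n, i ≠ lastCoord hn → i.1 < n - 1 := by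
      intro i hi
      have h1 : i.1 ≠ n - 1 := fun h => hi (Fin.ext h)
      omega
    rcases coneEdge_cases hn t h with ⟨h1, h2, rfl⟩ | ⟨h1, h2, rfl⟩ | ⟨h1, h2, h3, rfl⟩
    · exact cone_avail t (hlt x (h1 ▸ h2))
    · exact cone_avail t (hlt y (h1 ▸ h2.symm))
    · exact Nat.zero_le _
  tri x y z a b c ha hb hc := by
    -- a triangle has two whites, or one white and two different greens
    have key : ∀ i j : Fin n, i ≠ j → 
        Tri (Col.cone t i : Col ℕ ℕ) (Col.white 0) (Col.cone t j) := by
      intro i j hij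
      refine ⟨fun h => h.2.1 rfl, ?_, ?_, ?_, ?_⟩
      · rintro ⟨h1, h2⟩
        rw [Col.gidx_cone] at h1 h2
        exact hij (Fin.ext ((Option.some.inj h1).trans (Option.some.inj h2).symm))
      · rcases j with ⟨_ | j, hj⟩ <;> trivial
      · rcases i with ⟨_ | i, hi⟩ <;> trivial
      · rcases i with ⟨_ | i, hi⟩ <;> trivial
    rcases coneEdge_cases hn t ha with ⟨h1, h2, rfl⟩ | ⟨h1, h2, rfl⟩ | ⟨h1, h2, h3, rfl⟩ <;>
      rcases coneEdge_cases hn t hb with ⟨h1', h2', rfl⟩ | ⟨h1', h2', rfl⟩ | ⟨h1', h2', h3', rfl⟩ <;>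
      rcases coneEdge_cases hn t hc with ⟨h1'', h2'', rfl⟩ | ⟨h1'', h2'', rfl⟩ |
        ⟨h1'', h2'', h3'', rfl⟩ <;>
      first
      | (exfalso; simp_all; done)
      | (exact key _ _ h3')
      | (have := (key x z h3'').swap_xy; simpa using this)
      | (have := (key x y h3).swap_xy.swap_yz; simpa using this)
      | (refine ⟨fun h => h.1 rfl, ?_, ?_, ?_, ?_⟩ <;> simp [Vtx, Col.gidx, Col.rev, RedComp])
  y_congr s t' h := by
    have : s = t' := by
      funext i
      by_contra hxy
      have h1 := h i
      unfold coneEdge at h1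
      rw [if_neg hxy] at h1
      split_ifs at h1
    rw [this]
  y_isSome a := by
    have h2 : (∀ i j, i ≠ j → ∃ b, coneEdge hn t (a i) (a j) = some b ∧ ¬ b.IsGreen) ↔
        Function.Injective a ∧ ∀ i, a i ≠ lastCoord hn := by
      constructor
      · intro h
        have hinj : Function.Injective a := by
          intro i j hij
          by_contra hne
          obtain ⟨b, hb, -⟩ := h i j hne
          rw [hij, coneEdge, if_pos rfl] at hb
          cases hb
        refine ⟨hinj, fun i hi => ?_⟩
        obtain ⟨j, hj⟩ : ∃ j, i ≠ j := by
          have : Nontrivial (Fin (n - 1)) := Fin.nontrivial_iff_two_le.2 (by omega)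
          obtain ⟨j, hj⟩ := exists_ne i
          exact ⟨j, hj.symm⟩
        obtain ⟨b, hb, hg⟩ := h j i hj.symm
        rw [coneEdge, if_neg (fun h => hj (hinj h).symm), if_pos hi] at hb
        cases hb
        exact hg (Col.isGreen_cone _ _)
      · rintro ⟨h1, h2⟩ i j hij
        refine ⟨.white 0, ?_, fun h => h rfl⟩
        rw [coneEdge, if_neg (fun h => hij (h1 h)), if_neg (h2 j), if_neg (h2 i)]
    rw [h2]
    split_ifs with h <;> simp [h]
  y_ok a S h := by
    split_ifs at h
    exact Or.inr (Option.some.inj h).symm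
  y_cone a S z s h _ := by
    split_ifs at h
    rw [← Option.some.inj h]
    trivial

/-- The atom of a cone of tint `t`. -/
noncomputable def coneAtom (hn : 3 ≤ n) (t : ℕ) : RainbowAtom n := .ofPG (conePG hn t)

theorem coneAtom_e (hn : 3 ≤ n) (t : ℕ) (j : Fin (n - 1)) :
    (coneAtom hn t).toPG.e (baseCoord hn j) (lastCoord hn) = some (.cone t j) := by
  rw [coneAtom, RainbowAtom.toPG_ofPG]
  show coneEdge _ _ _ _ = _
  rw [coneEdge, if_neg (baseCoord_ne hn j), if_pos rfl]
  rfl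

/-- All the cones have the same base. -/
theorem coneAtom_agreeOff (hn : 3 ≤ n) (t t' : ℕ) :
    (coneAtom hn t).AgreeOff (lastCoord hn) (coneAtom hn t') := by
  rw [RainbowAtom.agreeOff_iff, coneAtom, coneAtom, RainbowAtom.toPG_ofPG, RainbowAtom.toPG_ofPG]
  refine ⟨fun j k hj hk => ?_, fun a _ => rfl⟩
  show coneEdge _ _ _ _ = coneEdge _ _ _ _
  unfold coneEdge
  rw [if_neg hk, if_neg hj, if_neg hk, if_neg hj]

end ConeAtom

/-! ### Descent in a substitution algebra of dimension `n + 3` -/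

section Edges

variable {n : ℕ}

/-- The set of atoms whose edge from `i` to `k` is `o`. -/
def edgeSet (o : Option Colour) (i k : Fin n) : Set (RainbowAtom n) := {p | p.edge i k = o}

theorem rainbowC_edgeSet (o : Option Colour) {i k j : Fin n} (hi : i ≠ j) (hk : k ≠ j) :
    rainbowC j (edgeSet o i k) = edgeSet o i k := by
  ext p
  rw [mem_rainbowC]
  constructor
  · rintro ⟨q, hq, hpq⟩
    exact (hpq.1 i k hi hk).trans hq
  · exact fun hp => ⟨p, hp, .refl j p⟩

theorem rainbowS_edgeSet_left (o : Option Colour) {i i' k : Fin n} (hk : k ≠ i) :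
    rainbowS (repl i i') (finitary_repl i i') (edgeSet o i k) = edgeSet o i' k := by
  ext p
  rw [mem_rainbowS]
  show (p.comap _).edge _ _ = _ ↔ p.edge _ _ = _
  rw [RainbowAtom.comap_edge, repl_self, repl_of_ne hk]

theorem rainbowS_edgeSet_right (o : Option Colour) {i k k' : Fin n} (hi : i ≠ k) :
    rainbowS (repl k k') (finitary_repl k k') (edgeSet o i k) = edgeSet o i k' := by
  ext p
  rw [mem_rainbowS]
  show (p.comap _).edge _ _ = _ ↔ p.edge _ _ = _
  rw [RainbowAtom.comap_edge, repl_self, repl_of_ne hi]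

end Edges

/-- The map `h` embeds the rainbow algebra in the neat reduct of a substitution algebra of dimension
`n + 3`, so that joins equal to `⊤` are preserved; `D`, `c` and `s` are the large algebra, and
`complete` expresses the last condition for families of sets that cover all atoms. -/
structure RainbowNeatEmbedding (n : ℕ) {D : Type u} [BooleanAlgebra D]
    (c : Fin (n + 3) → D → D) (s : Fin (n + 3) → Fin (n + 3) → D → D)
    (h : Set (RainbowAtom n) → D) : Prop where
  laws : SubstitutionLaws c s
  injective : Function.Injective h
  map_bot : h ∅ = ⊥
  map_inf : ∀ X Y, h (X ∩ Y) = h X ⊓ h Y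
  map_c : ∀ i X, h (rainbowC i X) = c (Fin.castAdd 3 i) (h X)
  map_s : ∀ i j X, h (rainbowS (repl i j) (finitary_repl i j) X) =
    s (Fin.castAdd 3 i) (Fin.castAdd 3 j) (h X)
  neat : ∀ k : Fin (n + 3), n ≤ k → ∀ X, c k (h X) = h X
  complete : ∀ F : Set (Set (RainbowAtom n)), (∀ p, ∃ X ∈ F, p ∈ X) → ∀ d,
    (∀ X ∈ F, h X ≤ d) → (∀ k : Fin (n + 3), n ≤ k → c k d = d) → d = ⊤

namespace RainbowNeatEmbedding

variable {n : ℕ} {D : Type u} [BooleanAlgebra D] {c : Fin (n + 3) → D → D}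
  {s : Fin (n + 3) → Fin (n + 3) → D → D} {h : Set (RainbowAtom n) → D}

/-- The old coordinates among the `n + 3` coordinates. -/
abbrev old (i : Fin n) : Fin (n + 3) := Fin.castAdd 3 i

theorem old_ne {i : Fin n} {u : Fin (n + 3)} (hu : n ≤ u) : old i ≠ u := by
  rintro rfl
  have := i.2
  simp at hu
  omega

theorem old_ne_old {i j : Fin n} (hij : i ≠ j) : old i ≠ old j := fun h =>
  hij (Fin.castAdd_injective _ _ h)

/-- The element "the edge from `u` to `v` is `o`", for new coordinates `u`, `v`, obtained by renaming
the old coordinates `i` and `k`. -/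
def edgeAt {D : Type u} (s : Fin (n + 3) → Fin (n + 3) → D → D) (h : Set (RainbowAtom n) → D)
    (i k : Fin n) (o : Option Colour) (u v : Fin (n + 3)) : D :=
  s (old i) u (s (old k) v (h (edgeSet o i k)))

variable (H : RainbowNeatEmbedding n c s h)
include H

theorem free_edge (o : Option Colour) {i k j : Fin n} (hi : i ≠ j) (hk : k ≠ j) :
    c (old j) (h (edgeSet o i k)) = h (edgeSet o i k) := by
  rw [← H.map_c, rainbowC_edgeSet o hi hk]

theorem mono {X Y : Set (RainbowAtom n)} (hXY : X ⊆ Y) : h X ≤ h Y := by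
  rw [← inf_eq_left, ← H.map_inf, Set.inter_eq_left.2 hXY]

theorem edgeAt_congr_left {i i' k : Fin n} (hik : i ≠ k) (hik' : i' ≠ k) (o : Option Colour)
    {u v : Fin (n + 3)} (hv : n ≤ v) :
    edgeAt s h i k o u v = edgeAt s h i' k o u v := by
  by_cases hii : i = i'
  · rw [hii]
  unfold edgeAt
  have h1 : h (edgeSet o i' k) = s (old i) (old i') (h (edgeSet o i k)) := by
    rw [← H.map_s, rainbowS_edgeSet_left o hik.symm]
  rw [h1, H.laws.s_s_comm v (old k) (old i') (old i) _ (old_ne hv).symm (old_ne hv).symm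
    (old_ne hv).symm (old_ne_old hik'.symm) (old_ne_old hik.symm) (old_ne_old (Ne.symm hii))]
  refine (H.laws.s_s_trans (old_ne_old (Ne.symm hii)) ?_).symm
  exact H.laws.c_s_free (old_ne_old hik') (old_ne hv) (H.free_edge o hii hik'.symm)

theorem edgeAt_congr_right {i k k' : Fin n} (hik : i ≠ k) (hik' : i ≠ k') (o : Option Colour)
    (u v : Fin (n + 3)) : edgeAt s h i k o u v = edgeAt s h i k' o u v := by
  by_cases hkk : k = k'
  · rw [hkk]
  unfold edgeAt
  have h1 : h (edgeSet o i k') = s (old k) (old k') (h (edgeSet o i k)) := by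
    rw [← H.map_s, rainbowS_edgeSet_right o hik]
  rw [h1, H.laws.s_s_trans (old_ne_old (Ne.symm hkk)) (H.free_edge o hik' hkk)]

/-- It does not matter which old coordinates are renamed. -/
theorem edgeAt_congr (hn : 3 ≤ n) {i k i' k' : Fin n} (hik : i ≠ k) (hik' : i' ≠ k')
    (o : Option Colour) {u v : Fin (n + 3)} (hv : n ≤ v) :
    edgeAt s h i k o u v = edgeAt s h i' k' o u v := by
  by_cases h1 : i' = k
  · subst h1
    obtain ⟨l, hl⟩ : ∃ l, l ∉ ({i, i'} : Finset (Fin n)) := by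
      by_contra hcon
      push Not at hcon
      have h1 : (Finset.univ : Finset (Fin n)).card ≤ ({i, i'} : Finset (Fin n)).card :=
        Finset.card_le_card fun x _ => hcon x
      have h2 := Finset.card_le_two (a := i) (b := i')
      rw [Finset.card_univ, Fintype.card_fin] at h1
      omega
    simp only [Finset.mem_insert, Finset.mem_singleton, not_or] at hl
    rw [H.edgeAt_congr_right hik (Ne.symm hl.1) o u v,
      H.edgeAt_congr_left (Ne.symm hl.1) (Ne.symm hl.2) o hv,
      H.edgeAt_congr_right (Ne.symm hl.2) hik' o u v]
  · rw [H.edgeAt_congr_left hik h1 o hv, H.edgeAt_congr_right h1 hik' o u v]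

/-- If the element saying that three new nodes form a triangle with edges `o₁`, `o₂`, `o₃` is nonzero,
then such a triangle occurs in some atom: rename the nodes to old coordinates. -/
theorem exists_triangle {o₁ o₂ o₃ : Option Colour} (hn : 3 ≤ n) {i k : Fin n} (hik : i ≠ k)
    {u v w : Fin (n + 3)} (hv : n ≤ v) (hw : n ≤ w)
    (hne : edgeAt s h i k o₁ u v ⊓ edgeAt s h i k o₂ v w ⊓ edgeAt s h i k o₃ u w ≠ ⊥) :
    ∃ (p : RainbowAtom n) (x y z : Fin n), p.edge x y = o₁ ∧ p.edge y z = o₂ ∧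
      p.edge x z = o₃ := by
  let x : Fin n := ⟨0, by omega⟩
  let y : Fin n := ⟨1, by omega⟩
  let z : Fin n := ⟨2, by omega⟩
  have hxy : x ≠ y := by simp [x, y]
  have hyz : y ≠ z := by simp [y, z]
  have hxz : x ≠ z := by simp [x, z]
  by_contra hcon
  apply hne
  have h0 : edgeSet o₁ x y ∩ edgeSet o₂ y z ∩ edgeSet o₃ x z = (∅ : Set (RainbowAtom n)) := by
    ext p
    refine ⟨fun hp => hcon ⟨p, x, y, z, hp.1.1, hp.1.2, hp.2⟩, fun hp => hp.elim⟩
  have h1 := congrArg (fun X => s (old x) u (s (old y) v (s (old z) w (h X)))) h0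
  simp only [H.map_inf, H.map_bot, H.laws.s_inf, H.laws.s_bot] at h1
  rw [H.laws.s_free w (H.free_edge o₁ hxz hyz)] at h1
  have h2 : c (old y) (s (old z) w (h (edgeSet o₃ x z))) = s (old z) w (h (edgeSet o₃ x z)) :=
    H.laws.c_s_free (old_ne_old hyz) (old_ne hw) (H.free_edge o₃ hxy hyz.symm)
  rw [H.laws.s_free v h2] at h1
  have h3 : c (old x) (s (old y) v (s (old z) w (h (edgeSet o₂ y z)))) =
      s (old y) v (s (old z) w (h (edgeSet o₂ y z))) :=
    H.laws.c_s_free (old_ne_old hxy) (old_ne hv) (H.laws.c_s_free (old_ne_old hxz) (old_ne hw)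
      (H.free_edge o₂ hxy.symm hxz.symm))
  rw [H.laws.s_free u h3] at h1
  rw [H.edgeAt_congr hn hik hxy o₁ hv, H.edgeAt_congr hn hik hyz o₂ hw,
    H.edgeAt_congr hn hik hxz o₃ hw]
  exact h1

/-- The same for triangles of an old coordinate `j` and two new nodes. -/
theorem exists_triangle_base {o₁ o₂ o₃ : Option Colour} (hn : 3 ≤ n) {i k : Fin n} (hik : i ≠ k)
    {j l : Fin n} (hjl : j ≠ l) {u v : Fin (n + 3)} (hv : n ≤ v)
    (hne : s (old l) u (h (edgeSet o₁ j l)) ⊓ edgeAt s h i k o₂ u v ⊓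
      s (old l) v (h (edgeSet o₃ j l)) ≠ ⊥) :
    ∃ (p : RainbowAtom n) (x y z : Fin n), p.edge x y = o₁ ∧ p.edge y z = o₂ ∧
      p.edge x z = o₃ := by
  obtain ⟨m, hm⟩ : ∃ m, m ∉ ({j, l} : Finset (Fin n)) := by
    by_contra hcon
    push Not at hcon
    have h1 : (Finset.univ : Finset (Fin n)).card ≤ ({j, l} : Finset (Fin n)).card :=
      Finset.card_le_card fun x _ => hcon x
    have h2 := Finset.card_le_two (a := j) (b := l)
    rw [Finset.card_univ, Fintype.card_fin] at h1
    omega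
  simp only [Finset.mem_insert, Finset.mem_singleton, not_or] at hm
  have hjm : j ≠ m := Ne.symm hm.1
  have hlm : l ≠ m := Ne.symm hm.2
  by_contra hcon
  apply hne
  have h0 : edgeSet o₁ j l ∩ edgeSet o₂ l m ∩ edgeSet o₃ j m = (∅ : Set (RainbowAtom n)) := by
    ext p
    refine ⟨fun hp => hcon ⟨p, j, l, m, hp.1.1, hp.1.2, hp.2⟩, fun hp => hp.elim⟩
  have h1 := congrArg (fun X => s (old l) u (s (old m) v (h X))) h0
  simp only [H.map_inf, H.map_bot, H.laws.s_inf, H.laws.s_bot] at h1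
  rw [H.laws.s_free v (H.free_edge o₁ hjm hlm)] at h1
  have h2 : c (old l) (s (old m) v (h (edgeSet o₃ j m))) = s (old m) v (h (edgeSet o₃ j m)) :=
    H.laws.c_s_free (old_ne_old hlm) (old_ne hv) (H.free_edge o₃ hjl hlm.symm)
  have h3 : h (edgeSet o₃ j m) = s (old l) (old m) (h (edgeSet o₃ j l)) := by
    rw [← H.map_s, rainbowS_edgeSet_right o₃ hjl]
  rw [H.laws.s_free u h2, h3, H.laws.s_s_trans (old_ne_old hlm.symm) (H.free_edge o₃ hjm hlm)] at h1
  rw [H.edgeAt_congr hn hik hlm o₂ hv]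
  exact h1

/-- The edge between two new nodes has some colour. This is the only place where joins equal to `⊤` need
to be preserved: the join of the elements `edgeAt … o u v` over all `o` is `⊤`. -/
theorem exists_edgeAt {i k : Fin n} (hik : i ≠ k) {u v : Fin (n + 3)} (hu : n ≤ u) (hv : n ≤ v)
    (huv : u ≠ v) {x : D} (hx : x ≠ ⊥) : ∃ o, x ⊓ edgeAt s h i k o u v ≠ ⊥ := by
  have L := H.laws
  by_contra hcon
  push Not at hcon
  apply hx
  -- make `x` independent of `i` and `k`, and rename `u` and `v` to `i` and `k`
  have hfi : ∀ o, c (old i) (edgeAt s h i k o u v) = edgeAt s h i k o u v := fun o =>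
    L.c_s _ _ _ (old_ne hu)
  have hfk : ∀ o, c (old k) (edgeAt s h i k o u v) = edgeAt s h i k o u v := fun o =>
    L.c_s_free (old_ne_old hik.symm) (old_ne hu) (L.c_s _ _ _ (old_ne hv))
  let z := c (old i) (c (old k) x)
  have hz1 : ∀ o, z ⊓ edgeAt s h i k o u v = ⊥ := fun o =>
    L.c_inf_eq_bot (hfi o) (L.c_inf_eq_bot (hfk o) (hcon o))
  have hzi : c (old i) z = z := L.c_c _ _
  have hzk : c (old k) z = z := L.c_c_free (L.c_c _ _)
  have hxz : x ≤ z := (L.le_c _ _).trans (L.le_c _ _)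
  let w := s v (old k) (s u (old i) z)
  have hw1 : ∀ o, w ⊓ h (edgeSet o i k) = ⊥ := by
    intro o
    have h1 := congrArg (fun y => s v (old k) (s u (old i) y)) (hz1 o)
    simp only [L.s_inf, L.s_bot, edgeAt] at h1
    rw [L.s_s_cancel (L.c_s_free (old_ne hu).symm huv (H.neat u hu _)),
      L.s_s_cancel (H.neat v hv _)] at h1
    exact h1
  have hw2 : s (old i) u (s (old k) v w) = z := by
    show s (old i) u (s (old k) v (s v (old k) (s u (old i) z))) = z
    rw [L.s_s_cancel (L.c_s_free (old_ne hu) (old_ne_old hik.symm) hzk), L.s_s_cancel hzi]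
  -- make `w` independent of the new coordinates
  let a : Fin (n + 3) := ⟨n, by omega⟩
  let b : Fin (n + 3) := ⟨n + 1, by omega⟩
  let d : Fin (n + 3) := ⟨n + 2, by omega⟩
  let w' := c a (c b (c d w))
  have hw3 : w ≤ w' := (L.le_c _ _).trans ((L.le_c _ _).trans (L.le_c _ _))
  have hw4 : ∀ o, w' ⊓ h (edgeSet o i k) = ⊥ := fun o =>
    L.c_inf_eq_bot (H.neat _ (by simp [a]) _) (L.c_inf_eq_bot (H.neat _ (by simp [b]) _)
      (L.c_inf_eq_bot (H.neat _ (by simp [d]) _) (hw1 o)))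
  have hw5 : ∀ m : Fin (n + 3), n ≤ m → c m w' = w' := by
    intro m hm
    have h1 : m = a ∨ m = b ∨ m = d := by
      have := m.2
      simp only [a, b, d, Fin.ext_iff]
      omega
    rcases h1 with rfl | rfl | rfl
    · exact L.c_c _ _
    · exact L.c_c_free (L.c_c _ _)
    · exact L.c_c_free (L.c_c_free (L.c_c _ _))
  have h1 := H.complete (Set.range fun o => edgeSet o i k)
    (fun p => ⟨_, ⟨p.edge i k, rfl⟩, rfl⟩) w'ᶜ (by
      rintro X ⟨o, rfl⟩
      exact le_compl_iff_disjoint_left.2 (disjoint_iff.2 (hw4 o)))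
    fun m hm => L.c_compl (hw5 m hm)
  have h2 : w = ⊥ := le_bot_iff.1 (hw3.trans (le_of_eq (compl_eq_top.1 h1)))
  rw [h2, L.s_bot, L.s_bot] at hw2
  exact le_bot_iff.1 (hxz.trans (le_of_eq hw2.symm))

omit H in
/-- The element "`u` is the apex of a cone of tint `t` over the old base points". -/
def apexAt (hn : 3 ≤ n) (s : Fin (n + 3) → Fin (n + 3) → D → D) (h : Set (RainbowAtom n) → D)
    (t : ℕ) (u : Fin (n + 3)) : D :=
  s (old (lastCoord hn)) u (h {coneAtom hn t})

theorem apexAt_le (hn : 3 ≤ n) (t : ℕ) (u : Fin (n + 3)) (j : Fin (n - 1)) :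
    apexAt hn s h t u ≤ s (old (lastCoord hn)) u
      (h (edgeSet (some (coneColour t j)) (baseCoord hn j) (lastCoord hn))) := by
  refine H.laws.s_mono _ _ (H.mono ?_)
  rintro p rfl
  show (coneAtom hn t).edge _ _ = _
  rw [RainbowAtom.edge_eq, coneAtom_e, ← Colour.ofCol_cone]
  rfl

theorem apexAt_ne_bot (hn : 3 ≤ n) (t : ℕ) {u : Fin (n + 3)} (hu : n ≤ u) :
    apexAt hn s h t u ≠ ⊥ := by
  intro h0
  have h1 := congrArg (s u (old (lastCoord hn))) h0
  rw [apexAt, H.laws.s_s_cancel (H.neat u hu _), H.laws.s_bot, ← H.map_bot] at h1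
  have h2 := H.injective h1
  exact (Set.singleton_ne_empty _) h2

theorem c_apexAt (hn : 3 ≤ n) (t : ℕ) {u : Fin (n + 3)} (hu : n ≤ u) :
    c u (apexAt hn s h t u) = h (rainbowC (lastCoord hn) {coneAtom hn 0}) := by
  rw [apexAt, H.laws.c_s_swap, H.laws.s_free _ (H.neat u hu _), ← H.map_c]
  congr 1
  ext p
  simp only [mem_rainbowC, Set.mem_singleton_iff, exists_eq_left]
  exact ⟨fun hp => hp.trans (coneAtom_agreeOff hn _ _), fun hp => hp.trans (coneAtom_agreeOff hn _ _)⟩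

/-- A further cone can be added at an unused new coordinate. -/
theorem inf_apexAt_ne_bot (hn : 3 ≤ n) (t t' : ℕ) {u w : Fin (n + 3)} (hu : n ≤ u) (hw : n ≤ w)
    {x : D} (hx : x ≠ ⊥) (hxu : x ≤ apexAt hn s h t u) (hxw : c w x = x) :
    x ⊓ apexAt hn s h t' w ≠ ⊥ := by
  intro h0
  have h1 : apexAt hn s h t' w ⊓ c w x = ⊥ := by rw [hxw, inf_comm, h0]
  have h2 := congrArg (c w) h1
  rw [H.laws.c_inf_c, H.laws.c_bot, H.c_apexAt hn t' hw, ← H.c_apexAt hn t hu, hxw,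
    inf_eq_right.2 (hxu.trans (H.laws.le_c _ _))] at h2
  exact hx h2

/-- The edge between the apexes of two cones of different tints is red. -/
theorem exists_red_of_apexAt (hn : 3 ≤ n) {i k : Fin n} (hik : i ≠ k) {t t' : ℕ} (htt : t ≠ t')
    {u v : Fin (n + 3)} (hv : n ≤ v) {o : Option Colour}
    (hne : apexAt hn s h t u ⊓ edgeAt s h i k o u v ⊓ apexAt hn s h t' v ≠ ⊥) :
    ∃ a b, o = some (.red a b) ∧ Sync t t' a b := by
  have h1 : ∀ j : Fin (n - 1), ∃ (p : RainbowAtom n) (x y z : Fin n),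
      p.edge x y = some (coneColour t j) ∧ p.edge y z = o ∧
      p.edge x z = some (coneColour t' j) := fun j => by
    refine H.exists_triangle_base hn hik (baseCoord_ne hn j) (u := u) hv fun h0 => hne ?_
    refine le_bot_iff.1 (h0 ▸ ?_)
    exact inf_le_inf (inf_le_inf_right _ (H.apexAt_le hn t u j)) (H.apexAt_le hn t' v j)
  have hcone : ∀ {p : RainbowAtom n} {x y} {t : ℕ} {j : ℕ}, p.edge x y = some (coneColour t j) →
      p.toPG.e x y = some (.cone t j) := by
    intro p x y t j hp
    rw [RainbowAtom.toPG_e, hp]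
    exact congrArg some (Colour.toCol_coneColour t j)
  cases o with
  | none =>
    obtain ⟨p, x, y, z, h2, h3, h4⟩ := h1 ⟨0, by omega⟩
    rw [p.edge_eq_none_iff] at h3
    have h5 := hcone h2
    rw [p.toPG.e_congr_right h3, hcone h4] at h5
    simp only [Option.some.injEq, Col.cone, Col.tinted.injEq] at h5
    exact absurd h5.symm htt
  | some b =>
    have hb : ∀ {p : RainbowAtom n} {y z}, p.edge y z = some b → p.toPG.e y z = some b.toCol :=
      fun hp => by rw [RainbowAtom.toPG_e, hp]; rfl
    have hav : b.toCol.Avail n := by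
      obtain ⟨p, x, y, z, h2, h3, h4⟩ := h1 ⟨0, by omega⟩
      exact p.toPG.e_avail _ _ _ (hb h3)
    obtain ⟨a, a', h5, h6⟩ := exists_red_of_tri hn hav (t := t) (t' := t') fun j => by
      obtain ⟨p, x, y, z, h2, h3, h4⟩ := h1 j
      exact p.toPG.tri _ _ _ _ _ _ (hcone h2) (hb h3) (hcone h4)
    exact ⟨a, a', by rw [Colour.eq_ofCol h5]; rfl, h6⟩

/-- The descent: the apexes of two cones with increasing tints are not joined by a red edge, since
adding a third cone would give another such edge with a smaller second index. -/
theorem descent (hn : 3 ≤ n) {i k : Fin n} (hik : i ≠ k) : ∀ (b a t t' : ℕ) (u v : Fin (n + 3)),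
    n ≤ u → n ≤ v → u ≠ v → t < t' →
    apexAt hn s h t u ⊓ edgeAt s h i k (some (.red a b)) u v ⊓ apexAt hn s h t' v = ⊥ := by
  have L := H.laws
  intro b
  induction b using Nat.strong_induction_on with
  | _ b ih =>
  intro a t t' u v hu hv huv htt
  by_contra hx
  obtain ⟨w, hw, hwu, hwv⟩ : ∃ w : Fin (n + 3), n ≤ w ∧ w ≠ u ∧ w ≠ v := by
    by_contra hcon
    push Not at hcon
    have h1 := hcon ⟨n, by omega⟩ le_rfl
    have h2 := hcon ⟨n + 1, by omega⟩ (by simp)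
    have h3 := hcon ⟨n + 2, by omega⟩ (by simp)
    simp only [Fin.ext_iff, ne_eq] at h1 h2 h3
    omega
  have hfree : ∀ t u, n ≤ u.1 → w ≠ u → c w (apexAt hn s h t u) = apexAt hn s h t u := fun t u _ hwu =>
    L.c_s_free (old_ne hw).symm hwu (H.neat w hw _)
  have hfree' : ∀ o, c w (edgeAt s h i k o u v) = edgeAt s h i k o u v := fun o =>
    L.c_s_free (old_ne hw).symm hwu (L.c_s_free (old_ne hw).symm hwv (H.neat w hw _))
  have h1 := H.inf_apexAt_ne_bot hn t (t' + 1) hu hw hx (inf_le_left.trans inf_le_left)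
    (L.c_inf (L.c_inf (hfree t u hu hwu) (hfree' _)) (hfree t' v hv hwv))
  obtain ⟨o₁, h2⟩ := H.exists_edgeAt hik hu hw (Ne.symm hwu) h1
  obtain ⟨o₂, h3⟩ := H.exists_edgeAt hik hv hw (Ne.symm hwv) h2
  set y := apexAt hn s h t u ⊓ edgeAt s h i k (some (.red a b)) u v ⊓ apexAt hn s h t' v ⊓
    apexAt hn s h (t' + 1) w ⊓ edgeAt s h i k o₁ u w ⊓ edgeAt s h i k o₂ v w with hy
  have e1 : y ≤ apexAt hn s h t u :=
    inf_le_left.trans (inf_le_left.trans (inf_le_left.trans (inf_le_left.trans inf_le_left)))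
  have e2 : y ≤ edgeAt s h i k (some (.red a b)) u v :=
    inf_le_left.trans (inf_le_left.trans (inf_le_left.trans (inf_le_left.trans inf_le_right)))
  have e3 : y ≤ apexAt hn s h t' v :=
    inf_le_left.trans (inf_le_left.trans (inf_le_left.trans inf_le_right))
  have e4 : y ≤ apexAt hn s h (t' + 1) w := inf_le_left.trans (inf_le_left.trans inf_le_right)
  have e5 : y ≤ edgeAt s h i k o₁ u w := inf_le_left.trans inf_le_right
  have e6 : y ≤ edgeAt s h i k o₂ v w := inf_le_right
  have hle : ∀ {a b d : D}, y ≤ a → y ≤ b → y ≤ d → a ⊓ b ⊓ d ≠ ⊥ := fun ha hb hd h0 =>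
    h3 (le_bot_iff.1 (h0 ▸ le_inf (le_inf ha hb) hd))
  obtain ⟨a₁, b₁, rfl, hs1⟩ := H.exists_red_of_apexAt hn hik (by omega) hw (hle e1 e5 e4)
  obtain ⟨a₂, b₂, rfl, hs2⟩ := H.exists_red_of_apexAt hn hik (by omega) hw (hle e3 e6 e4)
  obtain ⟨p, x', y', z', q1, q2, q3⟩ := H.exists_triangle hn hik hv hw (hle e2 e6 e5)
  have hred : ∀ {x y a b}, p.edge x y = some (.red a b) → p.toPG.e x y = some (.red a b) :=
    fun hp => by rw [RainbowAtom.toPG_e, hp]; rfl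
  obtain ⟨-, rfl, rfl⟩ := (p.toPG.tri _ _ _ _ _ _ (hred q1) (hred q2) (hred q3)).red
  exact hle e3 e6 e4 (ih b₂ (hs2.2.2 (Nat.lt_succ_self _)) b t' (t' + 1) v w hv hw (Ne.symm hwv)
    (Nat.lt_succ_self _))

/-- The apexes of two cones with increasing tints must be joined by a red edge, against the descent. -/
theorem false (hn : 3 ≤ n) : False := by
  let i : Fin n := ⟨0, by omega⟩
  let k : Fin n := ⟨1, by omega⟩
  have hik : i ≠ k := by simp [i, k]
  let u : Fin (n + 3) := ⟨n, by omega⟩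
  let v : Fin (n + 3) := ⟨n + 1, by omega⟩
  have hu : n ≤ u.1 := le_rfl
  have hv : n ≤ v.1 := Nat.le_succ n
  have huv : u ≠ v := by simp [u, v]
  have h1 := H.inf_apexAt_ne_bot hn 0 1 hu hv (H.apexAt_ne_bot hn 0 hu) le_rfl
    (H.laws.c_s_free (old_ne hv).symm huv.symm (H.neat v hv _))
  obtain ⟨o, h2⟩ := H.exists_edgeAt hik hu hv huv h1
  rw [inf_right_comm] at h2
  obtain ⟨a, b, rfl, -⟩ := H.exists_red_of_apexAt hn hik (by omega) hv h2
  exact h2 (H.descent hn hik b a 0 1 u v hu hv huv (by omega))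

end RainbowNeatEmbedding

/-! ### Reducts between the four kinds of algebras -/

theorem Kind.HasSubst.finitary {k : Kind} {ι : Type} {τ : ι → ι} (h : k.HasSubst τ) : Finitary τ := by
  cases k with
  | Sc => obtain ⟨i, j, rfl⟩ := h; exact finitary_repl i j
  | CA => exact h.elim
  | PA => exact h
  | PEA => exact h

namespace QuantifierLaws

variable {ι : Type} {D : Type u} [BooleanAlgebra D] {c : ι → D → D} (hD : QuantifierLaws c)
include hD

theorem c_sup (i : ι) (x y : D) : c i (x ⊔ y) = c i x ⊔ c i y := by
  refine le_antisymm ?_ (sup_le (hD.c_mono i le_sup_left) (hD.c_mono i le_sup_right))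
  -- the join of two closed elements is closed, being the complement of a meet of closed elements
  have h : c i (c i x ⊔ c i y) = c i x ⊔ c i y := by
    have := hD.c_compl (hD.c_inf (hD.c_compl (hD.c_c i x)) (hD.c_compl (hD.c_c i y)))
    rwa [compl_inf, compl_compl, compl_compl] at this
  rw [← h]
  exact hD.c_mono i (sup_le_sup (hD.le_c i x) (hD.le_c i y))

end QuantifierLaws

namespace CylindricLaws

variable {ι : Type} {D : Type u} [BooleanAlgebra D] {c : ι → D → D} {d : ι → ι → D}
  (hD : CylindricLaws c d)
include hD

theorem d_comm (i j : ι) : d i j = d j i := by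
  have key : ∀ i j : ι, i ≠ j → d i j ≤ d j i := by
    intro i j hij
    have h1 := hD.d_eq j j i hij hij
    rw [hD.d_self, inf_comm] at h1
    have h2 := hD.c_d i j (d j i) hij
    rw [← h1, top_inf_eq] at h2
    have h3 := le_bot_iff.1 ((hD.le_c i _).trans_eq h2)
    rw [← compl_compl (d j i)]
    exact le_compl_iff_disjoint_right.2 (disjoint_iff.2 h3)
  by_cases hij : i = j
  · rw [hij]
  · exact le_antisymm (key i j hij) (key j i (Ne.symm hij))

theorem c_d_self {i j : ι} (hij : i ≠ j) : c i (d i j) = ⊤ := by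
  have h1 := hD.d_eq j j i hij hij
  rwa [hD.d_self, hD.d_comm j i, inf_idem, eq_comm] at h1

theorem c_d_of_ne {i j k : ι} (hi : k ≠ i) (hj : k ≠ j) : c k (d i j) = d i j := by
  rw [hD.d_eq i j k hi hj, hD.c_c]

theorem d_inf_c {i j : ι} (hij : i ≠ j) (x : D) : d i j ⊓ c i (d i j ⊓ x) = d i j ⊓ x := by
  refine le_antisymm (le_inf inf_le_left ?_) (le_inf inf_le_left (hD.le_c i _))
  have h : d i j ⊓ xᶜ ⊓ c i (d i j ⊓ x) = ⊥ := by
    refine le_bot_iff.1 ?_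
    rw [← hD.c_d i j x hij, inf_comm]
    exact inf_le_inf_left _ (hD.le_c i _)
  have h2 : d i j ⊓ c i (d i j ⊓ x) ≤ xᶜᶜ := by
    rw [le_compl_iff_disjoint_right, disjoint_iff, ← h]
    ac_rfl
  rwa [compl_compl] at h2

theorem d_inf_d {i j l : ι} (hi : l ≠ i) (hj : l ≠ j) : d l i ⊓ d j l = d l i ⊓ d j i := by
  by_cases hij : j = i
  · subst hij
    rw [hD.d_self, inf_top_eq, hD.d_comm j l, inf_idem]
  refine le_antisymm (le_inf inf_le_left ?_) (le_inf inf_le_left ?_)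
  · rw [hD.d_eq j i l hj hi, inf_comm]
    exact hD.le_c l _
  · rw [hD.d_eq j l i (Ne.symm hij) (Ne.symm hi), hD.d_comm l i, inf_comm]
    exact hD.le_c i _

open Classical in
/-- In a cylindric algebra the replacements are `s_[i/j] x = c_i (d_ij ⊓ x)` for `i ≠ j`. -/
theorem substitutionLaws : SubstitutionLaws c fun i j x => if i = j then x else c i (d i j ⊓ x) where
  toQuantifierLaws := hD.toQuantifierLaws
  s_self i x := by simp
  s_sup i j x y := by
    split_ifs with h
    · rfl
    · rw [inf_sup_left, hD.c_sup]
  s_compl i j x := by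
    split_ifs with h
    · rfl
    · symm
      refine IsCompl.compl_eq ⟨disjoint_iff.2 (hD.c_d i j x h), codisjoint_iff.2 ?_⟩
      rw [← hD.c_sup, ← inf_sup_left, sup_compl_eq_top, inf_top_eq, hD.c_d_self h]
  s_c i j x := by
    split_ifs with h
    · rfl
    · rw [hD.c_inf_c, hD.c_d_self h, top_inf_eq]
  c_s i j x h := by rw [if_neg h, hD.c_c]
  s_c_comm i j k x hi hj := by
    split_ifs with h
    · rfl
    · rw [hD.c_comm k i, inf_comm (d i j) x, ← hD.c_d_of_ne hi hj, hD.c_inf_c, hD.c_d_of_ne hi hj,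
        inf_comm]
  c_s_swap i j x := by
    by_cases h : i = j
    · rw [h]
    · rw [if_neg h, if_neg (Ne.symm h), hD.c_comm, hD.d_comm]
  s_s_comm i j k l x hij hik hil hjk hjl hkl := by
    rw [if_neg hij.symm, if_neg hkl.symm, if_neg hkl.symm, if_neg hij.symm]
    have h1 : d j i ⊓ c l (d l k ⊓ x) = c l (d l k ⊓ x ⊓ d j i) := by
      rw [← hD.c_d_of_ne (d := d) (Ne.symm hjl) (Ne.symm hil), hD.c_inf_c, inf_comm]
    have h2 : d l k ⊓ c j (d j i ⊓ x) = c j (d j i ⊓ x ⊓ d l k) := by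
      rw [← hD.c_d_of_ne (d := d) hjl hjk, hD.c_inf_c, inf_comm]
    rw [h1, h2, hD.c_comm]
    congr 2
    ac_rfl
  s_s i j l x := by
    by_cases hli : l = i
    · subst hli
      simp
    have hf : ∀ y, (if l = i then y else c l (d l i ⊓ y)) = c l (d l i ⊓ y) := fun y => if_neg hli
    rw [hf, hf]
    by_cases hjl : j = l
    · subst hjl
      rw [if_pos rfl, if_neg hli, hD.c_inf_c, hD.c_d_self hli, top_inf_eq]
    by_cases hji : j = i
    · subst hji
      rw [if_neg hjl, if_pos rfl, hD.d_comm l j, hD.d_inf_c hjl]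
    rw [if_neg hjl, if_neg hji]
    have h : ∀ z, d l i ⊓ c j z = c j (z ⊓ d l i) := fun z => by
      rw [← hD.c_d_of_ne (d := d) hjl hji, hD.c_inf_c, inf_comm]
    rw [h, h]
    congr 2
    rw [inf_right_comm, inf_comm (d j l), hD.d_inf_d hli (Ne.symm hjl), inf_comm (d l i),
      inf_right_comm]

end CylindricLaws

theorem repl_eq_iff {ι : Type} {i j k l : ι} (hi : k ≠ i) (hj : k ≠ j) : repl i j l = k ↔ l = k := by
  by_cases h : l = i
  · subst h
    rw [repl_self]
    exact ⟨fun e => (hj e.symm).elim, fun e => (hi e.symm).elim⟩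
  · rw [repl_of_ne h]

theorem repl_ne {ι : Type} {i j : ι} (hij : i ≠ j) (l : ι) : repl i j l ≠ i := by
  by_cases h : l = i
  · subst h
    rw [repl_self]
    exact hij.symm
  · rwa [repl_of_ne h]

theorem finitary_id {ι : Type} : Finitary (id : ι → ι) := by simp [Finitary]

theorem Finitary.comp {ι : Type} {σ τ : ι → ι} (hσ : Finitary σ) (hτ : Finitary τ) :
    Finitary (σ ∘ τ) := by
  refine (hσ.union hτ).subset fun i hi => ?_
  by_contra h
  simp only [Set.mem_union, Set.mem_ofPred_eq, not_or, not_not] at h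
  exact hi (by simp [h.1, h.2])

namespace PolyadicLaws

variable {ι : Type} {D : Type u} [BooleanAlgebra D] {c : ι → D → D}
  {s : ∀ τ : ι → ι, Finitary τ → D → D} (hD : PolyadicLaws c s)
include hD

omit [BooleanAlgebra D] hD in
theorem s_congr {σ τ : ι → ι} (hσ : Finitary σ) (hτ : Finitary τ) (h : σ = τ) (x : D) :
    s σ hσ x = s τ hτ x := by subst h; rfl

theorem s_comp_congr {σ τ σ' τ' : ι → ι} (hσ : Finitary σ) (hτ : Finitary τ) (hσ' : Finitary σ')
    (hτ' : Finitary τ') (h : σ ∘ τ = σ' ∘ τ') (x : D) :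
    s σ hσ (s τ hτ x) = s σ' hσ' (s τ' hτ' x) := by
  rw [← hD.s_comp σ τ hσ hτ (hσ.comp hτ), ← hD.s_comp σ' τ' hσ' hτ' (hσ'.comp hτ')]
  exact s_congr _ _ h x

open Classical in
theorem c_s_swap {i j : ι} (hij : i ≠ j) (x : D) :
    c i (s (repl j i) (finitary_repl j i) x) = c j (s (repl i j) (finitary_repl i j) x) := by
  have hσ : Finitary (Equiv.swap i j : ι → ι) := by
    refine (Set.toFinite {i, j}).subset fun k hk => ?_
    by_contra h
    simp only [Set.mem_insert_iff, Set.mem_singleton_iff, not_or] at h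
    exact hk (Equiv.swap_apply_of_ne_of_ne h.1 h.2)
  have e : repl j i = Equiv.swap i j ∘ repl i j := by
    funext k
    by_cases hi : k = i
    · subst hi
      simp [repl, hij]
    by_cases hj : k = j
    · subst hj
      simp [repl, hi]
    · simp [repl, hi, hj, Equiv.swap_apply_of_ne_of_ne]
  have h1 : s (repl j i) (finitary_repl j i) x =
      s _ hσ (s (repl i j) (finitary_repl i j) x) := by
    rw [← hD.s_comp _ _ _ _ (hσ.comp (finitary_repl i j))]
    exact s_congr _ _ e x
  have h2 : ∀ y, c i (s _ hσ y) = s _ hσ (c j y) := fun y =>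
    hD.c_s_of_unique _ hσ i j y fun l => by rw [Equiv.swap_apply_eq_iff, Equiv.swap_apply_left]
  have h3 : c i (s (repl i j) (finitary_repl i j) x) = s (repl i j) (finitary_repl i j) x :=
    hD.c_s_of_notMem _ _ _ _ fun l => repl_ne hij l
  -- the element `c j (s_[i/j] x)` is free in both `i` and `j`, hence fixed by the transposition
  rw [h1, h2, ← h3, hD.c_comm j i, hD.s_c_congr _ (repl j i) hσ (finitary_repl j i) i,
    hD.c_comm i j, hD.s_c_congr _ id _ finitary_id j, hD.s_id, hD.c_comm]
  · intro k hk
    rw [repl_of_ne hk, id]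
  · intro k hk
    by_cases hj : k = j
    · subst hj
      simp [repl]
    · simp [repl, hj, Equiv.swap_apply_of_ne_of_ne hk hj]

theorem substitutionLaws : SubstitutionLaws c fun i j => s (repl i j) (finitary_repl i j) where
  toQuantifierLaws := hD.toQuantifierLaws
  s_self i x := by
    have : repl i i = id := by funext k; by_cases h : k = i <;> simp [repl, h]
    rw [s_congr (s := s) _ finitary_id this, hD.s_id]
  s_sup i j := hD.s_sup _ _
  s_compl i j := hD.s_compl _ _
  s_c i j x := by
    rw [hD.s_c_congr _ id _ finitary_id, hD.s_id]
    intro k hk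
    rw [repl_of_ne hk, id]
  c_s i j x h := hD.c_s_of_notMem _ _ _ _ fun l => repl_ne h l
  s_c_comm i j k x hi hj := (hD.c_s_of_unique _ _ _ _ _ fun l => repl_eq_iff hi hj).symm
  c_s_swap i j x := by
    by_cases h : i = j
    · rw [h]
    · exact hD.c_s_swap h x
  s_s_comm i j k l x hij hik hil hjk hjl hkl := by
    refine hD.s_comp_congr _ _ _ _ ?_ x
    funext m
    by_cases hm : m = j
    · subst hm
      simp [repl, hjl, hil]
    by_cases hl : m = l
    · subst hl
      simp [repl, Ne.symm hjk, hm]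
    · simp [repl, hm, hl]
  s_s i j l x := by
    refine hD.s_comp_congr _ _ _ _ ?_ x
    funext m
    by_cases hm : m = j
    · subst hm
      by_cases hl : i = l <;> simp [repl, hl]
    · rw [Function.comp_apply, Function.comp_apply, repl_of_ne hm, repl_of_ne hm]

end PolyadicLaws

theorem PolyadicEqualityLaws.s_repl {ι : Type} {D : Type u} [BooleanAlgebra D] {c : ι → D → D}
    {d : ι → ι → D} {s : ∀ τ : ι → ι, Finitary τ → D → D} (hD : PolyadicEqualityLaws c d s)
    {i j : ι} (hij : i ≠ j) (x : D) :
    s (repl i j) (finitary_repl i j) x = c i (d i j ⊓ x) := by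
  have hS := hD.substitutionLaws
  refine le_antisymm ?_ ?_
  · -- `s_[i/j]` does not change `c_i (d_ij ⊓ x)`, and it sends `d_ij` to `⊤`
    have h1 := hS.s_mono i j (hD.le_c i (d i j ⊓ x))
    rw [hS.s_c, hS.s_inf, hD.s_d, repl_self, repl_of_ne (Ne.symm hij), hD.d_self, top_inf_eq] at h1
    exact h1
  · have h1 := hD.c_mono i (hD.inf_d_le i j x)
    rwa [hS.c_s i j x hij, inf_comm] at h1

theorem PolyadicEqualityLaws.d_comm {ι : Type} {D : Type u} [BooleanAlgebra D] {c : ι → D → D}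
    {d : ι → ι → D} {s : ∀ τ : ι → ι, Finitary τ → D → D} (hD : PolyadicEqualityLaws c d s)
    (i j : ι) : d i j = d j i := by
  have key : ∀ i j, d i j ≤ d j i := by
    intro i j
    by_cases hij : i = j
    · rw [hij]
    have h := hD.inf_d_le i j (d j i)ᶜ
    rw [hD.s_compl, hD.s_d, repl_self, repl_of_ne (Ne.symm hij), hD.d_self, compl_top,
      le_bot_iff, inf_comm] at h
    rw [← compl_compl (d j i)]
    exact le_compl_iff_disjoint_right.2 (disjoint_iff.2 h)
  exact le_antisymm (key i j) (key j i)

theorem PolyadicEqualityLaws.cylindricLaws {ι : Type} {D : Type u} [BooleanAlgebra D] {c : ι → D → D}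
    {d : ι → ι → D} {s : ∀ τ : ι → ι, Finitary τ → D → D} (hD : PolyadicEqualityLaws c d s) :
    CylindricLaws c d where
  toQuantifierLaws := hD.toQuantifierLaws
  d_self := hD.d_self
  d_eq i j k hi hj := by
    rw [hD.d_comm i k, ← hD.s_repl hi, hD.s_d, repl_self, repl_of_ne (Ne.symm hj)]
  c_d i j x hij := by
    rw [← hD.s_repl hij, ← hD.s_repl hij, hD.s_compl, inf_compl_eq_bot]

/-- Every algebra of kind `k` has the replacement operators `s_[i/j]` of a substitution algebra; in
cylindric algebras they are definable. -/
theorem exists_substitutionLaws {k : Kind} {ι : Type} {D : Alg.{u} k ι} (hD : D ∈ variety k ι) :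
    ∃ s : ι → ι → D → D, SubstitutionLaws D.c s ∧
      (∀ i j h x, s i j x = D.s (repl i j) h x) ∧
      ∀ h i j x, i ≠ j → k = .CA → s i j x = D.c i (D.d h i j ⊓ x) := by
  classical
  cases k with
  | Sc => exact ⟨_, hD, fun _ _ _ _ => rfl, fun _ _ _ _ _ h => by cases h⟩
  | CA => exact ⟨_, hD.substitutionLaws, fun _ _ h => h.elim, fun _ _ _ _ h _ => if_neg h⟩
  | PA => exact ⟨_, hD.substitutionLaws, fun _ _ _ _ => rfl, fun _ _ _ _ _ h => by cases h⟩
  | PEA => exact ⟨_, hD.substitutionLaws, fun _ _ _ _ => rfl, fun _ _ _ _ _ h => by cases h⟩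

/-! ### Lifted reducts -/

/-- The reduct of `A` to the signature of kind `k`, on a copy of `A` in the universe `u`. -/
def Alg.red (k : Kind) {ι : Type} (A : Alg.{0} .PEA ι) : Alg.{u} k ι where
  carrier := ULift.{u} A
  ba := Equiv.ulift.booleanAlgebra
  c := fun i x => ⟨A.c i x.down⟩
  d := fun _ i j => ⟨A.d trivial i j⟩
  s := fun τ h x => ⟨A.s τ h.finitary x.down⟩

/-- `A` and its lifted reduct have the same elements. -/
def Alg.toRed (k : Kind) {ι : Type} (A : Alg.{0} .PEA ι) : A ≃o A.red k where
  toFun := ULift.up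
  invFun := ULift.down
  left_inv _ := rfl
  right_inv _ := rfl
  map_rel_iff' := Iff.rfl

section ModelTheory

open FirstOrder

/-- The interpretation of the signature of kind `k` in that of polyadic equality algebras. -/
def algLangHom (k : Kind) (ι : Type) : algLang k ι →ᴸ algLang .PEA ι where
  onFunction := fun _ o => match o with
    | .bot => .bot
    | .top => .top
    | .compl => .compl
    | .sup => .sup
    | .inf => .inf
    | .c i => .c i
    | .d _ i j => .d trivial i j
    | .s τ h => .s τ h.finitary
  onRelation := fun _ r => r

theorem Alg.red_realize_iff (k : Kind) {ι : Type} (A : Alg.{0} .PEA ι) (σ : (algLang k ι).Sentence) :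
    (A.red k : Alg.{u} k ι) ⊨ σ ↔ A ⊨ (algLangHom k ι).onSentence σ := by
  let : (algLang k ι).Structure A := (algLangHom k ι).reduct A
  have : (algLangHom k ι).IsExpansionOn A := ⟨fun _ _ => rfl, fun _ _ => rfl⟩
  rw [Language.LHom.realize_onSentence A]
  let e : Language.Equiv (algLang k ι) A (A.red k : Alg.{u} k ι) :=
    { A.toRed k with
      map_fun' := by
        intro m o x
        cases o <;> rfl
      map_rel' := fun r => r.elim }
  exact (Language.StrongHomClass.realize_sentence e σ).symm

/-- Elementarily equivalent algebras have elementarily equivalent reducts, so no elementary class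
separates these. -/
theorem IsElementary.red_mem {k : Kind} {ι : Type} {K : Set (Alg.{u} k ι)} (hK : IsElementary K)
    {A B : Alg.{0} .PEA ι} (h : (algLang .PEA ι).ElementarilyEquivalent A B)
    (hB : B.red k ∈ K) : A.red k ∈ K := by
  obtain ⟨T, hT⟩ := hK
  rw [hT] at hB ⊢
  refine ⟨fun σ hσ => ?_⟩
  rw [Alg.red_realize_iff, h.realize_sentence, ← Alg.red_realize_iff]
  exact hB.realize_of_mem σ hσ

end ModelTheory

/-! ### The rainbow algebra is not a complete subalgebra of a neat reduct -/

theorem IsHom.le_iff {k : Kind} {ι : Type} {A B : Alg.{u} k ι} {f : A → B} (hf : IsHom f)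
    (hi : Function.Injective f) {x y : A} : f x ≤ f y ↔ x ≤ y := by
  rw [← inf_eq_left, ← hf.map_inf, hi.eq_iff, inf_eq_left]

theorem castAddEmb_notMem_range {n m : ℕ} {k : Fin (n + m)} (h : n ≤ k) :
    k ∉ Set.range (Fin.castAddEmb m : Fin n ↪ Fin (n + m)) := by
  rintro ⟨i, rfl⟩
  have := i.2
  rw [Fin.castAddEmb_apply, Fin.val_castAdd] at h
  omega

theorem le_of_castAddEmb_notMem_range {n m : ℕ} {k : Fin (n + m)}
    (h : k ∉ Set.range (Fin.castAddEmb m : Fin n ↪ Fin (n + m))) : n ≤ k := by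
  by_contra hk
  exact h ⟨⟨k, by omega⟩, rfl⟩

/-- No algebra of kind `k` is a complete subalgebra of a neat reduct if the rainbow algebra is isomorphic
to it, as far as the operations of kind `k` are concerned; `φ` is that isomorphism. -/
theorem notMem_completeSub_Nr {n : ℕ} (hn : 3 ≤ n) {k : Kind} (A : Alg.{u} k (Fin n))
    (φ : Set (RainbowAtom n) ≃o A) (hc : ∀ i X, φ (rainbowC i X) = A.c i (φ X))
    (hd : ∀ h i j, φ (rainbowD i j) = A.d h i j)
    (hs : ∀ τ h h' X, φ (rainbowS τ h' X) = A.s τ h (φ X)) :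
    A ∉ completeSub (Nr (Fin.castAddEmb 3) (variety.{u} k (Fin (n + 3)))) := by
  rintro ⟨B, ⟨D, hD, g, hgi, hg, hgr⟩, f, hfi, hf, hsup⟩
  obtain ⟨s, hs', hs_repl, hs_diag⟩ := exists_substitutionLaws hD
  obtain ⟨G, hG⟩ : ∃ G : Set (RainbowAtom n) → D, ∀ X, G X = g (f (φ X)) := ⟨_, fun _ => rfl⟩
  have hPEA : PolyadicEqualityLaws (A := Set (RainbowAtom n)) rainbowC rainbowD rainbowS :=
    rainbowAlg_mem_variety hn
  have hmap_inf : ∀ X Y, G (X ∩ Y) = G X ⊓ G Y := fun X Y => by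
    have h1 : φ (X ∩ Y) = φ X ⊓ φ Y := map_inf φ X Y
    rw [hG, hG, hG, h1, hf.map_inf, hg.map_inf]
    rfl
  have hmap_c : ∀ i X, G (rainbowC i X) = D.c (Fin.castAdd 3 i) (G X) :=
    fun i X => by rw [hG, hG, hc, hf.map_c, hg.map_c]; rfl
  have hneat : ∀ j : Fin (n + 3), n ≤ j → ∀ X, D.c j (G X) = G X := by
    intro j hj X
    have h1 : g (f (φ X)) ∈ Set.range g := ⟨_, rfl⟩
    rw [hgr] at h1
    rw [hG]
    exact h1 j (castAddEmb_notMem_range hj)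
  have hmap_s : ∀ i j X, G (rainbowS (repl i j) (finitary_repl i j) X) =
      s (Fin.castAdd 3 i) (Fin.castAdd 3 j) (G X) := by
    intro i j X
    by_cases hk : k = .CA
    · subst hk
      by_cases hij : i = j
      · subst hij
        have h1 : rainbowS (repl i i) (finitary_repl i i) X = X :=
          hPEA.substitutionLaws.s_self i X
        rw [hs'.s_self, h1]
      · have h1 : rainbowS (repl i j) (finitary_repl i j) X = rainbowC i (rainbowD i j ∩ X) :=
          hPEA.s_repl hij X
        have hk : Kind.HasDiag .CA := trivial
        have h2 : G (rainbowD i j) = D.d hk (Fin.castAdd 3 i) (Fin.castAdd 3 j) := by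
          rw [hG, hd hk, hf.map_d, hg.map_d]
          rfl
        rw [h1, hs_diag hk _ _ _ (fun h => hij (Fin.castAdd_injective n 3 h)) rfl,
          hmap_c, hmap_inf, h2]
    · have hk' : k.HasSubst (repl i j) := by
        cases k with
        | Sc => exact ⟨i, j, rfl⟩
        | CA => exact (hk rfl).elim
        | PA => exact finitary_repl i j
        | PEA => exact finitary_repl i j
      have key : ∀ (τ : Fin (n + 3) → Fin (n + 3)) h h' y,
          τ = extendMap (Fin.castAddEmb 3) (repl i j) →
          D.s τ h' y = D.s (extendMap (Fin.castAddEmb 3) (repl i j)) h y := by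
        rintro τ h h' y rfl
        rfl
      have e := extendMap_repl (Fin.castAddEmb 3) i j
      have h1 := hk'.extendMap (Fin.castAddEmb 3)
      rw [hG, hG, hs (repl i j) hk', hf.map_s, hg.map_s]
      refine Eq.symm ((hs_repl _ _ ?_ _).trans (key _ h1 _ _ e.symm))
      exact e ▸ h1
  refine RainbowNeatEmbedding.false (D := D) (c := D.c) (s := s) (h := G)
    ⟨hs', fun X Y h => ?_, ?_, hmap_inf, hmap_c, hmap_s, hneat, ?_⟩ hn
  · rw [hG, hG] at h
    exact φ.injective (hfi (hgi h))
  · have h1 : φ ∅ = ⊥ := map_bot φ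
    rw [hG, h1, hf.map_bot, hg.map_bot]
    rfl
  · intro F hF d hFd hd'
    have h1 : d ∈ Set.range g := by
      rw [hgr]
      exact fun j hj => hd' j (le_of_castAddEmb_notMem_range hj)
    obtain ⟨b, rfl⟩ := h1
    have h2 : IsLUB (φ '' F) ⊤ := by
      refine ⟨fun _ _ => le_top, fun x hx => ?_⟩
      have h3 : (Set.univ : Set (RainbowAtom n)) ≤ φ.symm x := by
        intro p _
        obtain ⟨X, hX, hp⟩ := hF p
        have h4 : X ≤ φ.symm x := by
          rw [← φ.le_iff_le, OrderIso.apply_symm_apply]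
          exact hx ⟨X, hX, rfl⟩
        exact h4 hp
      rw [← φ.le_iff_le, OrderIso.apply_symm_apply] at h3
      exact (map_top φ).symm.trans_le h3
    have h3 : b = ⊤ := by
      refine top_le_iff.1 ((hsup _ h2).2 ?_)
      rintro _ ⟨_, ⟨X, hX, rfl⟩, rfl⟩
      have h4 := hFd X hX
      rw [hG] at h4
      exact (hg.le_iff hgi).1 h4
    rw [h3]
    exact hg.map_top

theorem red_notMem_completeSub_Nr {n : ℕ} (hn : 3 ≤ n) (k : Kind) :
    (rainbowAlg n).red k ∉ completeSub (Nr (Fin.castAddEmb 3) (variety.{u} k (Fin (n + 3)))) :=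
  notMem_completeSub_Nr hn _ ((rainbowAlg n).toRed k) (fun _ _ => rfl) (fun _ _ _ => rfl)
    (fun _ _ _ _ => rfl)

theorem rdSc_notMem_completeSub_Nr {n : ℕ} (hn : 3 ≤ n) :
    (rainbowAlg n).rdSc ∉ completeSub (Nr (Fin.castAddEmb 3) (variety.{0} .Sc (Fin (n + 3)))) :=
  notMem_completeSub_Nr hn _ (OrderIso.refl _ : Set (RainbowAtom n) ≃o (rainbowAlg n).rdSc)
    (fun _ _ => rfl) (fun h _ _ => h.elim) (fun _ _ _ _ => rfl)

/-! ### Set algebras and complete representations -/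

section Transfer

variable {ι : Type} {A B : Type u} [BooleanAlgebra A] [BooleanAlgebra B] {f : BoundedLatticeHom A B}
  (hi : Function.Injective f) {c : ι → A → A} {c' : ι → B → B}
  (hc : ∀ i x, f (c i x) = c' i (f x))
include hi hc

theorem QuantifierLaws.of_injective (h : QuantifierLaws c') : QuantifierLaws c where
  c_bot i := hi (by rw [hc, map_bot, h.c_bot])
  le_c i x := by
    rw [← inf_eq_left]
    exact hi (by rw [map_inf, hc, inf_eq_left]; exact h.le_c i _)
  c_inf_c i x y := hi (by simp only [hc, map_inf, h.c_inf_c])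
  c_comm i j x := hi (by simp only [hc]; exact h.c_comm i j _)

theorem SubstitutionLaws.of_injective {s : ι → ι → A → A} {s' : ι → ι → B → B}
    (hs : ∀ i j x, f (s i j x) = s' i j (f x)) (h : SubstitutionLaws c' s') :
    SubstitutionLaws c s where
  toQuantifierLaws := h.toQuantifierLaws.of_injective hi hc
  s_self i x := hi (by rw [hs, h.s_self])
  s_sup i j x y := hi (by simp only [hs, map_sup, h.s_sup])
  s_compl i j x := hi (by simp only [hs, map_compl', h.s_compl])
  s_c i j x := hi (by simp only [hs, hc, h.s_c])
  c_s i j x hij := hi (by simp only [hs, hc, h.c_s i j _ hij])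
  s_c_comm i j k x h₁ h₂ := hi (by simp only [hs, hc, h.s_c_comm i j k _ h₁ h₂])
  c_s_swap i j x := hi (by simp only [hs, hc, h.c_s_swap i j])
  s_s_comm i j k l x h₁ h₂ h₃ h₄ h₅ h₆ :=
    hi (by simp only [hs, h.s_s_comm i j k l _ h₁ h₂ h₃ h₄ h₅ h₆])
  s_s i j l x := hi (by simp only [hs]; exact h.s_s i j l _)

theorem CylindricLaws.of_injective {d : ι → ι → A} {d' : ι → ι → B} (hd : ∀ i j, f (d i j) = d' i j)
    (h : CylindricLaws c' d') : CylindricLaws c d where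
  toQuantifierLaws := h.toQuantifierLaws.of_injective hi hc
  d_self i := hi (by rw [hd, h.d_self, map_top])
  d_eq i j k h₁ h₂ := hi (by simp only [hd, hc, map_inf]; exact h.d_eq i j k h₁ h₂)
  c_d i j x hij := hi (by simp only [hd, hc, map_inf, map_compl', map_bot, h.c_d i j _ hij])

theorem PolyadicLaws.of_injective {s : ∀ τ : ι → ι, Finitary τ → A → A}
    {s' : ∀ τ : ι → ι, Finitary τ → B → B} (hs : ∀ τ hτ x, f (s τ hτ x) = s' τ hτ (f x))
    (h : PolyadicLaws c' s') : PolyadicLaws c s where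
  toQuantifierLaws := h.toQuantifierLaws.of_injective hi hc
  s_sup τ hτ x y := hi (by simp only [hs, map_sup, h.s_sup])
  s_compl τ hτ x := hi (by simp only [hs, map_compl', h.s_compl])
  s_id h' x := hi (by rw [hs, h.s_id])
  s_comp σ τ hσ hτ h' x := hi (by rw [hs, hs, hs, h.s_comp])
  s_c_congr σ τ hσ hτ i x h' := hi (by rw [hs, hs, hc, h.s_c_congr σ τ hσ hτ i _ h'])
  c_s_of_notMem τ hτ i x h' := hi (by rw [hc, hs, h.c_s_of_notMem τ hτ i _ h'])
  c_s_of_unique τ hτ i j x h' := hi (by rw [hc, hs, hs, hc, h.c_s_of_unique τ hτ i j _ h'])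

theorem PolyadicEqualityLaws.of_injective {d : ι → ι → A} {d' : ι → ι → B}
    (hd : ∀ i j, f (d i j) = d' i j) {s : ∀ τ : ι → ι, Finitary τ → A → A}
    {s' : ∀ τ : ι → ι, Finitary τ → B → B} (hs : ∀ τ hτ x, f (s τ hτ x) = s' τ hτ (f x))
    (h : PolyadicEqualityLaws c' d' s') : PolyadicEqualityLaws c d s where
  toPolyadicLaws := h.toPolyadicLaws.of_injective hi hc hs
  d_self i := hi (by rw [hd, h.d_self, map_top])
  s_d τ hτ i j := hi (by rw [hs, hd, hd, h.s_d])
  inf_d_le i j x := by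
    rw [← inf_eq_left]
    exact hi (by rw [map_inf, hs, map_inf, hd, inf_eq_left]; exact h.inf_d_le i j _)

end Transfer

/-- The underlying Boolean homomorphism. -/
def IsHom.toBoundedLatticeHom {k : Kind} {ι : Type} {A B : Alg.{u} k ι} {f : A → B} (hf : IsHom f) :
    BoundedLatticeHom A B where
  toFun := f
  map_sup' := hf.map_sup
  map_inf' := hf.map_inf
  map_top' := hf.map_top
  map_bot' := hf.map_bot

theorem mem_variety_of_injective {k : Kind} {ι : Type} {A B : Alg.{u} k ι} (hB : B ∈ variety k ι)
    {f : A → B} (hi : Function.Injective f) (hf : IsHom f) : A ∈ variety k ι := by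
  cases k with
  | Sc => exact SubstitutionLaws.of_injective (f := hf.toBoundedLatticeHom) hi hf.map_c
            (fun i j => hf.map_s (repl i j) ⟨i, j, rfl⟩) hB
  | CA => exact CylindricLaws.of_injective (f := hf.toBoundedLatticeHom) hi hf.map_c
            (hf.map_d trivial) hB
  | PA => exact PolyadicLaws.of_injective (f := hf.toBoundedLatticeHom) hi hf.map_c hf.map_s hB
  | PEA => exact PolyadicEqualityLaws.of_injective (f := hf.toBoundedLatticeHom) hi hf.map_c
            (hf.map_d trivial) hf.map_s hB

/-- The union of the Cartesian spaces `ι → W i`. -/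
def spaceOf (ι : Type) {U I : Type u} (W : I → Set U) : Set (ι → U) := {s | ∃ i, ∀ j, s j ∈ W i}

section SetOperations

variable {ι : Type} {U : Type u} {V : Set (ι → U)}

/-- Cylindrification of a subset of `V`. -/
def cylinder (i : ι) (X : Set V) : Set V := {s | ∃ t ∈ X, ∀ j, j ≠ i → t.1 j = s.1 j}

/-- The diagonal hyperplanes of `V`. -/
def diagonal (i j : ι) : Set V := {s | s.1 i = s.1 j}

/-- Substitution for subsets of `V`. -/
def substitute (τ : ι → ι) (X : Set V) : Set V := {s | ∃ t ∈ X, t.1 = s.1 ∘ τ}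

theorem mem_cylinder {i : ι} {X : Set V} {s : V} :
    s ∈ cylinder i X ↔ ∃ t ∈ X, ∀ j, j ≠ i → t.1 j = s.1 j := Iff.rfl

theorem mem_substitute {τ : ι → ι} {X : Set V} {s : V} (h : s.1 ∘ τ ∈ V) :
    s ∈ substitute τ X ↔ (⟨s.1 ∘ τ, h⟩ : V) ∈ X := by
  constructor
  · rintro ⟨t, ht, hts⟩
    have : t = ⟨s.1 ∘ τ, h⟩ := Subtype.ext hts
    exact this ▸ ht
  · exact fun h => ⟨_, h, rfl⟩

end SetOperations

section Space

variable {ι : Type} {U I : Type u} {W : I → Set U}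

theorem comp_mem_spaceOf {κ : Type} {s : ι → U} (hs : s ∈ spaceOf ι W) (τ : κ → ι) :
    s ∘ τ ∈ spaceOf κ W := by
  obtain ⟨i, hi⟩ := hs
  exact ⟨i, fun j => hi (τ j)⟩

open Classical in
/-- Sequences that share a value run in the same basis, so an entry of one may be replaced by any
entry of the other. -/
theorem update_mem_spaceOf {κ : Type} (hW : Pairwise fun i j => Disjoint (W i) (W j)) {s : ι → U}
    {t : κ → U} (hs : s ∈ spaceOf ι W) (ht : t ∈ spaceOf κ W) {l : ι} {l' : κ} (h : s l = t l')
    (i : ι) (j : κ) : Function.update s i (t j) ∈ spaceOf ι W := by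
  obtain ⟨a, ha⟩ := hs
  obtain ⟨b, hb⟩ := ht
  have hab : a = b := by
    by_contra hab
    exact Set.disjoint_left.1 (hW hab) (ha l) (h ▸ hb l')
  subst hab
  refine ⟨a, fun m => ?_⟩
  by_cases hm : m = i
  · subst hm
    rw [Function.update_self]
    exact hb j
  · rw [Function.update_of_ne hm]
    exact ha m

open Classical in
theorem polyadicEqualityLaws_spaceOf [Nontrivial ι] (hW : Pairwise fun i j => Disjoint (W i) (W j)) :
    PolyadicEqualityLaws (A := Set (spaceOf ι W)) cylinder diagonal fun τ _ => substitute τ := by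
  have mem_s : ∀ (τ : ι → ι) (X : Set (spaceOf ι W)) (s : spaceOf ι W),
      s ∈ substitute τ X ↔ (⟨s.1 ∘ τ, comp_mem_spaceOf s.2 τ⟩ : spaceOf ι W) ∈ X :=
    fun τ X s => mem_substitute _
  refine
    { c_bot := fun i => ?_
      le_c := fun i X s hs => ⟨s, hs, fun _ _ => rfl⟩
      c_inf_c := fun i X Y => Set.ext fun s => ?_
      c_comm := ?_
      s_sup := fun τ hτ X Y => Set.ext fun s => ?_
      s_compl := fun τ hτ X => Set.ext fun s => ?_
      s_id := fun h X => Set.ext fun s => ?_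
      s_comp := fun σ τ hσ hτ h X => Set.ext fun s => ?_
      s_c_congr := fun σ τ hσ hτ i X h => Set.ext fun s => ?_
      c_s_of_notMem := fun τ hτ i X h => Set.ext fun s => ?_
      c_s_of_unique := fun τ hτ i j X h => Set.ext fun s => ?_
      d_self := fun i => Set.ext fun s => ?_
      s_d := fun τ hτ i j => Set.ext fun s => ?_
      inf_d_le := fun i j X s hs => ?_ }
  · exact Set.ext fun s => ⟨fun ⟨t, ht, _⟩ => ht, fun h => h.elim⟩
  · constructor
    · rintro ⟨t, ⟨htX, u, hu, hut⟩, hts⟩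
      exact ⟨⟨t, htX, hts⟩, u, hu, fun j hj => (hut j hj).trans (hts j hj)⟩
    · rintro ⟨⟨t, htX, hts⟩, u, hu, hus⟩
      exact ⟨t, ⟨htX, u, hu, fun j hj => (hus j hj).trans (hts j hj).symm⟩, hts⟩
  · have key : ∀ (i j : ι) (X : Set (spaceOf ι W)),
        cylinder i (cylinder j X) ⊆ cylinder j (cylinder i X) := by
      rintro i j X s ⟨t, ⟨u, hu, hut⟩, hts⟩
      by_cases hij : i = j
      · subst hij
        exact ⟨t, ⟨u, hu, hut⟩, hts⟩
      · have h1 : s.1 j = t.1 j := (hts j (Ne.symm hij)).symm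
        have h2 : t.1 i = u.1 i := (hut i hij).symm
        -- exchange the two coordinates one at a time
        have h3 := update_mem_spaceOf hW t.2 u.2 h2 i j
        have h4 : Function.update s.1 j (u.1 j) ∈ spaceOf ι W := by
          have h5 := update_mem_spaceOf hW s.2 h3 (l := j) (l' := j)
            (by rw [Function.update_of_ne (Ne.symm hij), h1]) j i
          rwa [Function.update_self] at h5
        refine ⟨⟨_, h4⟩, ⟨u, hu, fun l hl => ?_⟩, fun l hl => Function.update_of_ne hl _ _⟩
        by_cases hlj : l = j
        · change u.1 l = Function.update s.1 j (u.1 j) l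
          rw [hlj, Function.update_self]
        · rw [hut l hlj, hts l hl]
          exact (Function.update_of_ne hlj _ _).symm
    exact fun i j X => Set.Subset.antisymm (key i j X) (key j i X)
  · exact (mem_s ..).trans (or_congr (mem_s ..).symm (mem_s ..).symm)
  · exact (mem_s ..).trans (not_congr (mem_s ..)).symm
  · exact mem_s ..
  · refine (mem_s ..).trans (Iff.trans ?_ (mem_s ..).symm)
    exact (mem_s ..).symm
  · refine (mem_s ..).trans (Iff.trans ?_ (mem_s ..).symm)
    rw [mem_cylinder, mem_cylinder]
    refine exists_congr fun t => and_congr_right fun _ => forall₂_congr fun j hj => ?_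
    simp only [Function.comp_apply, h j hj]
  · rw [mem_cylinder]
    refine ⟨fun ⟨t, ht, hts⟩ => ?_, fun hs => ⟨s, hs, fun _ _ => rfl⟩⟩
    rw [mem_s] at ht ⊢
    have e : (⟨s.1 ∘ τ, comp_mem_spaceOf s.2 τ⟩ : spaceOf ι W) =
        ⟨t.1 ∘ τ, comp_mem_spaceOf t.2 τ⟩ := Subtype.ext (funext fun l => (hts _ (h l)).symm)
    rwa [e]
  · rw [mem_cylinder, mem_s, mem_cylinder]
    constructor
    · rintro ⟨t, ht, hts⟩
      rw [mem_s] at ht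
      exact ⟨_, ht, fun l hl => hts _ fun e => hl ((h l).1 e)⟩
    · rintro ⟨u, hu, hus⟩
      obtain ⟨l, hl⟩ := exists_ne j
      have h1 := update_mem_spaceOf hW s.2 u.2 (hus l hl).symm i j
      refine ⟨⟨_, h1⟩, (mem_s ..).2 ?_, fun m hm => Function.update_of_ne hm _ _⟩
      convert hu
      funext m
      by_cases hm : m = j
      · change Function.update s.1 i (u.1 j) (τ m) = u.1 m
        rw [(h m).2 hm, hm, Function.update_self]
      · exact (Function.update_of_ne (fun e => hm ((h m).1 e)) _ _).trans (hus m hm).symm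
  · exact ⟨fun _ => trivial, fun _ => rfl⟩
  · exact mem_s ..
  · rw [mem_s]
    obtain ⟨h1, h2⟩ := hs
    have h3 : s.1 i = s.1 j := h2
    convert h1
    funext l
    by_cases hl : l = i
    · subst hl
      rw [Function.comp_apply, repl_self, h3]
    · rw [Function.comp_apply, repl_of_ne hl]

theorem setAlg_mem_variety [Nontrivial ι] (k : Kind)
    (hW : Pairwise fun i j => Disjoint (W i) (W j)) : setAlg k (spaceOf ι W) ∈ variety k ι := by
  have h := polyadicEqualityLaws_spaceOf (ι := ι) hW
  cases k with
  | Sc => exact h.substitutionLaws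
  | CA => exact h.cylindricLaws
  | PA => exact h.toPolyadicLaws
  | PEA => exact h

end Space

section CompletelyRepresentable

variable {ι κ : Type} {U I : Type u} {W : I → Set U} (e : ι ↪ κ)

/-- A sequence indexed by `κ`, restricted to the dimensions in `ι`. -/
def restrictSeq (s : spaceOf κ W) : spaceOf ι W := ⟨s.1 ∘ e, comp_mem_spaceOf s.2 e⟩

theorem restrictSeq_surjective [Nonempty ι] :
    Function.Surjective (restrictSeq e : spaceOf κ W → spaceOf ι W) := by
  classical
  rintro ⟨s, a, ha⟩
  obtain ⟨i₀⟩ := ‹Nonempty ι›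
  refine ⟨⟨Function.extend e s fun _ => s i₀, a, fun j => ?_⟩,
    ?_⟩
  · by_cases hj : ∃ i, e i = j
    · obtain ⟨i, rfl⟩ := hj
      rw [e.injective.extend_apply]
      exact ha i
    · rw [Function.extend_apply' _ _ _ hj]
      exact ha i₀
  · refine Subtype.ext (funext fun i => ?_)
    unfold restrictSeq
    simp only [Function.comp_apply]
    exact e.injective.extend_apply _ _ _

/-- The subsets of the `κ`-dimensional space that are cylinders with respect to all dimensions
outside `ι`. -/
def neatSets (W : I → Set U) : BooleanSubalgebra (Set (spaceOf κ W)) where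
  carrier := {X | ∀ j, j ∉ Set.range e → ∀ s ∈ X, ∀ t : spaceOf κ W,
    (∀ l, l ≠ j → s.1 l = t.1 l) → t ∈ X}
  supClosed' := by
    rintro X hX Y hY j hj s (hs | hs) t h
    · exact Or.inl (hX j hj s hs t h)
    · exact Or.inr (hY j hj s hs t h)
  infClosed' := fun X hX Y hY j hj s hs t h => ⟨hX j hj s hs.1 t h, hY j hj s hs.2 t h⟩
  compl_mem' := fun hX j hj s hs t h ht => hs (hX j hj t ht s fun l hl => (h l hl).symm)
  bot_mem' := fun _ _ _ hs => hs.elim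

theorem mem_neatSets {X : Set (spaceOf κ W)} :
    X ∈ neatSets e W ↔ ∀ j, j ∉ Set.range e → cylinder j X = X := by
  refine ⟨fun h j hj => Set.Subset.antisymm ?_ fun s hs => ⟨s, hs, fun _ _ => rfl⟩,
    fun h j hj s hs t hst => ?_⟩
  · rintro t ⟨s, hs, hst⟩
    exact h j hj s hs t hst
  · rw [← h j hj]
    exact ⟨s, hs, hst⟩

/-- The neat reduct of the full set algebra on the `κ`-dimensional space. -/
noncomputable def neatSetAlg [Nontrivial κ] (hW : Pairwise fun i j => Disjoint (W i) (W j))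
    (k : Kind) : Alg.{u} k ι where
  carrier := neatSets e W
  c := fun i X => ⟨cylinder (e i) X.1, (mem_neatSets e).2 fun j hj => by
    rw [(polyadicEqualityLaws_spaceOf hW).c_comm, (mem_neatSets e).1 X.2 j hj]⟩
  d := fun _ i j => ⟨diagonal (e i) (e j), fun k hk s hs t hst => by
    have h1 : s.1 (e i) = s.1 (e j) := hs
    change t.1 (e i) = t.1 (e j)
    rw [← hst _ fun h => hk ⟨i, h⟩, ← hst _ fun h => hk ⟨j, h⟩, h1]⟩
  s := fun τ _ X => ⟨substitute (extendMap e τ) X.1, fun k hk s hs t hst => by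
    rw [mem_substitute (comp_mem_spaceOf s.2 _)] at hs
    rw [mem_substitute (comp_mem_spaceOf t.2 _)]
    refine X.2 k hk _ hs _ fun l hl => hst _ ?_
    by_cases hx : ∃ m, e m = l
    · obtain ⟨m, rfl⟩ := hx
      rw [extendMap_apply]
      exact fun h => hk ⟨_, h⟩
    · rwa [extendMap_of_notMem e τ l hx]⟩

theorem neatSetAlg_mem_Nr [Nontrivial κ] (hW : Pairwise fun i j => Disjoint (W i) (W j))
    (k : Kind) : neatSetAlg e hW k ∈ Nr e (variety.{u} k κ) := by
  refine ⟨setAlg k (spaceOf κ W), setAlg_mem_variety k hW, Subtype.val, Subtype.val_injective,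
    ⟨rfl, rfl, fun _ => rfl, fun _ _ => rfl, fun _ _ => rfl, fun _ _ => rfl, fun _ _ _ => rfl,
      fun _ _ _ => rfl⟩, ?_⟩
  refine Subtype.range_coe.trans (Set.ext fun X => ?_)
  exact mem_neatSets e

/-- A complete representation on `ι`-dimensional spaces embeds the algebra completely in the neat
reduct of a set algebra of any larger dimension. -/
theorem CompletelyRepresentable.mem_completeSub [Nontrivial ι] {k : Kind} {A : Alg.{u} k ι}
    (hA : CompletelyRepresentable A) : A ∈ completeSub (Nr e (variety.{u} k κ)) := by
  classical
  obtain ⟨U, V, ⟨I, W, hI, hWn, hW, rfl⟩, f, hfi, hf, hinf⟩ := hA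
  have : Nontrivial κ := e.injective.nontrivial
  let F : A → Set (spaceOf ι W) := f
  have hF_bot : F ⊥ = ∅ := hf.map_bot
  have hF_top : F ⊤ = Set.univ := hf.map_top
  have hF_compl : ∀ x, F xᶜ = (F x)ᶜ := hf.map_compl
  have hF_sup : ∀ x y, F (x ⊔ y) = F x ∪ F y := hf.map_sup
  have hF_inf : ∀ x y, F (x ⊓ y) = F x ∩ F y := hf.map_inf
  have hF_c : ∀ i x, F (A.c i x) = cylinder i (F x) := hf.map_c
  have hF_d : ∀ h i j, F (A.d h i j) = diagonal i j := hf.map_d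
  have hF_s : ∀ τ h x, F (A.s τ h x) = substitute τ (F x) := hf.map_s
  -- pull the representation back along the restriction of sequences
  let f' : A → neatSetAlg e hW k := fun a => ⟨restrictSeq e ⁻¹' F a, fun j hj s hs t hst => by
    have h1 : restrictSeq e s = restrictSeq e t :=
      Subtype.ext (funext fun i => hst _ fun h => hj ⟨i, h⟩)
    change restrictSeq e t ∈ F a
    rw [← h1]
    exact hs⟩
  refine ⟨neatSetAlg e hW k, neatSetAlg_mem_Nr e hW k, f', fun a b hab => ?_, ?_, ?_⟩
  · have h1 : restrictSeq e ⁻¹' F a = restrictSeq e ⁻¹' F b := congrArg Subtype.val hab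
    exact hfi ((restrictSeq_surjective e).preimage_injective h1)
  · have ext : ∀ {X Y : neatSetAlg e hW k},
        (∀ s : spaceOf κ W, s ∈ (X : neatSets e W).1 ↔ s ∈ (Y : neatSets e W).1) → X = Y :=
      fun h => Subtype.ext (Set.ext h)
    refine ⟨ext fun s => ?_, ext fun s => ?_, fun x => ext fun s => ?_, fun x y => ext fun s => ?_,
      fun x y => ext fun s => ?_, fun i x => ext fun s => ?_, fun h i j => ext fun s => ?_,
      fun τ h x => ext fun s => ?_⟩
    · exact Set.ext_iff.1 hF_bot (restrictSeq e s)
    · exact Set.ext_iff.1 hF_top (restrictSeq e s)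
    · exact Set.ext_iff.1 (hF_compl x) (restrictSeq e s)
    · exact Set.ext_iff.1 (hF_sup x y) (restrictSeq e s)
    · exact Set.ext_iff.1 (hF_inf x y) (restrictSeq e s)
    · refine (Set.ext_iff.1 (hF_c i x) (restrictSeq e s)).trans ?_
      constructor
      · rintro ⟨t, ht, hts⟩
        obtain ⟨l, hl⟩ := exists_ne i
        have h1 := update_mem_spaceOf hW s.2 t.2 (l := e l) (l' := l) (hts l hl).symm (e i) i
        refine ⟨⟨_, h1⟩, ?_, fun m hm => Function.update_of_ne hm _ _⟩
        change restrictSeq e ⟨_, h1⟩ ∈ F x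
        convert ht
        refine Subtype.ext (funext fun m => ?_)
        change Function.update s.1 (e i) (t.1 i) (e m) = t.1 m
        by_cases hm : m = i
        · rw [hm, Function.update_self]
        · rw [Function.update_of_ne (e.injective.ne hm)]
          exact (hts m hm).symm
      · rintro ⟨t, ht, hts⟩
        exact ⟨restrictSeq e t, ht, fun m hm => hts _ (e.injective.ne hm)⟩
    · exact Set.ext_iff.1 (hF_d h i j) (restrictSeq e s)
    · refine (Set.ext_iff.1 (hF_s τ h x) (restrictSeq e s)).trans ?_
      refine (mem_substitute (comp_mem_spaceOf (restrictSeq e s).2 τ)).trans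
        (Iff.trans ?_ (mem_substitute (comp_mem_spaceOf s.2 _)).symm)
      have h1 : (⟨(restrictSeq e s).1 ∘ τ, comp_mem_spaceOf (restrictSeq e s).2 τ⟩ : spaceOf ι W) =
          restrictSeq e ⟨s.1 ∘ extendMap e τ, comp_mem_spaceOf s.2 _⟩ :=
        Subtype.ext (funext fun i => congrArg s.1 (extendMap_apply e τ i).symm)
      rw [h1]
      rfl
  · intro X hX
    refine ⟨fun _ _ => le_top, fun Y hY => ?_⟩
    -- the complements of the members of `X` have meet `⊥`, so their images have empty intersection
    have h1 : IsGLB (compl '' X) (⊥ : A) := by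
      refine ⟨fun _ _ => bot_le, fun b hb => ?_⟩
      have h2 : bᶜ ∈ upperBounds X := fun x hx => le_compl_comm.1 (hb ⟨x, hx, rfl⟩)
      have h3 := hX.2 h2
      rw [top_le_iff, compl_eq_top] at h3
      exact h3.le
    have h2 := hinf _ _ h1
    have h3 : ∀ s : spaceOf ι W, ∃ x ∈ X, s ∈ F x := by
      intro s
      by_contra hs
      push Not at hs
      have h4 : ({s} : Set (spaceOf ι W)) ⊆ F ⊥ := by
        refine (le_isGLB_iff h2 (b := ({s} : Set (spaceOf ι W)))).2 ?_
        rintro _ ⟨_, ⟨x, hx, rfl⟩, rfl⟩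
        have h5 : ({s} : Set (spaceOf ι W)) ⊆ F xᶜ := by
          rw [hF_compl, Set.singleton_subset_iff]
          exact hs _ hx
        exact h5
      rw [hF_bot] at h4
      exact h4 (Set.mem_singleton s)
    refine fun s _ => ?_
    obtain ⟨x, hx, hs⟩ := h3 (restrictSeq e s)
    exact hY ⟨x, hx, rfl⟩ hs

theorem CompletelyRepresentable.mem_variety [Nontrivial ι] {k : Kind} {A : Alg.{u} k ι}
    (hA : CompletelyRepresentable A) : A ∈ variety k ι := by
  obtain ⟨U, V, ⟨I, W, hI, hWn, hW, rfl⟩, f, hfi, hf, hinf⟩ := hA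
  exact mem_variety_of_injective (setAlg_mem_variety k hW) hfi hf

/-- Complete representations pass to lifted reducts. -/
theorem CompletelyRepresentable.red {A : Alg.{0} .PEA ι} (hA : CompletelyRepresentable A) (k : Kind) :
    CompletelyRepresentable (A.red k : Alg.{u} k ι) := by
  obtain ⟨U, V, ⟨I, W, hI, hWn, hW, rfl⟩, f, hfi, hf, hinf⟩ := hA
  let W' : ULift.{u} I → Set (ULift.{u} U) := fun i => ULift.down ⁻¹' W i.down
  let r : spaceOf ι W' → spaceOf ι W := fun s => ⟨ULift.down ∘ s.1, s.2.imp' ULift.down fun _ h => h⟩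
  let l : spaceOf ι W → spaceOf ι W' := fun s => ⟨ULift.up ∘ s.1, s.2.imp' ULift.up fun _ h => h⟩
  have hl : ∀ s, r (l s) = s := fun _ => rfl
  have hr : Function.Surjective r := fun s => ⟨l s, hl s⟩
  let F : A → Set (spaceOf ι W) := f
  refine ⟨ULift.{u} U, spaceOf ι W', ⟨ULift.{u} I, W', ⟨⟨hI.some⟩⟩, fun i => ?_, fun i j hij => ?_, rfl⟩,
    fun a => (r ⁻¹' F a.down : Set _), fun a b hab => ?_, ?_, ?_⟩
  · obtain ⟨x, hx⟩ := hWn i.down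
    exact ⟨⟨x⟩, hx⟩
  · exact (hW fun h => hij (ULift.down_injective h)).preimage _
  · exact ULift.down_injective (hfi (hr.preimage_injective hab))
  · have ext : ∀ {X Y : Set (spaceOf ι W)}, X = Y → (r ⁻¹' X : Set (spaceOf ι W')) = r ⁻¹' Y :=
      fun h => by rw [h]
    refine ⟨ext hf.map_bot, ext hf.map_top, fun x => ext (hf.map_compl _), fun x y => ext (hf.map_sup _ _),
      fun x y => ext (hf.map_inf _ _), fun i x => (ext (hf.map_c _ _)).trans (Set.ext fun s => ?_),
      fun h i j => (ext (hf.map_d _ _ _)).trans (Set.ext fun s => ?_),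
      fun τ h x => (ext (hf.map_s _ _ _)).trans (Set.ext fun s => ?_)⟩
    · constructor
      · rintro ⟨t, ht, hts⟩
        exact ⟨l t, ht, fun j hj => ULift.down_injective (hts j hj)⟩
      · rintro ⟨t, ht, hts⟩
        exact ⟨r t, ht, fun j hj => congrArg ULift.down (hts j hj)⟩
    · exact ULift.down_injective.eq_iff
    · constructor
      · rintro ⟨t, ht, hts⟩
        exact ⟨l t, ht, funext fun j => ULift.down_injective (congrFun hts j)⟩
      · rintro ⟨t, ht, hts⟩
        exact ⟨r t, ht, funext fun j => congrArg ULift.down (congrFun hts j)⟩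
  · intro X a h
    have h1 : IsGLB (ULift.down '' X) a.down := by
      refine ⟨?_, fun b hb =>
        (le_isGLB_iff h (b := ULift.up b)).2 fun x hx => hb ⟨x, hx, rfl⟩⟩
      rintro _ ⟨x, hx, rfl⟩
      exact h.1 hx
    have h2 := hinf _ _ h1
    refine ⟨?_, fun Y hY s hs => ?_⟩
    · rintro _ ⟨x, hx, rfl⟩ s hs
      exact h2.1 ⟨_, ⟨x, hx, rfl⟩, rfl⟩ hs
    · have h3 : (({r s} : Set (spaceOf ι W)) : setAlg .PEA (spaceOf ι W)) ≤ f a.down := by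
        refine h2.2 ?_
        rintro _ ⟨_, ⟨x, hx, rfl⟩, rfl⟩ t rfl
        exact hY ⟨x, hx, rfl⟩ hs
      exact h3 (Set.mem_singleton _)

end CompletelyRepresentable

/-- A class between the two given ones contains the reduct of the completely representable algebra `B`,
but not that of the rainbow algebra, to which `B` is elementarily equivalent. -/
theorem not_isElementary_of_elementarilyEquivalent {n : ℕ} (hn : 3 ≤ n) {B : Alg.{0} .PEA (Fin n)} (hB : CompletelyRepresentable B)
    (h : (algLang .PEA (Fin n)).ElementarilyEquivalent (rainbowAlg n) B) (k : Kind) :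
    (∀ L : Set (Alg.{u} k (Fin n)),
      completeSub (Nr Fin.valEmbedding (variety.{u} k ℕ)) ⊆ L →
      L ⊆ completeSub (Nr (Fin.castAddEmb 3) (variety.{u} k (Fin (n + 3)))) →
      ¬ IsElementary L) ∧
    ¬ IsElementary (completelyRepresentables.{u} k (Fin n)) := by
  have : Nontrivial (Fin n) := Fin.nontrivial_iff_two_le.2 (by omega)
  have hB' : CompletelyRepresentable (B.red k : Alg.{u} k (Fin n)) := hB.red k
  refine ⟨fun L h₁ h₂ hL => ?_, fun hL => ?_⟩
  · exact red_notMem_completeSub_Nr hn k (h₂ (hL.red_mem h (h₁ (hB'.mem_completeSub _))))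
  · exact red_notMem_completeSub_Nr hn k
      ((hL.red_mem h (B := B) ⟨hB'.mem_variety, hB'⟩).2.mem_completeSub _)

/-! ### Elementary substructures closed under further operations -/

section ModelTheory

open FirstOrder Language

/-- A form of the downward Löwenheim–Skolem theorem: countably many finitary operations may be added
to the Skolem functions. -/
theorem exists_elementarySubstructure_closed (L : FirstOrder.Language.{0, 0}) [Countable L.Symbols]
    {M : Type} [Nonempty M] [L.Structure M]
    {J : Type} [Countable J] (a : J → ℕ) (F : ∀ j, (Fin (a j) → M) → M) :
    ∃ S : L.ElementarySubstructure M, Countable S ∧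
      ∀ j x, (∀ l, x l ∈ S) → F j x ∈ S := by
  let K : FirstOrder.Language.{0, 0} := ⟨fun m => {j : J // a j = m}, fun _ => Empty⟩
  let : K.Structure M := ⟨fun {m} j x => F j.1 fun l => x (Fin.cast j.2 l), fun {m} r => r.elim⟩
  let L' := (L.sum L.skolem₁).sum K
  have hL' : Countable (Σ m, L'.Functions m) := by
    have h1 : ∀ m, Countable (L.Functions m) := fun m =>
      (sigma_mk_injective (β := L.Functions) (i := m)).countable
    have h2 : ∀ m, Countable (L.BoundedFormula Empty m) := fun m =>
      (sigma_mk_injective (β := L.BoundedFormula Empty) (i := m)).countable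
    have h3 : ∀ m, Countable (L'.Functions m) := fun m =>
      inferInstanceAs (Countable ((L.Functions m ⊕ L.BoundedFormula Empty (m + 1)) ⊕
        {j : J // a j = m}))
    infer_instance
  let S' : L'.Substructure M := Substructure.closure L' ∅
  have hS' : Countable S' := Set.countable_empty.substructure_closure (L := L')
  refine ⟨Substructure.elementarySkolem₁Reduct (LHom.sumInl.substructureReduct S'), hS', fun j x hx => ?_⟩
  exact S'.fun_mem (LHom.sumInr.onFunction (⟨j, rfl⟩ : {j' : J // a j' = a j})) x hx

end ModelTheory

instance OpSymbol.countable {n : ℕ} : Countable (Σ m, OpSymbol .PEA (Fin n) m) := by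
  let g : (Σ m, OpSymbol .PEA (Fin n) m) →
      Fin 5 ⊕ Fin n ⊕ (Fin n × Fin n) ⊕ (Fin n → Fin n) := fun o =>
    match o with
    | ⟨_, .bot⟩ => .inl 0
    | ⟨_, .top⟩ => .inl 1
    | ⟨_, .compl⟩ => .inl 2
    | ⟨_, .sup⟩ => .inl 3
    | ⟨_, .inf⟩ => .inl 4
    | ⟨_, .c i⟩ => .inr (.inl i)
    | ⟨_, .d _ i j⟩ => .inr (.inr (.inl (i, j)))
    | ⟨_, .s τ _⟩ => .inr (.inr (.inr τ))
  refine Function.Injective.countable (f := g) ?_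
  rintro ⟨m, o⟩ ⟨m', o'⟩ h
  cases o <;> cases o' <;> try first | rfl | (simp [g] at h)
  · obtain rfl : _ = _ := by simpa [g] using h
    rfl
  · obtain ⟨rfl, rfl⟩ : _ ∧ _ := by simpa [g] using h
    rfl
  · obtain rfl : _ = _ := by simpa [g] using h
    rfl

instance {n : ℕ} : Countable (algLang .PEA (Fin n)).Symbols := by
  have h1 : Countable (Σ m, (algLang .PEA (Fin n)).Functions m) := OpSymbol.countable
  have h2 : IsEmpty (Σ m, (algLang .PEA (Fin n)).Relations m) := ⟨fun r => Empty.elim r.2⟩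
  exact inferInstanceAs (Countable (_ ⊕ _))

/-! ### Nonstandard colours -/

open Filter

/-- A non-principal ultrafilter on the natural numbers. -/
noncomputable abbrev natUltra : Ultrafilter ℕ := hyperfilter ℕ

/-- The ultrapower of a type. -/
abbrev NStar (β : Type) : Type := Germ (natUltra : Filter ℕ) β

namespace NStar

variable {β : Type}

/-- A chosen sequence that represents an element of the ultrapower. -/
noncomputable def rep (a : NStar β) : ℕ → β := Quotient.out a

theorem coe_rep (a : NStar β) : (↑(rep a) : NStar β) = a := Quotient.out_eq a

theorem eq_iff {a b : NStar β} : a = b ↔ ∀ᶠ m in natUltra, rep a m = rep b m := by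
  conv_lhs => rw [← coe_rep a, ← coe_rep b]
  exact Germ.coe_eq

theorem eq_coe_iff {a : NStar β} {f : ℕ → β} : a = ↑f ↔ ∀ᶠ m in natUltra, rep a m = f m := by
  conv_lhs => rw [← coe_rep a]
  exact Germ.coe_eq

theorem rep_coe (f : ℕ → β) : ∀ᶠ m in natUltra, rep (↑f : NStar β) m = f m := eq_coe_iff.1 rfl

theorem lt_iff [LinearOrder β] {a b : NStar β} : a < b ↔ ∀ᶠ m in natUltra, rep a m < rep b m := by
  conv_lhs => rw [← coe_rep a, ← coe_rep b]
  exact Germ.coe_lt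

end NStar

namespace Col

variable {T R T' R' : Type}

/-- Apply maps to the tint or to the red indices of a colour. -/
def map (f : T → T') (g : R → R') : Col T R → Col T' R'
  | green i => green i
  | tinted t => tinted (f t)
  | white i => white i
  | red k l => red (g k) (g l)

variable (f : T → T') (g : R → R') (a : Col T R)

@[simp] theorem map_rev : (a.map f g).rev = a.rev.map f g := by cases a <;> rfl

@[simp] theorem gidx_map : (a.map f g).gidx = a.gidx := by cases a <;> rfl

@[simp] theorem isGreen_map : (a.map f g).IsGreen ↔ a.IsGreen := by simp [IsGreen]

@[simp] theorem avail_map {n : ℕ} : (a.map f g).Avail n ↔ a.Avail n := by cases a <;> rfl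

@[simp] theorem map_cone (t : T) (j : ℕ) : (cone t j : Col T R).map f g = cone (f t) j := by
  cases j <;> rfl

end Col

/-- A set of nonstandard natural numbers and a set of nonstandard shades, used for tints, red indices
and shades of yellow. The finite sets of tints are among the shades. -/
structure StarColours where
  N : Set (NStar ℕ)
  Sh : Set (NStar (Set ℕ))
  shade : Set N → Sh
  mem_shade : ∀ s, s.Finite → ∀ t : N, (∀ᶠ m in natUltra, t.1.rep m ∈ (shade s).1.rep m) ↔ t ∈ s
  ok_shade : ∀ s, s.Finite → ∀ᶠ m in natUltra,
    ((shade s).1.rep m).Finite ∨ (shade s).1.rep m = Set.univ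

namespace StarColours

variable (Q : StarColours)

/-- The palette with these colours; membership holds if it does so almost everywhere. -/
noncomputable abbrev palette : Palette where
  T := Q.N
  R := Q.N
  Sh := Q.Sh
  mem t S := ∀ᶠ m in natUltra, t.1.rep m ∈ S.1.rep m
  ok S := ∀ᶠ m in natUltra, (S.1.rep m).Finite ∨ S.1.rep m = Set.univ
  shade := Q.shade
  mem_shade := Q.mem_shade
  ok_shade := Q.ok_shade

/-- The standard colour given by a nonstandard one at `m`. -/
noncomputable def eval (m : ℕ) : Col Q.N Q.N → Col ℕ ℕ := Col.map (fun t => t.1.rep m) fun t => t.1.rep m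

variable {Q}

@[simp] theorem eval_rev (m : ℕ) (a : Col Q.N Q.N) : (Q.eval m a).rev = Q.eval m a.rev := Col.map_rev ..
@[simp] theorem gidx_eval (m : ℕ) (a : Col Q.N Q.N) : (Q.eval m a).gidx = a.gidx := Col.gidx_map ..
@[simp] theorem isGreen_eval (m : ℕ) (a : Col Q.N Q.N) : (Q.eval m a).IsGreen ↔ a.IsGreen :=
  Col.isGreen_map ..
@[simp] theorem avail_eval {n : ℕ} (m : ℕ) (a : Col Q.N Q.N) : (Q.eval m a).Avail n ↔ a.Avail n :=
  Col.avail_map ..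
@[simp] theorem eval_cone (m : ℕ) (t : Q.N) (j : ℕ) :
    Q.eval m (Col.cone t j) = Col.cone (t.1.rep m) j := Col.map_cone ..

theorem eq_iff_eval {a b : Col Q.N Q.N} : a = b ↔ ∀ᶠ m in natUltra, Q.eval m a = Q.eval m b := by
  refine ⟨fun h => by rw [h]; exact Eventually.of_forall fun _ => rfl, fun h => ?_⟩
  obtain ⟨m, hm⟩ := h.exists
  cases a <;> cases b <;> simp only [eval, Col.map, reduceCtorEq] at hm
  · simpa using hm
  · congr 1
    exact Subtype.ext (NStar.eq_iff.2 (h.mono fun m hm => by simpa [eval, Col.map] using hm))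
  · simpa using hm
  · have h1 := NStar.eq_iff.2 (h.mono fun m hm => (Col.red.inj hm).1)
    have h2 := NStar.eq_iff.2 (h.mono fun m hm => (Col.red.inj hm).2)
    rw [Subtype.ext h1, Subtype.ext h2]

theorem eq_iff_map_eval {o o' : Option (Col Q.N Q.N)} :
    o = o' ↔ ∀ᶠ m in natUltra, o.map (Q.eval m) = o'.map (Q.eval m) := by
  refine ⟨fun h => by rw [h]; exact Eventually.of_forall fun _ => rfl, fun h => ?_⟩
  rcases o with _ | a <;> rcases o' with _ | b
  · rfl
  · obtain ⟨m, hm⟩ := h.exists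
    cases hm
  · obtain ⟨m, hm⟩ := h.exists
    cases hm
  · exact congrArg some (eq_iff_eval.2 (h.mono fun m hm => Option.some.inj hm))

theorem eq_iff_map_rep {o o' : Option Q.Sh} :
    o = o' ↔ ∀ᶠ m in natUltra, o.map (fun S => S.1.rep m) = o'.map fun S => S.1.rep m := by
  refine ⟨fun h => by rw [h]; exact Eventually.of_forall fun _ => rfl, fun h => ?_⟩
  rcases o with _ | a <;> rcases o' with _ | b
  · rfl
  · obtain ⟨m, hm⟩ := h.exists
    cases hm
  · obtain ⟨m, hm⟩ := h.exists
    cases hm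
  · exact congrArg some (Subtype.ext (NStar.eq_iff.2 (h.mono fun m hm => Option.some.inj hm)))

theorem sync_iff {i j k l : Q.N} : Sync i j k l ↔
    ∀ᶠ m in natUltra, Sync (i.1.rep m) (j.1.rep m) (k.1.rep m) (l.1.rep m) := by
  have hlt : ∀ {a b : Q.N}, a < b ↔ ∀ᶠ m in natUltra, a.1.rep m < b.1.rep m := NStar.lt_iff
  constructor
  · rintro ⟨h1, h2, h3⟩
    rcases lt_trichotomy i j with h | rfl | h
    · filter_upwards [hlt.1 h, hlt.1 (h3 h)] with m hm hm'
      exact ⟨fun e => (hm.ne e).elim, fun e => (lt_asymm hm e).elim, fun _ => hm'⟩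
    · rw [h1 rfl]
      exact Eventually.of_forall fun m => ⟨fun _ => rfl, fun h => (lt_irrefl _ h).elim,
        fun h => (lt_irrefl _ h).elim⟩
    · filter_upwards [hlt.1 h, hlt.1 (h2 h)] with m hm hm'
      exact ⟨fun e => (hm.ne' e).elim, fun _ => hm', fun e => (lt_asymm hm e).elim⟩
  · intro h
    refine ⟨?_, fun e => hlt.2 ?_, fun e => hlt.2 ?_⟩
    · rintro rfl
      exact Subtype.ext (NStar.eq_iff.2 (h.mono fun m hm => hm.1 rfl))
    · filter_upwards [h, hlt.1 e] with m hm he using hm.2.1 he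
    · filter_upwards [h, hlt.1 e] with m hm he using hm.2.2 he

theorem vtx_iff {a c b : Col Q.N Q.N} :
    Vtx a c b ↔ ∀ᶠ m in natUltra, Vtx (Q.eval m a) (Q.eval m c) (Q.eval m b) := by
  cases b with
  | green i => exact iff_of_true trivial (Eventually.of_forall fun _ => trivial)
  | tinted i => exact iff_of_true trivial (Eventually.of_forall fun _ => trivial)
  | white i =>
    change ¬ _ ↔ ∀ᶠ m in natUltra, ¬ ((Q.eval m a).gidx = some i ∧ (Q.eval m c).gidx = some i)
    simp
  | red k l =>
    change (∀ s t, a = .tinted s → c = .tinted t → Sync s t k l) ↔ ∀ᶠ m in natUltra,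
      ∀ s t, Q.eval m a = .tinted s → Q.eval m c = .tinted t → Sync s t (k.1.rep m) (l.1.rep m)
    cases a with
    | tinted s =>
      cases c with
      | tinted t => simp [eval, Col.map, sync_iff]
      | _ => simp [eval, Col.map]
    | _ => simp [eval, Col.map]

theorem redComp_iff {a b c : Col Q.N Q.N} :
    RedComp a b c ↔ ∀ᶠ m in natUltra, RedComp (Q.eval m a) (Q.eval m b) (Q.eval m c) := by
  cases a <;> cases b <;> cases c <;>
    simp [RedComp, eval, Col.map, ← NStar.eq_iff, Subtype.ext_iff]

theorem tri_iff {a b c : Col Q.N Q.N} :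
    Tri a b c ↔ ∀ᶠ m in natUltra, Tri (Q.eval m a) (Q.eval m b) (Q.eval m c) := by
  constructor
  · rintro ⟨h1, h2, h3, h4, h5⟩
    filter_upwards [vtx_iff.1 h2, vtx_iff.1 h3, vtx_iff.1 h4, redComp_iff.1 h5] with m h2 h3 h4 h5
    exact ⟨by simpa using h1, h2, by simpa using h3, by simpa using h4, h5⟩
  · intro h
    refine ⟨?_, vtx_iff.2 (h.mono fun m hm => hm.vtx_x),
      vtx_iff.2 (h.mono fun m hm => by simpa using hm.vtx_y),
      vtx_iff.2 (h.mono fun m hm => by simpa using hm.vtx_z), redComp_iff.2 (h.mono fun m hm => hm.red)⟩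
    obtain ⟨m, hm⟩ := h.exists
    simpa using hm.not_green

variable (Q) in
/-- The sequence `f` of atoms represents the pre-graph `p` with nonstandard colours. -/
def Realizes {n : ℕ} (f : ℕ → RainbowAtom n) (p : PG Q.palette n (Fin n)) : Prop :=
  ∀ᶠ m in natUltra, (∀ i j, (f m).toPG.e i j = (p.e i j).map (Q.eval m)) ∧
    ∀ t, (f m).toPG.y t = (p.y t).map fun S => S.1.rep m

variable {n : ℕ} {f g : ℕ → RainbowAtom n} {p q : PG Q.palette n (Fin n)}

theorem exists_realizes (hn : 3 ≤ n) (p : PG Q.palette n (Fin n)) : ∃ f, Q.Realizes f p := by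
  classical
  let e : ℕ → Fin n → Fin n → Option (Col ℕ ℕ) := fun m i j => (p.e i j).map (Q.eval m)
  let y : ℕ → (Fin (n - 1) → Fin n) → Option (Set ℕ) := fun m t => (p.y t).map fun S => S.1.rep m
  have h_tri : ∀ᶠ m in natUltra, ∀ x y z a b c, p.e x y = some a → p.e y z = some b →
      p.e x z = some c → Tri (Q.eval m a) (Q.eval m b) (Q.eval m c) := by
    simp only [eventually_all]
    intro x y z
    cases hx : p.e x y with
    | none => simp
    | some a =>
      cases hy : p.e y z with
      | none => simp
      | some b =>
        cases hz : p.e x z with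
        | none => simp
        | some c =>
          filter_upwards [tri_iff.1 (p.tri _ _ _ _ _ _ hx hy hz)] with m hm
          rintro _ _ _ ⟨⟩ ⟨⟩ ⟨⟩
          exact hm
  have h_ok : ∀ᶠ m in natUltra, ∀ t S, p.y t = some S → (S.1.rep m).Finite ∨ S.1.rep m = Set.univ := by
    rw [eventually_all]
    intro t
    cases ht : p.y t with
    | none => simp
    | some S =>
      filter_upwards [p.y_ok _ _ ht] with m hm
      rintro _ ⟨⟩
      exact hm
  have h_cone : ∀ᶠ m in natUltra, ∀ t z S s, p.y t = some S →
      (∀ j, p.e (t j) z = some (Col.cone s j)) → s.1.rep m ∈ S.1.rep m := by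
    rw [eventually_all]
    intro t
    rw [eventually_all]
    intro z
    by_cases h : ∃ S s, p.y t = some S ∧ ∀ j, p.e (t j) z = some (Col.cone s j)
    · obtain ⟨S, s, hS, hs⟩ := h
      filter_upwards [p.y_cone _ _ _ _ hS hs] with m hm
      intro S' s' hS' hs'
      obtain rfl := Option.some.inj (hS.symm.trans hS')
      have h1 : (Col.tinted s : Col Q.N Q.N) = Col.tinted s' :=
        Option.some.inj ((hs ⟨0, by omega⟩).symm.trans (hs' ⟨0, by omega⟩))
      obtain rfl := Col.tinted.inj h1
      exact hm
    · exact Eventually.of_forall fun m S s hS hs => (h ⟨S, s, hS, hs⟩).elim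
  -- almost everywhere the standard parts of the colours form a pre-graph
  have h : ∀ᶠ m in natUltra, ∃ M : PG stdPalette n (Fin n), (∀ i j, M.e i j = e m i j) ∧
      ∀ t, M.y t = y m t := by
    filter_upwards [h_tri, h_ok, h_cone] with m h_tri h_ok h_cone
    refine ⟨
    { e := e m
      y := y m
      e_self := ?e_self
      e_congr := ?e_congr
      e_symm := ?e_symm
      e_avail := ?e_avail
      tri := ?tri
      y_congr := ?y_congr
      y_isSome := ?y_isSome
      y_ok := ?y_ok
      y_cone := ?y_cone }, fun _ _ => rfl, fun _ => rfl⟩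
    case e_self => exact fun x => by simp [e, p.e_self]
    case e_congr =>
      intro x y z hxy
      have h1 : p.e x y = none := by simpa [e] using hxy
      simp only [e, p.e_congr x y z h1]
    case e_symm =>
      intro x y
      simp only [e, p.e_symm x y, Option.map_map]
      congr 1
      funext a
      simp
    case e_avail =>
      intro x y a ha
      obtain ⟨b, hb, rfl⟩ := Option.map_eq_some_iff.1 ha
      exact (avail_eval _ _).2 (p.e_avail _ _ _ hb)
    case tri =>
      intro x y z a b c ha hb hc
      obtain ⟨a, ha', rfl⟩ := Option.map_eq_some_iff.1 ha
      obtain ⟨b, hb', rfl⟩ := Option.map_eq_some_iff.1 hb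
      obtain ⟨c, hc', rfl⟩ := Option.map_eq_some_iff.1 hc
      exact h_tri _ _ _ _ _ _ ha' hb' hc'
    case y_congr =>
      intro s t hst
      simp only [y, p.y_congr s t fun i => by simpa [e] using hst i]
    case y_isSome =>
      intro t
      simp only [y, e, Option.isSome_map, p.y_isSome t]
      refine forall₃_congr fun i j hij => ⟨?_, ?_⟩
      · rintro ⟨a, ha, h⟩
        exact ⟨Q.eval m a, by rw [ha]; rfl, by simpa using h⟩
      · rintro ⟨a, ha, h⟩
        obtain ⟨a, ha', rfl⟩ := Option.map_eq_some_iff.1 ha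
        exact ⟨a, ha', by simpa using h⟩
    case y_ok =>
      intro t S hS
      obtain ⟨S, hS', rfl⟩ := Option.map_eq_some_iff.1 hS
      exact h_ok _ _ hS'
    case y_cone =>
      intro t S z s hS hs
      obtain ⟨S, hS', rfl⟩ := Option.map_eq_some_iff.1 hS
      -- the base edge at `0` determines the nonstandard tint
      obtain ⟨a, ha, ha'⟩ := Option.map_eq_some_iff.1 (hs ⟨0, by omega⟩)
      cases a with
      | tinted τ =>
        obtain rfl : τ.1.rep m = s := Col.tinted.inj ha'
        refine h_cone t z S τ hS' fun j => ?_
        obtain ⟨b, hb, hb'⟩ := Option.map_eq_some_iff.1 (hs j)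
        obtain ⟨j, hj⟩ := j
        cases j with
        | zero => exact ha
        | succ j =>
          rw [hb]
          cases b with
          | green i => exact congrArg (fun i => some (Col.green i)) (Col.green.inj hb')
          | _ => cases hb'
      | _ => cases ha'
  have : Nonempty (RainbowAtom n) := by
    obtain ⟨m, M, _⟩ := h.exists
    exact ⟨.ofPG M⟩
  let f : ℕ → RainbowAtom n := fun m =>
    if h : ∃ M : PG stdPalette n (Fin n), (∀ i j, M.e i j = e m i j) ∧ ∀ t, M.y t = y m t then
      .ofPG h.choose else Classical.arbitrary _
  refine ⟨f, ?_⟩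
  filter_upwards [h] with m hm
  have hf : (f m).toPG = hm.choose := by simp only [f, dif_pos hm, RainbowAtom.toPG_ofPG]
  rw [hf]
  exact hm.choose_spec

/-- A sequence of atoms whose colours are, almost everywhere, given by nonstandard colours is
represented by a pre-graph with nonstandard colours. -/
theorem exists_realizes_of_colours
    (he : ∀ i j, ∃ o : Option (Col Q.N Q.N), ∀ᶠ m in natUltra, (f m).toPG.e i j = o.map (Q.eval m))
    (hy : ∀ t, ∃ o : Option Q.Sh, ∀ᶠ m in natUltra,
      (f m).toPG.y t = o.map fun S => S.1.rep m) :
    ∃ p, Q.Realizes f p := by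
  choose e he using he
  choose y hy using hy
  have h : ∀ᶠ m in natUltra, (∀ i j, (f m).toPG.e i j = (e i j).map (Q.eval m)) ∧
      ∀ t, (f m).toPG.y t = (y t).map fun S => S.1.rep m :=
    (eventually_all.2 fun i => eventually_all.2 fun j => he i j).and (eventually_all.2 hy)
  obtain ⟨m₀, h₀, h₀'⟩ := h.exists
  have hnone : ∀ {i j}, e i j = none → ∀ᶠ m in natUltra, (f m).toPG.e i j = none := fun hij =>
    h.mono fun m hm => by rw [hm.1, hij]; rfl
  have hsome : ∀ {i j a}, e i j = some a → ∀ᶠ m in natUltra, (f m).toPG.e i j = some (Q.eval m a) :=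
    fun hij => h.mono fun m hm => by rw [hm.1, hij]; rfl
  refine ⟨
    { e := e
      y := y
      e_self := ?e_self
      e_congr := ?e_congr
      e_symm := ?e_symm
      e_avail := ?e_avail
      tri := ?tri
      y_congr := ?y_congr
      y_isSome := ?y_isSome
      y_ok := ?y_ok
      y_cone := ?y_cone }, h⟩
  case e_self =>
    intro x
    have := h₀ x x
    rw [PG.e_self] at this
    exact Option.map_eq_none_iff.1 this.symm
  case e_congr =>
    intro x y z hxy
    refine eq_iff_map_eval.2 ?_
    filter_upwards [h, hnone hxy] with m hm hm'
    rw [← hm.1, ← hm.1, PG.e_congr _ _ _ _ hm']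
  case e_symm =>
    intro x y
    refine eq_iff_map_eval.2 ?_
    filter_upwards [h] with m hm
    rw [← hm.1, PG.e_symm, hm.1, Option.map_map, Option.map_map]
    congr 1
    funext a
    simp
  case e_avail =>
    intro x y a ha
    have h1 := h₀ x y
    rw [ha] at h1
    exact (avail_eval m₀ a).1 (PG.e_avail _ _ _ _ h1)
  case tri =>
    intro x y z a b c ha hb hc
    refine tri_iff.2 ?_
    filter_upwards [hsome ha, hsome hb, hsome hc] with m ha hb hc
    exact PG.tri _ _ _ _ _ _ _ ha hb hc
  case y_congr =>
    intro s t hst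
    refine eq_iff_map_rep.2 ?_
    filter_upwards [h, eventually_all.2 fun i => hnone (hst i)] with m hm hst
    rw [← hm.2, ← hm.2, PG.y_congr _ _ _ hst]
  case y_isSome =>
    intro t
    have h1 := (f m₀).toPG.y_isSome t
    rw [h₀', Option.isSome_map] at h1
    rw [h1]
    refine forall₃_congr fun i j hij => ?_
    rw [h₀]
    constructor
    · rintro ⟨a, ha, h⟩
      obtain ⟨a, ha', rfl⟩ := Option.map_eq_some_iff.1 ha
      exact ⟨a, ha', by simpa using h⟩
    · rintro ⟨a, ha, h⟩
      exact ⟨Q.eval m₀ a, by rw [ha]; rfl, by simpa using h⟩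
  case y_ok =>
    intro t S hS
    filter_upwards [h] with m hm
    exact (f m).toPG.y_ok t _ (by rw [hm.2, hS]; rfl)
  case y_cone =>
    intro t S z s hS hs
    filter_upwards [h, eventually_all.2 fun j => hsome (hs j)] with m hm hs
    refine (f m).toPG.y_cone t _ z _ (by rw [hm.2, hS]; rfl) fun j => ?_
    rw [hs, eval_cone]

theorem Realizes.agreeOff_iff (hf : Q.Realizes f p) (hg : Q.Realizes g q) {i : Fin n} :
    p.AgreeOff i q ↔ ∀ᶠ m in natUltra, (f m).AgreeOff i (g m) := by
  simp only [RainbowAtom.agreeOff_iff]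
  constructor
  · intro h
    filter_upwards [hf, hg] with m hf hg
    refine ⟨fun k l hk hl => ?_, fun t ht => ?_⟩
    · rw [hf.1, hg.1, h.1 k l hk hl]
    · rw [hf.2, hg.2, h.2 t ht]
  · intro h
    refine ⟨fun k l hk hl => eq_iff_map_eval.2 ?_, fun t ht => eq_iff_map_rep.2 ?_⟩
    · filter_upwards [hf, hg, h] with m hf hg h
      rw [← hf.1, ← hg.1]
      exact h.1 k l hk hl
    · filter_upwards [hf, hg, h] with m hf hg h
      rw [← hf.2, ← hg.2]
      exact h.2 t ht

theorem Realizes.comap (hf : Q.Realizes f p) (τ : Fin n → Fin n) :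
    Q.Realizes (fun m => (f m).comap τ) (p.comap τ) := by
  filter_upwards [hf] with m hf
  rw [RainbowAtom.toPG_comap]
  exact ⟨fun i j => hf.1 _ _, fun t => hf.2 _⟩

theorem Realizes.eventuallyEq (hf : Q.Realizes f p) (hg : Q.Realizes g p) :
    ∀ᶠ m in natUltra, f m = g m := by
  filter_upwards [hf, hg] with m hf hg
  refine RainbowAtom.toPG_injective (PG.ext (fun i j => ?_) fun t => ?_)
  · rw [hf.1, hg.1]
  · rw [hf.2, hg.2]

theorem Realizes.edge_eq_none_iff (hf : Q.Realizes f p) {i j : Fin n} :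
    p.e i j = none ↔ ∀ᶠ m in natUltra, (f m).toPG.e i j = none := by
  rw [eq_iff_map_eval]
  refine eventually_congr ?_
  filter_upwards [hf] with m hf
  rw [hf.1, Option.map_none]

end StarColours

/-! ### A countable elementary substructure of an ultrapower of the rainbow algebra -/

/-- An ultrapower of the rainbow algebra. -/
abbrev RStar (n : ℕ) : Type := (natUltra : Filter ℕ).Product fun _ : ℕ => (rainbowAlg n : Type)

section RStar

variable {n : ℕ}

/-- A chosen sequence of sets of atoms that represents an element of the ultrapower. -/
noncomputable def RStar.rep (x : RStar n) : ℕ → Set (RainbowAtom n) := Quotient.out x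

/-- The element of the ultrapower that is represented by a sequence. -/
noncomputable def RStar.mk (X : ℕ → Set (RainbowAtom n)) : RStar n :=
  Quotient.mk (productSetoid (natUltra : Filter ℕ) fun _ : ℕ => (rainbowAlg n : Type)) X

theorem RStar.mk_rep (x : RStar n) : RStar.mk x.rep = x := Quotient.out_eq x

theorem RStar.mk_eq_mk {X Y : ℕ → Set (RainbowAtom n)} :
    RStar.mk X = RStar.mk Y ↔ ∀ᶠ m in natUltra, X m = Y m := Quotient.eq

theorem RStar.rep_mk (X : ℕ → Set (RainbowAtom n)) :
    ∀ᶠ m in natUltra, (RStar.mk X).rep m = X m := RStar.mk_eq_mk.1 (RStar.mk_rep _)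

/-- The nonstandard atom `f` lies in the internal set `x`. -/
def RStar.Mem (f : ℕ → RainbowAtom n) (x : RStar n) : Prop := ∀ᶠ m in natUltra, f m ∈ x.rep m

theorem RStar.mem_mk {f : ℕ → RainbowAtom n} {X : ℕ → Set (RainbowAtom n)} :
    RStar.Mem f (RStar.mk X) ↔ ∀ᶠ m in natUltra, f m ∈ X m := by
  refine eventually_congr ?_
  filter_upwards [RStar.rep_mk X] with m hm
  rw [hm]

/-- The internal singleton of a nonstandard atom. -/
noncomputable def RStar.point (f : ℕ → RainbowAtom n) : RStar n := RStar.mk fun m => {f m}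

theorem RStar.mem_point {f g : ℕ → RainbowAtom n} :
    RStar.Mem f (RStar.point g) ↔ ∀ᶠ m in natUltra, f m = g m := RStar.mem_mk

open FirstOrder Language in
theorem RStar.funMap_eq {k : ℕ} (o : (algLang .PEA (Fin n)).Functions k) (x : Fin k → RStar n) :
    Structure.funMap o x =
      RStar.mk fun m => Structure.funMap (M := (rainbowAlg n : Type)) o fun l => (x l).rep m := by
  conv_lhs => rw [← funext fun l => RStar.mk_rep (x l)]
  exact Ultraproduct.funMap_cast (M := fun _ : ℕ => (rainbowAlg n : Type)) o fun l => (x l).rep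

open FirstOrder Language in
theorem RStar.mem_funMap {f : ℕ → RainbowAtom n} {k : ℕ} (o : (algLang .PEA (Fin n)).Functions k)
    (x : Fin k → RStar n) :
    RStar.Mem f (Structure.funMap o x) ↔ ∀ᶠ m in natUltra,
      f m ∈ id (α := Set (RainbowAtom n))
        (Structure.funMap (M := (rainbowAlg n : Type)) o fun l => (x l).rep m) := by
  rw [RStar.funMap_eq]
  exact RStar.mem_mk

theorem coneAtom_injective (hn : 3 ≤ n) : Function.Injective (coneAtom hn) := by
  intro t t' h
  have h1 := coneAtom_e hn t ⟨0, by omega⟩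
  rw [h, coneAtom_e] at h1
  exact (Col.tinted.inj (Option.some.inj h1)).symm

/-- Nonstandard numbers, coded by elements of the ultrapower. -/
noncomputable def encNum (hn : 3 ≤ n) (a : NStar ℕ) : RStar n :=
  RStar.mk fun m => {coneAtom hn (a.rep m)}

theorem encNum_injective (hn : 3 ≤ n) : Function.Injective (encNum hn) := by
  intro a b h
  refine NStar.eq_iff.2 ((RStar.mk_eq_mk.1 h).mono fun m hm => ?_)
  exact coneAtom_injective hn (Set.singleton_injective hm)

/-- Nonstandard shades, coded by elements of the ultrapower. -/
noncomputable def encShade (hn : 3 ≤ n) (a : NStar (Set ℕ)) : RStar n :=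
  RStar.mk fun m => coneAtom hn '' a.rep m

theorem encShade_injective (hn : 3 ≤ n) : Function.Injective (encShade hn) := by
  intro a b h
  refine NStar.eq_iff.2 ((RStar.mk_eq_mk.1 h).mono fun m hm => ?_)
  exact (coneAtom_injective hn).image_injective hm

end RStar

/-! #### Colours and their shapes -/

namespace Col

variable {T R X : Type}

/-- Replace the tint or the red indices of a colour. -/
def relabel (a b : X) : Col T R → Col X X
  | green i => green i
  | tinted _ => tinted a
  | white i => white i
  | red _ _ => red a b

/-- The tint or the first red index of a colour. -/
def fst (d : X) : Option (Col X X) → X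
  | some (tinted t) => t
  | some (red k _) => k
  | _ => d

/-- The second red index of a colour. -/
def snd (d : X) : Option (Col X X) → X
  | some (red _ l) => l
  | _ => d

/-- A colour without its tint or red indices. -/
def shape (a : Col T R) : Col Unit Unit := a.map (fun _ => ()) fun _ => ()

theorem relabel_shape (o : Option (Col X X)) (d : X) :
    (o.map shape).map (relabel (fst d o) (snd d o)) = o := by
  rcases o with _ | _ | _ | _ | _ <;> rfl

theorem map_relabel {Y : Type} (f : X → Y) (a b : X) (c : Col T R) :
    (c.relabel a b).map f f = c.relabel (f a) (f b) := by
  cases c <;> rfl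

theorem relabel_fst_snd {Y : Type} (f : X → Y) (o : Option (Col X X)) (d : X) :
    (o.map shape).map (relabel (f (fst d o)) (f (snd d o))) = o.map (map f f) := by
  rcases o with _ | _ | _ | _ | _ <;> rfl

theorem finite_shapes (n : ℕ) : {a : Col Unit Unit | a.Avail n}.Finite := by
  refine (((Set.finite_Iic n).image green).union (((Set.finite_Iic n).image white).union
    (Set.toFinite {tinted (), red () ()}))).subset ?_
  rintro (i | t | i | ⟨k, l⟩) h
  · exact Or.inl ⟨i, h.2.trans (Nat.sub_le _ _), rfl⟩
  · exact Or.inr (Or.inr (Or.inl rfl))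
  · exact Or.inr (Or.inl ⟨i, le_trans h (Nat.sub_le _ _), rfl⟩)
  · exact Or.inr (Or.inr (Or.inr rfl))

end Col

/-- An available colour in the ultrapower has a shape, and it is given by nonstandard indices. -/
theorem exists_relabel {n : ℕ} {o : ℕ → Option (Col ℕ ℕ)} (ho : ∀ m a, o m = some a → a.Avail n) :
    ∃ σ : Option (Col Unit Unit), ∀ᶠ m in natUltra,
      o m = σ.map (Col.relabel (Col.fst 0 (o m)) (Col.snd 0 (o m))) := by
  have hfin : (insert none (some '' {a : Col Unit Unit | a.Avail n})).Finite :=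
    ((Col.finite_shapes n).image some).insert none
  have h1 : (⋃ σ ∈ insert none (some '' {a : Col Unit Unit | a.Avail n}),
      {m | (o m).map Col.shape = σ}) ∈ natUltra := by
    refine univ_mem' fun m => ?_
    simp only [Set.mem_iUnion]
    refine ⟨(o m).map Col.shape, ?_, rfl⟩
    cases h : o m with
    | none => exact Or.inl rfl
    | some a => exact Or.inr ⟨a.shape, (Col.avail_map _ _ _).2 (ho m a h), rfl⟩
  obtain ⟨σ, -, hσ⟩ := (Ultrafilter.finite_biUnion_mem_iff hfin).1 h1
  refine ⟨σ, ?_⟩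
  filter_upwards [hσ] with m hm
  rw [← (hm : _ = σ), Col.relabel_shape]

/-! #### The closed substructure -/

/-- Positions of the tints, red indices and shades in a pre-graph on `n` nodes. -/
abbrev Pos (n : ℕ) : Type := (Fin n × Fin n × Bool) ⊕ (Fin (n - 1) → Fin n)

/-- Operations on the ultrapower, indexed by symbols: `pick` chooses an element of an internal set,
`fst`, `snd` and `shade` extract the colours of that element, `scale` and `finite` provide nonstandard
numbers and finite shades, and `glue` forms atoms from given colours. -/
inductive StarOp (n : ℕ) : Type
  | pick
  | fst (i j : Fin n)
  | snd (i j : Fin n)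
  | shade (t : Fin (n - 1) → Fin n)
  | scale (q : Set.Ioi (0 : ℚ))
  | finite (k : ℕ)
  | glue (E : Fin n → Fin n → Option (Col Unit Unit)) (Y : (Fin (n - 1) → Fin n) → Option Unit)

namespace StarOp

variable {n : ℕ}

instance : Countable (StarOp n) := by
  let g : StarOp n → Unit ⊕ (Fin n × Fin n) ⊕ (Fin n × Fin n) ⊕ (Fin (n - 1) → Fin n) ⊕
      Set.Ioi (0 : ℚ) ⊕ ℕ ⊕ ((Fin n → Fin n → Option (Col Unit Unit)) ×
        ((Fin (n - 1) → Fin n) → Option Unit)) := fun o =>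
    match o with
    | pick => .inl ()
    | fst i j => .inr (.inl (i, j))
    | snd i j => .inr (.inr (.inl (i, j)))
    | shade t => .inr (.inr (.inr (.inl t)))
    | scale q => .inr (.inr (.inr (.inr (.inl q))))
    | finite k => .inr (.inr (.inr (.inr (.inr (.inl k)))))
    | glue E Y => .inr (.inr (.inr (.inr (.inr (.inr (E, Y))))))
  refine Function.Injective.countable (f := g) ?_
  intro a b h
  cases a <;> cases b <;> simp_all [g]

/-- The number of arguments. -/
def arity : StarOp n → ℕ
  | pick => 1
  | fst _ _ => 1
  | snd _ _ => 1
  | shade _ => 1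
  | scale _ => 0
  | finite k => k
  | glue _ _ => Fintype.card (Pos n)

variable [Nonempty (RainbowAtom n)]

/-- An element of a set of atoms, if there is one. -/
noncomputable def elt (X : Set (RainbowAtom n)) : RainbowAtom n :=
  open Classical in if h : X.Nonempty then h.some else Classical.arbitrary _

theorem elt_mem {X : Set (RainbowAtom n)} (h : X.Nonempty) : elt X ∈ X := by
  rw [elt, dif_pos h]
  exact h.some_mem

/-- The number `⌊q m⌋` at `m`. -/
noncomputable def scaleNum (q : Set.Ioi (0 : ℚ)) : NStar ℕ := ↑fun m : ℕ => ⌊q.1 * m⌋₊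

theorem scaleNum_strictMono : StrictMono scaleNum := by
  intro q q' h
  have h0 : (0 : ℚ) < q'.1 - q.1 := sub_pos.2 h
  refine Germ.coe_lt.2 (Nat.hyperfilter_le_atTop ?_)
  obtain ⟨N, hN⟩ := exists_nat_gt (1 / (q'.1 - q.1))
  filter_upwards [eventually_ge_atTop N] with m hm
  have h1 : (1 : ℚ) ≤ (q'.1 - q.1) * m := by
    have h2 : (1 : ℚ) / (q'.1 - q.1) < m := hN.trans_le (by exact_mod_cast hm)
    rw [div_lt_iff₀ h0] at h2
    linarith
  have h2 : (0 : ℚ) ≤ q.1 * m := mul_nonneg q.2.le (Nat.cast_nonneg m)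
  refine Nat.lt_of_succ_le (Nat.le_floor ?_)
  have h3 := Nat.floor_le h2
  push_cast
  linarith

/-- The operations. -/
noncomputable def op (hn : 3 ≤ n) : ∀ o : StarOp n, (Fin o.arity → RStar n) → RStar n
  | pick, x => RStar.point fun m => elt ((x (0 : Fin 1)).rep m)
  | fst i j, x => encNum hn ↑fun m => Col.fst 0 ((elt ((x (0 : Fin 1)).rep m)).toPG.e i j)
  | snd i j, x => encNum hn ↑fun m => Col.snd 0 ((elt ((x (0 : Fin 1)).rep m)).toPG.e i j)
  | shade t, x => encShade hn ↑fun m => ((elt ((x (0 : Fin 1)).rep m)).toPG.y t).getD ∅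
  | scale q, _ => encNum hn (scaleNum q)
  | finite _, x => encShade hn ↑fun m => Set.range fun l => (Function.invFun (encNum hn) (x l)).rep m
  | glue E Y, x => RStar.mk fun m =>
      let x' : Pos n → RStar n := fun l => x (Fintype.equivFin (Pos n) l)
      let num : Pos n → ℕ := fun l => (Function.invFun (encNum hn) (x' l)).rep m
      {p | (∀ i j, p.toPG.e i j =
          (E i j).map (Col.relabel (num (.inl (i, j, false))) (num (.inl (i, j, true))))) ∧
        ∀ t, p.toPG.y t = (Y t).map fun _ => (Function.invFun (encShade hn) (x' (.inr t))).rep m}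

end StarOp

open FirstOrder in
/-- A countable elementary substructure `S` of the ultrapower such that every nonzero element of `S`
contains an atom of `S`, and the atoms of `S` are exactly the nonstandard atoms with tints, red indices
and shades from the countable sets `N` and `Sh`. The order of `N` is embedded in its reverse, so that the
tints over any base can be matched with red indices; in `ℕ` this is impossible. -/
structure ClosedStar (n : ℕ) extends StarColours where
  S : (algLang .PEA (Fin n)).ElementarySubstructure (RStar n)
  countable : Countable S
  countable_N : Countable N
  nonempty_N : Nonempty N
  countable_Sh : Countable Sh
  point_mem : ∀ f (p : PG toStarColours.palette n (Fin n)), toStarColours.Realizes f p →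
    RStar.point f ∈ S
  exists_realizes : ∀ f, RStar.point f ∈ S →
    ∃ p : PG toStarColours.palette n (Fin n), toStarColours.Realizes f p
  exists_point : ∀ x ∈ S, (∃ f, RStar.Mem f x) → ∃ f, RStar.point f ∈ S ∧ RStar.Mem f x
  ρ : N → N
  strictAnti : StrictAnti ρ

open FirstOrder in
theorem exists_closedStar {n : ℕ} (hn : 3 ≤ n) : Nonempty (ClosedStar n) := by
  classical
  have : Nonempty (RainbowAtom n) := ⟨coneAtom hn 0⟩
  obtain ⟨S, hS, hcl⟩ := exists_elementarySubstructure_closed (algLang .PEA (Fin n)) (M := RStar n)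
    StarOp.arity (StarOp.op hn)
  let N : Set (NStar ℕ) := encNum hn ⁻¹' S
  let Sh : Set (NStar (Set ℕ)) := encShade hn ⁻¹' S
  have hN : Countable N := Set.Countable.preimage_of_injOn (Set.to_countable _)
    (encNum_injective hn).injOn
  have hSh : Countable Sh := Set.Countable.preimage_of_injOn (Set.to_countable _)
    (encShade_injective hn).injOn
  have hinv : ∀ a, Function.invFun (encNum hn) (encNum hn a) = a :=
    Function.leftInverse_invFun (encNum_injective hn)
  have hinv' : ∀ a, Function.invFun (encShade hn) (encShade hn a) = a :=
    Function.leftInverse_invFun (encShade_injective hn)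
  have hscale : ∀ q, StarOp.scaleNum q ∈ N := fun q => hcl (.scale q) Fin.elim0 fun l => l.elim0
  let imageShade : Set N → NStar (Set ℕ) := fun s => ↑fun m : ℕ => (fun t : N => t.1.rep m) '' s
  have himage : ∀ s : Set N, s.Finite → imageShade s ∈ Sh := by
    intro s hs
    have := hs.fintype
    let e := Fintype.equivFin s
    have h1 := hcl (.finite (Fintype.card s)) (fun l => encNum hn (e.symm l).1.1)
      fun l => (e.symm l).1.2
    refine (congrArg (fun y => encShade hn y ∈ S) ?_).mp h1
    refine congrArg _ (funext fun m => ?_)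
    simp only [hinv]
    ext z
    constructor
    · rintro ⟨l, rfl⟩
      exact ⟨(e.symm l).1, (e.symm l).2, rfl⟩
    · rintro ⟨t, ht, rfl⟩
      exact ⟨e ⟨t, ht⟩, by simp⟩
  let shade : Set N → Sh := fun s =>
    if h : s.Finite then ⟨imageShade s, himage s h⟩ else ⟨imageShade ∅, himage ∅ Set.finite_empty⟩
  have hshade : ∀ s : Set N, s.Finite → ∀ᶠ m in natUltra,
      (shade s).1.rep m = (fun t : N => t.1.rep m) '' s := by
    intro s hs
    have : (shade s).1 = imageShade s := by simp only [shade, dif_pos hs]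
    rw [this]
    exact NStar.rep_coe _
  let Q : StarColours :=
    { N := N
      Sh := Sh
      shade := shade
      mem_shade := by
        intro s hs t
        have h1 : (∀ᶠ m in natUltra, t.1.rep m ∈ (shade s).1.rep m) ↔
            (⋃ t' ∈ s, {m | t'.1.rep m = t.1.rep m}) ∈ natUltra := by
          change _ ↔ ∀ᶠ m in natUltra, m ∈ ⋃ t' ∈ s, {m | t'.1.rep m = t.1.rep m}
          refine eventually_congr ?_
          filter_upwards [hshade s hs] with m hm
          rw [hm, Set.mem_iUnion₂]
          simp only [Set.mem_image, Set.mem_ofPred_eq, exists_prop]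
        rw [h1, Ultrafilter.finite_biUnion_mem_iff hs]
        constructor
        · rintro ⟨t', ht', h⟩
          have : t' = t := Subtype.ext (NStar.eq_iff.2 h)
          exact this ▸ ht'
        · exact fun h => ⟨t, h, univ_mem' fun _ => rfl⟩
      ok_shade := by
        intro s hs
        filter_upwards [hshade s hs] with m hm
        rw [hm]
        exact Or.inl (hs.image _) }
  have hpoint : ∀ {f : ℕ → RainbowAtom n}, ∀ᶠ m in natUltra, StarOp.elt ((RStar.point f).rep m) = f m := by
    intro f
    filter_upwards [RStar.rep_mk fun m => {f m}] with m hm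
    rw [RStar.point, hm]
    exact StarOp.elt_mem (Set.singleton_nonempty _)
  -- the order embedding of the countable order `N` in the rationals, reversed
  obtain ⟨φ⟩ : Nonempty (Nᵒᵈ ↪o Set.Ioi (0 : ℚ)) := by
    have : Countable Nᵒᵈ := hN
    exact Order.embedding_from_countable_to_dense _ _
  refine ⟨{ Q with S := S, countable := hS, countable_N := hN
                   nonempty_N := ⟨⟨_, hscale ⟨1, Set.mem_Ioi.2 one_pos⟩⟩⟩, countable_Sh := hSh
                   point_mem := ?_, exists_realizes := ?_, exists_point := ?_
                   ρ := fun t => ⟨_, hscale (φ (OrderDual.toDual t))⟩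
                   strictAnti := fun a b h => StarOp.scaleNum_strictMono (φ.strictMono h) }⟩
  · intro f p hf
    let d : N := ⟨_, hscale ⟨1, Set.mem_Ioi.2 one_pos⟩⟩
    let x' : Pos n → RStar n := fun l => match l with
      | .inl (i, j, false) => encNum hn (Col.fst d (p.e i j)).1
      | .inl (i, j, true) => encNum hn (Col.snd d (p.e i j)).1
      | .inr t => match p.y t with
        | none => encNum hn d.1
        | some S => encShade hn S.1
    have h1 := hcl (.glue (fun i j => (p.e i j).map Col.shape) fun t => (p.y t).map fun _ => ())
      (fun l => x' ((Fintype.equivFin (Pos n)).symm l)) (by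
        intro l
        generalize (Fintype.equivFin (Pos n)).symm l = l'
        rcases l' with ⟨i, j, _ | _⟩ | t
        · exact (Col.fst d (p.e i j)).2
        · exact (Col.snd d (p.e i j)).2
        · change (match p.y t with
            | none => encNum hn d.1
            | some S => encShade hn S.1) ∈ S
          split
          · exact d.2
          · rename_i S _
            exact S.2)
    refine (congrArg (· ∈ S) ?_).mp h1
    refine RStar.mk_eq_mk.2 ?_
    filter_upwards [hf] with m hm
    have h2 : ∀ i j, ((p.e i j).map Col.shape).map (Col.relabel ((Col.fst d (p.e i j)).1.rep m)
        ((Col.snd d (p.e i j)).1.rep m)) = (f m).toPG.e i j := fun i j =>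
      (Col.relabel_fst_snd (fun t : N => t.1.rep m) (p.e i j) d).trans (hm.1 i j).symm
    have h3 : ∀ t, (((p.y t).map fun _ => ()).map fun _ =>
        (Function.invFun (encShade hn) (x' (.inr t))).rep m) = (f m).toPG.y t := by
      intro t
      rw [hm.2 t]
      cases ht : p.y t with
      | none => rfl
      | some S =>
        have : x' (.inr t) = encShade hn S.1 := by simp only [x', ht]
        simp only [this, hinv', Option.map_some]
    simp only [Equiv.symm_apply_apply, h3]
    ext q
    simp only [Set.mem_ofPred_eq, Set.mem_singleton_iff]
    constructor
    · rintro ⟨hq, hq'⟩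
      refine RainbowAtom.toPG_injective (PG.ext (fun i j => ?_) hq')
      rw [hq, ← h2]
      simp only [x', hinv]
    · rintro rfl
      refine ⟨fun i j => ?_, fun _ => rfl⟩
      rw [← h2]
      simp only [x', hinv]
  · intro f hf
    refine StarColours.exists_realizes_of_colours (Q := Q) (fun i j => ?_) fun t => ?_
    · obtain ⟨σ, hσ⟩ := exists_relabel (o := fun m => (f m).toPG.e i j)
        fun m a => (f m).toPG.e_avail i j a
      have h1 := hcl (.fst i j) (fun _ => RStar.point f) fun _ => hf
      have h2 := hcl (.snd i j) (fun _ => RStar.point f) fun _ => hf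
      refine ⟨σ.map (Col.relabel (⟨_, h1⟩ : N) ⟨_, h2⟩), ?_⟩
      filter_upwards [hσ, hpoint (f := f), NStar.rep_coe (fun m => Col.fst 0
        ((StarOp.elt ((RStar.point f).rep m)).toPG.e i j)), NStar.rep_coe (fun m => Col.snd 0
        ((StarOp.elt ((RStar.point f).rep m)).toPG.e i j))] with m hm hf h3 h4
      rw [hf] at h3 h4
      refine hm.trans ?_
      rw [Option.map_map]
      congr 1
      funext c
      refine Eq.trans ?_ (Col.map_relabel _ _ _ c).symm
      exact congrArg₂ (fun a b => c.relabel a b) h3.symm h4.symm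
    · by_cases h : ∀ᶠ m in natUltra, (f m).toPG.y t = none
      · exact ⟨none, h⟩
      · have h1 := hcl (.shade t) (fun _ => RStar.point f) fun _ => hf
        refine ⟨some ⟨_, h1⟩, ?_⟩
        filter_upwards [Ultrafilter.eventually_not.2 h, hpoint (f := f), NStar.rep_coe (fun m =>
          ((StarOp.elt ((RStar.point f).rep m)).toPG.y t).getD ∅)] with m hm hf h3
        rw [hf] at h3
        obtain ⟨S, hS⟩ := Option.ne_none_iff_exists'.1 hm
        rw [hS] at h3 ⊢
        exact congrArg some h3.symm
  · rintro x hx ⟨f, hf⟩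
    refine ⟨_, hcl .pick (fun _ => x) fun _ => hx, ?_⟩
    exact hf.mono fun m hm => StarOp.elt_mem ⟨_, hm⟩

/-! ### The disjoint union of the saturated graphs -/

/-- A disjoint union of Cartesian spaces whose sequences are labelled by the pre-graphs that they
enumerate, so that every pre-graph occurs and every one-node extension of an occurring pre-graph can be
found in the same space. -/
structure SaturatedSpace (P : Palette) (n : ℕ) where
  U : Type
  I : Type
  W : I → Set U
  nonempty_I : Nonempty I
  nonempty : ∀ i, (W i).Nonempty
  disjoint : Pairwise fun i j => Disjoint (W i) (W j)
  lab : spaceOf (Fin n) W → PG P n (Fin n)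
  e_eq_none_iff : ∀ s i j, (lab s).e i j = none ↔ s.1 i = s.1 j
  lab_comp : ∀ s τ, lab ⟨s.1 ∘ τ, comp_mem_spaceOf s.2 τ⟩ = (lab s).comap τ
  agree : ∀ s t i, (∀ j, j ≠ i → s.1 j = t.1 j) → (lab s).AgreeOff i (lab t)
  exists_update : ∀ s i p, PG.AgreeOff i p (lab s) → ∃ t, lab t = p ∧ ∀ j, j ≠ i → t.1 j = s.1 j
  lab_surjective : Function.Surjective lab

theorem exists_saturatedSpace {P : Palette} {n : ℕ} (hn : 3 ≤ n) [Countable P.T] [Countable P.R]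
    [Countable P.Sh] [Nonempty P.R] {ρ₀ : P.T → P.R} (hρ₀ : StrictAnti ρ₀)
    (hP : Nonempty (PG P n (Fin n))) : Nonempty (SaturatedSpace P n) := by
  classical
  choose G v₀ hv₀ using fun p : PG P n (Fin n) => exists_saturatedGraph hn hρ₀ p
  let W : PG P n (Fin n) → Set (Σ p, (G p).W) := fun p => {u | u.1 = p}
  let i₀ : Fin n := ⟨0, by omega⟩
  let mk : ∀ p, (Fin n → (G p).W) → spaceOf (Fin n) W := fun p v => ⟨fun i => ⟨p, v i⟩, p, fun _ => rfl⟩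
  have hmk : ∀ s : spaceOf (Fin n) W, ∃ p v, s = mk p v := by
    rintro ⟨s, p, hs⟩
    have h : ∀ i, ∃ w, s i = ⟨p, w⟩ := by
      intro i
      have h1 : (s i).1 = p := hs i
      subst h1
      exact ⟨(s i).2, rfl⟩
    choose v hv using h
    exact ⟨p, v, Subtype.ext (funext hv)⟩
  have hlt : ∀ (s : spaceOf (Fin n) W) i, (s.1 i).1 = (s.1 i₀).1 := by
    rintro ⟨s, p, hs⟩ i
    exact (hs i : _ = p).trans (hs i₀ : _ = p).symm
  let lab : spaceOf (Fin n) W → PG P n (Fin n) := fun s =>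
    (G (s.1 i₀).1).lab fun i => cast (congrArg (fun p => (G p).W) (hlt s i)) (s.1 i).2
  have hlab : ∀ p v, lab (mk p v) = (G p).lab v := fun p v => rfl
  have hpair : ∀ {p} {w w' : (G p).W}, ((⟨p, w⟩ : Σ p, (G p).W) = ⟨p, w'⟩) ↔ w = w' := by
    intro p w w'
    exact ⟨fun h => eq_of_heq (Sigma.mk.inj h).2, fun h => by rw [h]⟩
  refine ⟨
    { U := Σ p, (G p).W
      I := PG P n (Fin n)
      W := W
      nonempty_I := hP
      nonempty := fun p => ⟨⟨p, v₀ p i₀⟩, rfl⟩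
      disjoint := fun p q hpq => Set.disjoint_left.2 fun u hu hu' =>
        hpq ((hu : u.1 = p).symm.trans hu')
      lab := lab
      e_eq_none_iff := ?_
      lab_comp := ?_
      agree := ?_
      exists_update := ?_
      lab_surjective := fun p => ⟨mk p (v₀ p), (hlab _ _).trans (hv₀ p)⟩ }⟩
  · intro s i j
    obtain ⟨p, v, rfl⟩ := hmk s
    rw [hlab, (G p).e_eq_none_iff]
    exact hpair.symm
  · intro s τ
    obtain ⟨p, v, rfl⟩ := hmk s
    exact (G p).lab_comp v τ
  · intro s t i h
    obtain ⟨p, v, rfl⟩ := hmk s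
    obtain ⟨q, w, rfl⟩ := hmk t
    have : Nontrivial (Fin n) := Fin.nontrivial_iff_two_le.2 (by omega)
    obtain ⟨k, hk⟩ := exists_ne i
    obtain rfl : p = q := (Sigma.mk.inj (h k hk)).1
    exact (G p).agree v w i fun j hj => hpair.1 (h j hj)
  · intro s i H hH
    obtain ⟨p, v, rfl⟩ := hmk s
    obtain ⟨x, hx⟩ := (G p).exists_update v i H hH
    refine ⟨mk p (Function.update v i x), hx, fun j hj => ?_⟩
    exact hpair.2 (Function.update_of_ne hj _ _)

/-! ### The completely representable algebra -/

namespace ClosedStar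

variable {n : ℕ} (hn : 3 ≤ n) (K : ClosedStar n) (L : SaturatedSpace K.palette n)

/-- A nonstandard atom with the given colours. -/
noncomputable def real (p : PG K.palette n (Fin n)) : ℕ → RainbowAtom n :=
  (StarColours.exists_realizes hn p).choose

theorem realizes_real (p : PG K.palette n (Fin n)) : K.toStarColours.Realizes (K.real hn p) p :=
  (StarColours.exists_realizes hn p).choose_spec

theorem real_mem_congr {f : ℕ → RainbowAtom n} {p : PG K.palette n (Fin n)}
    (hf : K.toStarColours.Realizes f p) (x : RStar n) :
    RStar.Mem (K.real hn p) x ↔ RStar.Mem f x := by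
  refine eventually_congr ?_
  filter_upwards [(K.realizes_real hn p).eventuallyEq hf] with m hm
  rw [hm]

/-- Every nonempty internal set in the substructure contains a nonstandard atom with colours from `K`. -/
theorem exists_real_mem {x : RStar n} (hx : x ∈ K.S) {f : ℕ → RainbowAtom n} (hf : RStar.Mem f x) :
    ∃ p, RStar.Mem (K.real hn p) x := by
  obtain ⟨g, hg, hgx⟩ := K.exists_point x hx ⟨f, hf⟩
  obtain ⟨p, hp⟩ := K.exists_realizes g hg
  exact ⟨p, (K.real_mem_congr hn hp x).2 hgx⟩

/-- An element of the substructure, as the set of the sequences labelled by its atoms. -/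
def represent (x : K.S) : Set (spaceOf (Fin n) L.W) := {s | RStar.Mem (K.real hn (L.lab s)) x.1}

open FirstOrder Language

theorem represent_bot (x : Fin 0 → K.S) :
    K.represent hn L (Structure.funMap (L := algLang .PEA (Fin n)) OpSymbol.bot x) = ⊥ := by
  refine Set.ext fun s => (RStar.mem_funMap _ _).trans (iff_of_false (fun h => ?_) id)
  obtain ⟨m, hm⟩ := h.exists
  exact hm

theorem represent_top (x : Fin 0 → K.S) :
    K.represent hn L (Structure.funMap (L := algLang .PEA (Fin n)) OpSymbol.top x) = ⊤ :=
  Set.ext fun _ => (RStar.mem_funMap _ _).trans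
    (iff_of_true (Eventually.of_forall fun _ => trivial) trivial)

theorem represent_compl (x : Fin 1 → K.S) :
    K.represent hn L (Structure.funMap (L := algLang .PEA (Fin n)) OpSymbol.compl x) =
      (K.represent hn L (x 0))ᶜ :=
  Set.ext fun _ => (RStar.mem_funMap _ _).trans Ultrafilter.eventually_not

theorem represent_sup (x : Fin 2 → K.S) :
    K.represent hn L (Structure.funMap (L := algLang .PEA (Fin n)) OpSymbol.sup x) =
      K.represent hn L (x 0) ⊔ K.represent hn L (x 1) :=
  Set.ext fun _ => (RStar.mem_funMap _ _).trans Ultrafilter.eventually_or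

theorem represent_inf (x : Fin 2 → K.S) :
    K.represent hn L (Structure.funMap (L := algLang .PEA (Fin n)) OpSymbol.inf x) =
      K.represent hn L (x 0) ⊓ K.represent hn L (x 1) :=
  Set.ext fun _ => (RStar.mem_funMap _ _).trans eventually_and

theorem represent_c (i : Fin n) (x : Fin 1 → K.S) :
    K.represent hn L (Structure.funMap (L := algLang .PEA (Fin n)) (OpSymbol.c i) x) =
      cylinder i (K.represent hn L (x 0)) := by
  have hc : ∀ (f : ℕ → RainbowAtom n) (y : RStar n),
      RStar.Mem f (Structure.funMap (L := algLang .PEA (Fin n)) (OpSymbol.c i) fun _ => y) ↔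
        ∀ᶠ m in natUltra, ∃ q, q ∈ y.rep m ∧ (f m).AgreeOff i q := fun f y => RStar.mem_funMap _ _
  have hx : x = fun _ => x 0 := funext fun l => congrArg x (Subsingleton.elim l 0)
  generalize x 0 = y at hx
  subst hx
  ext s
  refine (hc _ _).trans ?_
  constructor
  · intro h
    have : Nonempty (RainbowAtom n) := ⟨K.real hn (L.lab s) 0⟩
    obtain ⟨f, hf⟩ := h.choice
    -- the atoms of `y` that agree with the label of `s` form an element of the substructure
    let pt : K.S := ⟨_, K.point_mem _ _ (K.realizes_real hn (L.lab s))⟩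
    let z : K.S := Structure.funMap (L := algLang .PEA (Fin n)) OpSymbol.inf
      ![Structure.funMap (L := algLang .PEA (Fin n)) (OpSymbol.c i) fun _ => pt, y]
    have hz : ∀ g, RStar.Mem g z.1 ↔
        (∀ᶠ m in natUltra, (g m).AgreeOff i (K.real hn (L.lab s) m)) ∧ RStar.Mem g y.1 := by
      intro g
      refine (RStar.mem_funMap _ _).trans (eventually_and.trans (and_congr ?_ Iff.rfl))
      refine (hc g pt.1).trans (eventually_congr ?_)
      filter_upwards [RStar.rep_mk fun m => {K.real hn (L.lab s) m}] with m hm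
      have : pt.1.rep m = {K.real hn (L.lab s) m} := hm
      rw [this]
      simp
    obtain ⟨p, hp⟩ := K.exists_real_mem hn z.2
      ((hz f).2 ⟨hf.mono fun m hm => hm.2.symm, hf.mono fun m hm => hm.1⟩)
    obtain ⟨h1, h2⟩ := (hz _).1 hp
    obtain ⟨t, rfl, ht⟩ := L.exists_update s i p
      (((K.realizes_real hn p).agreeOff_iff (K.realizes_real hn (L.lab s))).2 h1)
    exact ⟨t, h2, ht⟩
  · rintro ⟨t, ht, hts⟩
    have h1 := ((K.realizes_real hn (L.lab s)).agreeOff_iff (K.realizes_real hn (L.lab t))).1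
      (L.agree s t i fun j hj => (hts j hj).symm)
    exact h1.mp (Eventually.mono ht fun m h2 h1 => ⟨_, h2, h1⟩)

theorem represent_d (h : Kind.PEA.HasDiag) (i j : Fin n) (x : Fin 0 → K.S) :
    K.represent hn L (Structure.funMap (L := algLang .PEA (Fin n)) (OpSymbol.d h i j) x) =
      diagonal i j := by
  refine Set.ext fun s => (RStar.mem_funMap _ _).trans ?_
  refine Iff.trans ?_ (L.e_eq_none_iff s i j)
  rw [(K.realizes_real hn (L.lab s)).edge_eq_none_iff]
  refine eventually_congr (Eventually.of_forall fun m => ?_)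
  exact RainbowAtom.edge_eq_none_iff _ i j

theorem represent_s (τ : Fin n → Fin n) (h : Kind.PEA.HasSubst τ) (x : Fin 1 → K.S) :
    K.represent hn L (Structure.funMap (L := algLang .PEA (Fin n)) (OpSymbol.s τ h) x) =
      substitute τ (K.represent hn L (x 0)) := by
  refine Set.ext fun s => (RStar.mem_funMap _ _).trans ?_
  rw [mem_substitute (comp_mem_spaceOf s.2 τ)]
  change _ ↔ RStar.Mem (K.real hn (L.lab _)) _
  rw [L.lab_comp, K.real_mem_congr hn ((K.realizes_real hn (L.lab s)).comap τ)]
  exact eventually_congr (Eventually.of_forall fun m => mem_rainbowS)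

theorem represent_injective : Function.Injective (K.represent hn L) := by
  have key : ∀ x y : K.S, K.represent hn L x ⊆ K.represent hn L y →
      ∀ᶠ m in natUltra, x.1.rep m ⊆ y.1.rep m := by
    intro x y hxy
    by_contra h
    have h1 : ∀ᶠ m in natUltra, ∃ p, p ∈ x.1.rep m ∧ p ∉ y.1.rep m :=
      (Ultrafilter.eventually_not.2 h).mono fun m hm => Set.not_subset.1 hm
    have : Nonempty (RainbowAtom n) := ⟨h1.exists.choose_spec.choose⟩
    obtain ⟨f, hf⟩ := h1.choice
    let z : K.S := Structure.funMap (L := algLang .PEA (Fin n)) OpSymbol.inf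
      ![x, Structure.funMap (L := algLang .PEA (Fin n)) OpSymbol.compl fun _ => y]
    have hz : ∀ g, RStar.Mem g z.1 ↔ RStar.Mem g x.1 ∧ ¬ RStar.Mem g y.1 := fun g =>
      (RStar.mem_funMap _ _).trans (eventually_and.trans (and_congr Iff.rfl
        ((RStar.mem_funMap (OpSymbol.compl : (algLang .PEA (Fin n)).Functions 1) fun _ => y.1).trans
          Ultrafilter.eventually_not)))
    obtain ⟨p, hp⟩ := K.exists_real_mem hn z.2
      ((hz f).2 ⟨hf.mono fun m hm => hm.1, Ultrafilter.eventually_not.1 (hf.mono fun m hm => hm.2)⟩)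
    obtain ⟨s, rfl⟩ := L.lab_surjective p
    exact ((hz _).1 hp).2 (hxy ((hz _).1 hp).1)
  intro x y hxy
  refine Subtype.ext ?_
  rw [← RStar.mk_rep x.1, ← RStar.mk_rep y.1]
  refine RStar.mk_eq_mk.2 ?_
  filter_upwards [key x y hxy.subset, key y x hxy.symm.subset] with m h1 h2
  exact h1.antisymm h2

/-- The represented elements. -/
def represented : BooleanSubalgebra (Set (spaceOf (Fin n) L.W)) where
  carrier := Set.range (K.represent hn L)
  supClosed' := by
    rintro _ ⟨x, rfl⟩ _ ⟨y, rfl⟩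
    exact ⟨_, K.represent_sup hn L ![x, y]⟩
  infClosed' := by
    rintro _ ⟨x, rfl⟩ _ ⟨y, rfl⟩
    exact ⟨_, K.represent_inf hn L ![x, y]⟩
  compl_mem' := by
    rintro _ ⟨x, rfl⟩
    exact ⟨_, K.represent_compl hn L fun _ => x⟩
  bot_mem' := ⟨_, K.represent_bot hn L Fin.elim0⟩

/-- The set algebra of the represented elements. -/
noncomputable def setAlgebra : Alg.{0} .PEA (Fin n) where
  carrier := K.represented hn L
  c := fun i X => ⟨cylinder i X.1, by
    obtain ⟨_, x, rfl⟩ := X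
    exact ⟨_, K.represent_c hn L i fun _ => x⟩⟩
  d := fun h i j => ⟨diagonal i j, _, K.represent_d hn L h i j Fin.elim0⟩
  s := fun τ h X => ⟨substitute τ X.1, by
    obtain ⟨_, x, rfl⟩ := X
    exact ⟨_, K.represent_s hn L τ h fun _ => x⟩⟩

/-- The substructure is isomorphic to the set algebra. -/
noncomputable def equivSetAlgebra : K.S ≃[algLang .PEA (Fin n)] K.setAlgebra hn L where
  toEquiv := Equiv.ofInjective _ (K.represent_injective hn L)
  map_fun' := by
    intro k o x
    refine Subtype.ext ?_
    cases o with
    | bot => exact K.represent_bot hn L x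
    | top => exact K.represent_top hn L x
    | compl => exact K.represent_compl hn L x
    | sup => exact K.represent_sup hn L x
    | inf => exact K.represent_inf hn L x
    | c i => exact K.represent_c hn L i x
    | d h i j => exact K.represent_d hn L h i j x
    | s τ h => exact K.represent_s hn L τ h x
  map_rel' := fun r => r.elim

theorem countable_setAlgebra : Countable (K.setAlgebra hn L) :=
  have := K.countable
  (K.equivSetAlgebra hn L).toEquiv.symm.injective.countable

theorem elementarilyEquivalent_setAlgebra :
    (algLang .PEA (Fin n)).ElementarilyEquivalent (rainbowAlg n) (K.setAlgebra hn L) := by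
  have h1 : (algLang .PEA (Fin n)).ElementarilyEquivalent (rainbowAlg n) (RStar n) := by
    refine elementarilyEquivalent_iff.2 fun φ => ?_
    rw [Ultraproduct.sentence_realize, eventually_const]
  have h2 := K.S.elementarilyEquivalent
  have h3 := StrongHomClass.elementarilyEquivalent (K.equivSetAlgebra hn L)
  exact h1.trans (h2.symm.trans h3)

/-- The set of all sequences with a given label. -/
def fibre (p : PG K.palette n (Fin n)) : K.setAlgebra hn L :=
  ⟨{s | L.lab s = p}, ⟨_, K.point_mem _ _ (K.realizes_real hn p)⟩, Set.ext fun s => by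
    refine RStar.mem_point.trans ⟨fun h => ?_, fun h => ?_⟩
    · refine PG.ext (fun i j => StarColours.eq_iff_map_eval.2 ?_) fun t =>
        StarColours.eq_iff_map_rep.2 ?_
      · filter_upwards [h, K.realizes_real hn p, K.realizes_real hn (L.lab s)] with m h h1 h2
        rw [← h1.1, ← h2.1, h]
      · filter_upwards [h, K.realizes_real hn p, K.realizes_real hn (L.lab s)] with m h h1 h2
        rw [← h1.2, ← h2.2, h]
    · have : L.lab s = p := h
      rw [this]
      exact Eventually.of_forall fun _ => rfl⟩

theorem mem_fibre {p : PG K.palette n (Fin n)} {s : spaceOf (Fin n) L.W} :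
    s ∈ (K.fibre hn L p).1 ↔ L.lab s = p := Iff.rfl

/-- The elements of the set algebra are unions of fibres. -/
theorem fibre_le {X : K.setAlgebra hn L} {s : spaceOf (Fin n) L.W} (hs : s ∈ X.1) :
    K.fibre hn L (L.lab s) ≤ X := by
  obtain ⟨_, x, rfl⟩ := X
  intro t ht
  have h1 : L.lab t = L.lab s := ht
  change RStar.Mem _ _
  rw [h1]
  exact hs

theorem isAtom_fibre (p : PG K.palette n (Fin n)) : IsAtom (K.fibre hn L p) := by
  obtain ⟨s, hs⟩ := L.lab_surjective p
  refine ⟨fun h => ?_, fun X hX => ?_⟩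
  · have h1 : s ∈ (⊥ : K.setAlgebra hn L).1 := h ▸ (hs : s ∈ (K.fibre hn L p).1)
    exact h1
  · by_contra hne
    have h1 : X.1.Nonempty := Set.nonempty_iff_ne_empty.2 fun h => hne (Subtype.ext h)
    obtain ⟨t, ht⟩ := h1
    have h2 : L.lab t = p := hX.le ht
    exact hX.not_ge (h2 ▸ K.fibre_le hn L ht)

theorem isAtomic_setAlgebra : IsAtomic (K.setAlgebra hn L) := by
  refine ⟨fun X => or_iff_not_imp_left.2 fun hX => ?_⟩
  obtain ⟨s, hs⟩ : X.1.Nonempty := Set.nonempty_iff_ne_empty.2 fun h => hX (Subtype.ext h)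
  exact ⟨_, K.isAtom_fibre hn L _, K.fibre_le hn L hs⟩

theorem completelyRepresentable_setAlgebra : CompletelyRepresentable (K.setAlgebra hn L) := by
  refine ⟨L.U, spaceOf (Fin n) L.W, ⟨L.I, L.W, L.nonempty_I, L.nonempty, L.disjoint, rfl⟩,
    Subtype.val, Subtype.val_injective, ⟨rfl, rfl, fun _ => rfl, fun _ _ => rfl, fun _ _ => rfl,
      fun _ _ => rfl, fun _ _ _ => rfl, fun _ _ _ => rfl⟩, fun X a ha => ⟨?_, fun Y hY s hs => ?_⟩⟩
  · rintro _ ⟨x, hx, rfl⟩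
    exact ha.1 hx
  · -- the fibre of a common element is a lower bound
    refine ha.2 (fun x hx => ?_) ((K.mem_fibre hn L).2 rfl : s ∈ (K.fibre hn L (L.lab s)).1)
    exact K.fibre_le hn L (hY ⟨x, hx, rfl⟩ hs)

end ClosedStar

/-- The completely representable algebra: a countable elementary substructure of an ultrapower of the
rainbow algebra. -/
theorem exists_completelyRepresentable {n : ℕ} (hn : 3 ≤ n) : ∃ B : Alg.{0} .PEA (Fin n),
    Countable B ∧ IsAtomic B ∧ CompletelyRepresentable B ∧
      (algLang .PEA (Fin n)).ElementarilyEquivalent (rainbowAlg n) B := by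
  obtain ⟨K⟩ := exists_closedStar hn
  have := K.countable_N
  have := K.countable_Sh
  have := K.nonempty_N
  -- the top element has an atom, so there is a pre-graph
  have hP : Nonempty (PG K.palette n (Fin n)) := by
    have h : RStar.Mem (fun _ => coneAtom hn 0) (FirstOrder.Language.Structure.funMap
        (L := algLang .PEA (Fin n)) OpSymbol.top fun l => l.elim0 : K.S).1 :=
      (RStar.mem_funMap _ _).2 (Eventually.of_forall fun _ => trivial)
    exact ⟨(K.exists_real_mem hn (Subtype.prop _) h).choose⟩
  obtain ⟨L⟩ := exists_saturatedSpace (P := K.palette) hn K.strictAnti hP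
  exact ⟨K.setAlgebra hn L, K.countable_setAlgebra hn L, K.isAtomic_setAlgebra hn L,
    K.completelyRepresentable_setAlgebra hn L, K.elementarilyEquivalent_setAlgebra hn L⟩

theorem mainTheorem2 (n : ℕ) (hn : 3 ≤ n) :
    -- the rainbow algebra of dimension `n`
    (rainbowAlg n ∈ variety .PEA (Fin n) ∧
      IsAtomic (rainbowAlg n) ∧
      {a : rainbowAlg n | IsAtom a}.Countable ∧
      (rainbowAlg n).rdSc ∉
        completeSub (Nr (Fin.castAddEmb 3) (variety.{0} .Sc (Fin (n + 3)))) ∧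
      ∃ B : Alg.{0} .PEA (Fin n),
        Countable B ∧ IsAtomic B ∧
        B ∈ completeSub (Nr Fin.valEmbedding (variety.{0} .PEA ℕ)) ∧
        CompletelyRepresentable B ∧
        (algLang .PEA (Fin n)).ElementarilyEquivalent (rainbowAlg n) B) ∧
    -- the consequences, for each kind of algebras
    ∀ k : Kind,
      (∀ L : Set (Alg.{u} k (Fin n)),
        completeSub (Nr Fin.valEmbedding (variety.{u} k ℕ)) ⊆ L →
        L ⊆ completeSub (Nr (Fin.castAddEmb 3) (variety.{u} k (Fin (n + 3)))) →
        ¬ IsElementary L) ∧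
      ¬ IsElementary (completelyRepresentables.{u} k (Fin n)) := by
  obtain ⟨B, hcount, hatomic, hrep, hequiv⟩ := exists_completelyRepresentable hn
  have : Nontrivial (Fin n) := Fin.nontrivial_iff_two_le.2 (by omega)
  exact ⟨⟨rainbowAlg_mem_variety hn, rainbowAlg_isAtomic, rainbowAlg_countable_atoms,
    rdSc_notMem_completeSub_Nr hn, B, hcount, hatomic, hrep.mem_completeSub _, hrep, hequiv⟩,
    not_isElementary_of_elementarilyEquivalent hn hrep hequiv⟩
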